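/- **Notation and definitions.** Let $G$ be an abelian group, written additively, $|\cdot|$ cardinality. For a finite generating subset $S$ of $G$ with $0\in S$ and $X\subseteq G$ finite put $\partial_S(X)=(X+S)\setminus X$ and $X^S=G\setminus(X+S)$. For $k\ge 1$ let $$\kappa_k(S)=\min\{|\partial_S(X)| : X \text{ finite},\ |X|\ge k,\ |X^S|\ge k\},$$ with $\min\emptyset=|G|-2k+1$. A finite set $X$ with $|X|\ge k$, $|X^S|\ge k$ and $|\partial_S(X)|=\kappa_k(S)$ is a *$k$-fragment* of $S$. The set $S$ is *degenerate* if some subgroup of $G$ is a $2$-fragment of $S$; a subgroup that is maximal among the subgroups that are $2$-fragments of $S$ is a *hyper-atom* of $S$. For a nonempty set $X$, $X^*$ denotes an arbitrary translate of $X$ containing $0$. Let $H$ be a subgroup of $G$. A set $A$ is *$H$-periodic* if $A+H=A$, *aperiodic* if it is not $K$-periodic for any nonzero subgroup $K$, and *$(H,-j)$-periodic* if it is obtained from an $H$-periodic set by deleting $j$ elements. An *$H$-decomposition* of $A$ is a partition $A=\bigcup_{i} A_i$ in which each $A_i$ is the nonempty intersection of $A$ with an $H$-coset. An *$H$-progression*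 with difference $d\in G/H$ is an $H$-decomposition $A=\bigcup_{0\le i\le u}A_i$ such that $A_i+H+d=A_{i+1}+H$ for $0\le i\le u-1$. The pair $\{S,T\}$ is an *$H$-essential pair* if there are $H$-progressions $S=\bigcup_{0\le i\le u}S_i$, $T=\bigcup_{0\le i\le t}T_i$ with the same difference such that $|S+H|-|S|=|T+H|-|T|=|H|$ and one of the following holds: * (a) $|H|-1=|S_0|=|S_u|=|T_0|=|T_t|=1$; * (b) $u,t\ge 1$, $|S_u|=|T_t|=1$, $|S_{u-1}|=|T_{t-1}|=|H|-1$ and $T_{t-1}+S_u=T_t+S_{u-1}$; * (c) there are subgroups $K_0,K_1$ of order $2$ such that $H=K_0\oplus K_1$, $S_0^*=T_0^*=K_0$ and $S_u^*=T_t^*=K_1$. **Theorem.** Let $\mu\in\{0,1\}$. Let $S$ be a finite degenerate generating subset of an abelian group $G$ with $0\in S$, and let $H$ be a hyper-atom of $S$. Let $T$ be a finite subset of $G$ such that $$3-\mu\le |S|\le \max(4-2\mu,|S|)\le |T|,$$ $S+T$ is aperiodic and $$|S+T|=|S|+|T|-\mu\le \frac{2|G|+2\mu}{3}$$ (the last inequality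 being void if $G$ is infinite). Then one of the following holds: * (i) $\mu=0$, $T^*$ generates $G$, and $|G|=3|S|=3|T|=4\kappa_2(T^*)=12$; * (ii) $\mu=0$ and $\{S,T\}$ is an $H$-essential pair; * (iii) there are $H$-progressions $S=\bigcup_{0\le i\le u}S_i$ and $T=\bigcup_{0\le i\le t}T_i$ with the same difference and an integer $\nu$ with $0\le\nu\le 1-\mu$ such that one of the sets $S\setminus S_u$, $T\setminus T_t$ is $H$-periodic and the other is $(H,-\nu)$-periodic, and $|T_t+S_u|=|T_t|+|S_u|-\nu-\mu$. Moreover $|T+H|-|T|\le |H|-\mu$. -/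

import Mathlib

open scoped Pointwise

namespace SmallSumset

section Isoperimetric

variable {G : Type*} [AddCommGroup G] [DecidableEq G]

/-- The boundary `∂_S(X) = (X + S) \ X`. -/
def boundary (S X : Finset G) : Finset G := (X + S) \ X

/-- The exterior `X^S = G \ (X + S)`; it may be infinite. -/
def exterior (S X : Finset G) : Set G := ((X + S : Finset G) : Set G)ᶜ

/-- The finite sets `X` with `|X| ≥ k` and `|X^S| ≥ k`. -/
def IsAdmissible (k : ℕ) (S X : Finset G) : Prop :=
  k ≤ X.card ∧ (k : ℕ∞) ≤ (exterior S X).encard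

open Classical in
/-- The `k`-th connectivity `κ_k(S)` of a finite set `S`: the minimum of `|∂_S(X)|` over the
admissible sets `X`, and `|G| - 2k + 1` if there are none (this can only happen for finite `G`;
the notion is meant for `|G| ≥ 2k - 1`). -/
noncomputable def connectivity (k : ℕ) (S : Finset G) : ℕ :=
  if ∃ X : Finset G, IsAdmissible k S X then
    sInf {m : ℕ | ∃ X : Finset G, IsAdmissible k S X ∧ (boundary S X).card = m}
  else Nat.card G + 1 - 2 * k

/-- `X` is a `k`-fragment of `S`. -/
def IsFragment (k : ℕ) (S X : Finset G) : Prop :=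
  IsAdmissible k S X ∧ (boundary S X).card = connectivity k S

/-- The subgroup `K` is (finite and) a `k`-fragment of `S`. -/
def IsSubgroupFragment (k : ℕ) (S : Finset G) (K : AddSubgroup G) : Prop :=
  ∃ X : Finset G, (X : Set G) = (K : Set G) ∧ IsFragment k S X

/-- `S` is degenerate: some subgroup is a `2`-fragment of `S`. -/
def IsDegenerate (S : Finset G) : Prop :=
  ∃ K : AddSubgroup G, IsSubgroupFragment 2 S K

/-- `H` is a hyper-atom of `S`: a maximal subgroup among those that are `2`-fragments of `S`. -/
def IsHyperAtom (S : Finset G) (H : AddSubgroup G) : Prop :=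
  Maximal (IsSubgroupFragment 2 S) H

end Isoperimetric

section Periodicity

variable {G : Type*} [AddCommGroup G] [DecidableEq G]

/-- `A` is `H`-periodic: `A + H = A`, that is, `A` is a union of `H`-cosets. -/
def IsPeriodic (H : AddSubgroup G) (A : Finset G) : Prop :=
  (A : Set G) + (H : Set G) = (A : Set G)

/-- `A` is aperiodic: it is not `K`-periodic for any nonzero subgroup `K`. -/
def IsAperiodic (A : Finset G) : Prop :=
  ∀ K : AddSubgroup G, IsPeriodic K A → K = ⊥

/-- `A` is `(H, -j)`-periodic: it arises from an `H`-periodic set by deleting `j` elements. -/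
def IsNearPeriodic (H : AddSubgroup G) (j : ℕ) (A : Finset G) : Prop :=
  ∃ B D : Finset G, IsPeriodic H B ∧ D ⊆ B ∧ D.card = j ∧ A = B \ D

/-- `A = X 0 ∪ ⋯ ∪ X u` is an `H`-decomposition: a partition of `A` each of whose pieces is
the nonempty intersection of `A` with an `H`-coset. -/
structure IsDecomposition (H : AddSubgroup G) (A : Finset G) (u : ℕ) (X : ℕ → Finset G) :
    Prop where
  nonempty : ∀ i ≤ u, (X i).Nonempty
  coset : ∀ i ≤ u, ∃ a : G, (X i : Set G) = (a +ᵥ (H : Set G)) ∩ (A : Set G)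
  disjoint : ∀ i ≤ u, ∀ j ≤ u, i ≠ j → Disjoint (X i) (X j)
  union : A = (Finset.range (u + 1)).biUnion X

/-- `A = X 0 ∪ ⋯ ∪ X u` is an `H`-progression with difference `d ∈ G ⧸ H`: an
`H`-decomposition such that the coset of `X (i + 1)` is the coset of `X i` plus `d`. -/
structure IsCosetProgression (H : AddSubgroup G) (d : G ⧸ H) (A : Finset G) (u : ℕ)
    (X : ℕ → Finset G) : Prop extends IsDecomposition H A u X where
  step : ∀ i < u, ∀ x ∈ X i, ∀ y ∈ X (i + 1), (y : G ⧸ H) = (x : G ⧸ H) + d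

/-- `A` is a translate of the subgroup `K` (equivalently, the translates of `A` that contain `0`
are equal to `K`). -/
def IsTranslateOf (A : Finset G) (K : AddSubgroup G) : Prop :=
  ∃ a : G, (A : Set G) = a +ᵥ (K : Set G)

/-- `{S, T}` is an `H`-essential pair. Each of the three alternatives forces `H` to be finite. -/
def IsEssentialPair (H : AddSubgroup G) (S T : Finset G) : Prop :=
  ∃ (d : G ⧸ H) (u t : ℕ) (X Y : ℕ → Finset G),
    IsCosetProgression H d S u X ∧ IsCosetProgression H d T t Y ∧
    ((S : Set G) + (H : Set G)).ncard = S.card + Nat.card H ∧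
    ((T : Set G) + (H : Set G)).ncard = T.card + Nat.card H ∧
    ((Nat.card H = 2 ∧
        (X 0).card = 1 ∧ (X u).card = 1 ∧ (Y 0).card = 1 ∧ (Y t).card = 1) ∨
      (1 ≤ u ∧ 1 ≤ t ∧ (X u).card = 1 ∧ (Y t).card = 1 ∧
        (X (u - 1)).card + 1 = Nat.card H ∧ (Y (t - 1)).card + 1 = Nat.card H ∧
        Y (t - 1) + X u = Y t + X (u - 1)) ∨
      (∃ K₀ K₁ : AddSubgroup G, Nat.card K₀ = 2 ∧ Nat.card K₁ = 2 ∧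
        K₀ ⊔ K₁ = H ∧ K₀ ⊓ K₁ = ⊥ ∧
        IsTranslateOf (X 0) K₀ ∧ IsTranslateOf (Y 0) K₀ ∧
        IsTranslateOf (X u) K₁ ∧ IsTranslateOf (Y t) K₁))

end Periodicity

end SmallSumset

open SmallSumset

/-!
The proof passes to the quotient `φ : G → G / H` and describes `S`, `T` and `T + S` by their images
and by the fibres of `φ`. That `H` is a `2`-fragment of `S` determines the connectivity of `S`:
`|X + S| ≥ |X| + |φ(S)| |H| - |H|` for every admissible `X`. Applied to unions of cosets, this says
that sumsets of `φ(S)` satisfy the Cauchy-Davenport bound; by the maximality of `H` the bound is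
strict for sums with nonzero subgroups. A set with these properties is called rigid (`IsRigid`), and
`Config` collects what is known about `S` and `T` (`IsHyperAtom.config`).

Two general tools are proved first: Kneser's theorem (`kneser`), by Dyson transforms and a union
lemma for sets with different stabilizers, and a Vosper property of rigid sets (`IsRigid.vosper`):
if no two-element set has the smallest possible sumset with `φ(S)`, then no admissible set has. The
latter rests on the structure of the smallest sets attaining the minimum, whose translates share at
most one element unless they are cosets of subgroups.

Counting level by level, according to the sizes of the fibres, shows that `φ(T) + φ(S)` itself is as
small as the Cauchy-Davenport bound (`Config.card_image_add_le`). From this `φ(S)` and `φ(T)` turn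
out to be progressions with the same difference (`Config.shape`):

* If `T + S` misses a coset, then by the Vosper property, used for `T` and for the negative of the
  complement of `T + S`, some pair `{0, y}` attains the bound with `φ(S)`
  (`Config.exists_small_union`).
* If `T + S` meets all cosets, then `φ(S)` has just two elements (`Config.card_image_eq_two`). If
  `T` misses a coset, it follows that `φ(T)` is a progression. If `T` meets all cosets, then there
  are three of them (`TwoCosets.card_eq_three`), and `T` is a four-term progression in a cyclic
  group of order twelve (`ThreeCosets.exists_run`); this is the exceptional case, where the
  connectivity of `T` is computed in `connectivity_run`.

For progressions, all that matters is where the fibres of `S`, `T` and `T + S` have holes, that is,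
how far they are from being whole cosets. Two fibres whose holes number less than `|H|` have a whole
coset as their sum, and the connectivity gives a lower bound for the holes of two consecutive fibres
of the sumset. These constraints imply that the sumset has at most as many holes as `S`
(`HoleChain.sum_d_le`), and that the holes lie next to the ends (`HoleChain.classify`). Kneser's
theorem within a coset then identifies the end fibres (`CosetChain.chainEnd`): either they form an
essential pair, or all fibres but the last ones are whole cosets, up to one element.
-/

set_option linter.unusedSectionVars false

namespace SmallSumset

/-! ### Stabilizers and Kneser's theorem -/

section Kneser

variable {G : Type*} [AddCommGroup G] [DecidableEq G]

/-- The elements of a finite subgroup, as a `Finset`. -/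
noncomputable def elts (K : AddSubgroup G) [Finite K] : Finset G :=
  (Set.toFinite (K : Set G)).toFinset

@[simp] theorem mem_elts {K : AddSubgroup G} [Finite K] {g : G} : g ∈ elts K ↔ g ∈ K := by
  simp [elts]

theorem card_elts (K : AddSubgroup G) [Finite K] : (elts K).card = Nat.card K := by
  rw [elts, ← Set.ncard_eq_toFinset_card (K : Set G), ← Nat.card_coe_set_eq]
  rfl

/-- The stabilizer (group of periods) of a finite set under translation. -/
def stab (C : Finset G) : AddSubgroup G where
  carrier := {g | ∀ x, g + x ∈ C ↔ x ∈ C}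
  zero_mem' := by simp
  add_mem' := by
    intro a b ha hb x
    rw [add_assoc]
    exact (ha _).trans (hb _)
  neg_mem' := by
    intro a ha x
    have := ha (-a + x)
    rw [add_neg_cancel_left] at this
    exact this.symm

theorem mem_stab {C : Finset G} {g : G} : g ∈ stab C ↔ ∀ x, g + x ∈ C ↔ x ∈ C := Iff.rfl

/-- For a finite set it suffices to check that translation maps the set into itself. -/
theorem mem_stab_of_forall {C : Finset G} {g : G} (h : ∀ x ∈ C, g + x ∈ C) : g ∈ stab C := by
  have himg : C.image (g + ·) = C := by
    apply Finset.eq_of_subset_of_card_le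
    · intro y hy
      obtain ⟨x, hx, rfl⟩ := Finset.mem_image.1 hy
      exact h x hx
    · rw [Finset.card_image_of_injective _ (add_right_injective g)]
  intro x
  constructor
  · intro hx
    rw [← himg] at hx
    obtain ⟨y, hy, hyx⟩ := Finset.mem_image.1 hx
    rwa [← add_left_cancel hyx]
  · exact h x

theorem finite_stab {C : Finset G} (hC : C.Nonempty) : Finite (stab C) := by
  obtain ⟨c, hc⟩ := hC
  have : ((stab C : AddSubgroup G) : Set G) ⊆ ((C.image (fun x => x - c) : Finset G) : Set G) := by
    intro g hg
    have := (mem_stab.1 hg c).2 hc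
    simp only [Finset.coe_image, Set.mem_image, Finset.mem_coe]
    exact ⟨g + c, this, by abel⟩
  exact (Set.Finite.subset (Finset.finite_toSet _) this).to_subtype

theorem stab_image_add (C : Finset G) (b : G) : stab (C.image (· + b)) = stab C := by
  have key : ∀ x, x ∈ C.image (· + b) ↔ x - b ∈ C := by
    intro x
    simp only [Finset.mem_image]
    constructor
    · rintro ⟨y, hy, rfl⟩; simpa using hy
    · intro h; exact ⟨x - b, h, by abel⟩
  ext g
  simp only [mem_stab, key]
  constructor
  · intro h x
    have := h (x + b)
    simpa [add_sub_assoc] using this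
  · intro h x
    have := h (x - b)
    rwa [← add_sub_assoc] at this

theorem add_elts_stab {C : Finset G} [Finite (stab C)] : C + elts (stab C) = C := by
  ext x
  rw [Finset.mem_add]
  constructor
  · rintro ⟨c, hc, k, hk, rfl⟩
    rw [add_comm]
    exact (mem_stab.1 (mem_elts.1 hk) c).2 hc
  · intro hx
    exact ⟨x, hx, 0, mem_elts.2 (zero_mem _), add_zero x⟩

theorem add_elts_eq_self {C : Finset G} {K : AddSubgroup G} [Finite K] (hK : K ≤ stab C) :
    C + elts K = C := by
  ext x
  rw [Finset.mem_add]
  constructor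
  · rintro ⟨c, hc, k, hk, rfl⟩
    rw [add_comm]
    exact (mem_stab.1 (hK (mem_elts.1 hk)) c).2 hc
  · intro hx
    exact ⟨x, hx, 0, mem_elts.2 (zero_mem _), add_zero x⟩

theorem le_stab_add_elts (C : Finset G) (K : AddSubgroup G) [Finite K] :
    K ≤ stab (C + elts K) := by
  intro k hk
  apply mem_stab_of_forall
  intro x hx
  obtain ⟨c, hc, l, hl, rfl⟩ := Finset.mem_add.1 hx
  refine Finset.mem_add.2 ⟨c, hc, k + l, mem_elts.2 (add_mem hk (mem_elts.1 hl)), by abel⟩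

theorem stab_le_stab_add_left (A B : Finset G) : stab A ≤ stab (A + B) := by
  intro k hk
  apply mem_stab_of_forall
  intro x hx
  obtain ⟨a, ha, b, hb, rfl⟩ := Finset.mem_add.1 hx
  exact Finset.mem_add.2 ⟨k + a, (mem_stab.1 hk a).2 ha, b, hb, by abel⟩

theorem stab_le_stab_add_right (A B : Finset G) : stab B ≤ stab (A + B) := by
  rw [add_comm]; exact stab_le_stab_add_left B A

theorem subset_add_elts (C : Finset G) (K : AddSubgroup G) [Finite K] : C ⊆ C + elts K :=
  fun x hx => Finset.mem_add.2 ⟨x, hx, 0, mem_elts.2 (zero_mem _), add_zero x⟩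

/-- A nonempty set invariant under a subgroup has at least as many elements as the subgroup. -/
theorem card_le_of_le_stab {C : Finset G} {K : AddSubgroup G} [Finite K] (hC : C.Nonempty)
    (hK : K ≤ stab C) : Nat.card K ≤ C.card := by
  obtain ⟨c, hc⟩ := hC
  rw [← card_elts, ← Finset.card_image_of_injective (elts K) (add_left_injective c)]
  apply Finset.card_le_card
  intro x hx
  obtain ⟨k, hk, rfl⟩ := Finset.mem_image.1 hx
  exact (mem_stab.1 (hK (mem_elts.1 hk)) c).2 hc

/-- If `U ⊆ H₂` and `V ⊆ H₁` are such that all sums `x + y + z` land in `E`, then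
`|V| |U| ≤ |H₁ ∩ H₂| |E|`, since each sum has at most `|H₁ ∩ H₂|` representations. -/
theorem card_mul_card_le_of_sums {H₁ H₂ : AddSubgroup G} [Finite H₁] [Finite H₂]
    {U V E : Finset G} (hU : U ⊆ elts H₂) (hV : V ⊆ elts H₁) (x : G)
    (hE : ∀ y ∈ V, ∀ z ∈ U, x + y + z ∈ E) :
    V.card * U.card ≤ Nat.card (H₁ ⊓ H₂ : AddSubgroup G) * E.card := by
  have hfin : Finite (H₁ ⊓ H₂ : AddSubgroup G) :=
    Set.Finite.subset (Set.toFinite (H₁ : Set G)) (fun y hy => hy.1)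
  rw [← Finset.card_product]
  apply Finset.card_le_mul_card_image_of_maps_to (f := fun p : G × G => x + p.1 + p.2)
  · intro p hp
    obtain ⟨h1, h2⟩ := Finset.mem_product.1 hp
    exact hE _ h1 _ h2
  · intro e _
    by_cases hne : (Finset.filter (fun p : G × G => x + p.1 + p.2 = e) (V ×ˢ U)).Nonempty
    · obtain ⟨p₀, hp₀⟩ := hne
      rw [← card_elts]
      apply Finset.card_le_card_of_injOn (fun p : G × G => p.1 - p₀.1)
      · intro p hp
        simp only [Finset.coe_filter, Finset.mem_product, Set.mem_setOf_eq, Finset.mem_filter]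
          at hp hp₀
        have e1 : p.1 - p₀.1 = p₀.2 - p.2 := by
          have := hp.2.trans hp₀.2.symm
          have h3 : p.1 + p.2 = p₀.1 + p₀.2 := by
            rw [add_assoc, add_assoc] at this; exact add_left_cancel this
          rw [sub_eq_sub_iff_add_eq_add, h3, add_comm]
        simp only [Finset.mem_coe, mem_elts, AddSubgroup.mem_inf]
        constructor
        · exact sub_mem (mem_elts.1 (hV hp.1.1)) (mem_elts.1 (hV hp₀.1.1))
        · rw [e1]
          exact sub_mem (mem_elts.1 (hU hp₀.1.2)) (mem_elts.1 (hU hp.1.2))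
      · intro p hp q hq hpq
        simp only [Finset.coe_filter, Finset.mem_product, Set.mem_setOf_eq] at hp hq hpq
        have h1 : p.1 = q.1 := sub_left_injective hpq
        have h2 : p.2 = q.2 := by
          have := hp.2.trans hq.2.symm
          rw [h1] at this
          exact add_left_cancel this
        exact Prod.ext h1 h2
    · rw [Finset.not_nonempty_iff_eq_empty.1 hne]; simp

/-- The counting step of the union lemma. An `h₁ × h₂` grid is cut by `b` rows and `a` columns; `E`
and `F` bound the two opposite blocks `b × a` and `(h₁ - b) × (h₂ - a)`, up to the multiplicity `d`.
If no side of the blocks is shorter than `d` unless it vanishes, then `h₁ ≤ E + d` or `h₂ ≤ F + d`;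
the case of `h₂` columns requires `h₁ ≤ h₂`. -/
theorem grid_arith {h₁ h₂ d a b E F : ℕ} (hd : 0 < d) (ha : d ≤ a) (hb : d ≤ b)
    (ha2 : a ≤ h₂) (hb1 : b ≤ h₁) (ha' : h₂ - a = 0 ∨ d ≤ h₂ - a)
    (hb' : h₁ - b = 0 ∨ d ≤ h₁ - b) (hE : b * a ≤ d * E)
    (hF : (h₂ - a) * (h₁ - b) ≤ d * F) (hfull : h₂ - a = 0 → h₁ ≤ h₂) :
    h₁ ≤ E + d ∨ h₂ ≤ F + d := by
  obtain ⟨a', rfl⟩ := Nat.exists_eq_add_of_le ha2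
  obtain ⟨b', rfl⟩ := Nat.exists_eq_add_of_le hb1
  simp only [Nat.add_sub_cancel_left] at *
  rcases Nat.eq_zero_or_pos b' with rfl | hb0
  · left
    have : d * b ≤ d * E := by nlinarith
    have := Nat.le_of_mul_le_mul_left this hd
    omega
  rcases Nat.eq_zero_or_pos a' with rfl | ha0
  · left
    have h1 := hfull rfl
    have : d * (b + b') ≤ d * E := by nlinarith
    have := Nat.le_of_mul_le_mul_left this hd
    omega
  have ha'' : d ≤ a' := by omega
  have hb'' : d ≤ b' := by omega
  by_cases hab : b' ≤ a
  · left
    obtain ⟨p, rfl⟩ := Nat.exists_eq_add_of_le ha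
    obtain ⟨q, rfl⟩ := Nat.exists_eq_add_of_le hb
    have : d * (d + q + b') ≤ d * (E + d) := by nlinarith [Nat.zero_le (p * q)]
    exact Nat.le_of_mul_le_mul_left this hd
  · right
    obtain ⟨p, rfl⟩ := Nat.exists_eq_add_of_le ha''
    obtain ⟨q, rfl⟩ := Nat.exists_eq_add_of_le hb''
    have : d * (a + (d + p)) ≤ d * (F + d) := by nlinarith [Nat.zero_le (p * q)]
    exact Nat.le_of_mul_le_mul_left this hd

/-- One coset of `H₁ + H₂`, where `H₁`, `H₂` are the stabilizers of `C₁`, `C₂`: if it meets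
`C₂ \ C₁`, then one of the two set differences is large. The exceptional possibility is that
the coset misses `C₁` altogether and `|H₂| < |H₁|`. -/
theorem sdiff_card_of_coset {C₁ C₂ : Finset G} [Finite (stab C₁)] [Finite (stab C₂)] {x : G}
    (hx2 : x ∈ C₂) (hx1 : x ∉ C₁)
    (hfull : (∀ z ∈ stab C₂, x + z ∉ C₁) → Nat.card (stab C₁) ≤ Nat.card (stab C₂)) :
    Nat.card (stab C₁) ≤ (C₂ \ C₁).card + Nat.card (stab C₁ ⊓ stab C₂ : AddSubgroup G) ∨
    Nat.card (stab C₂) ≤ (C₁ \ C₂).card + Nat.card (stab C₁ ⊓ stab C₂ : AddSubgroup G) := by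
  set H₁ := stab C₁ with hH₁
  set H₂ := stab C₂ with hH₂
  have hfin : Finite (H₁ ⊓ H₂ : AddSubgroup G) :=
    Set.Finite.subset (Set.toFinite (H₁ : Set G)) (fun y hy => hy.1)
  -- The coset of `H₁ + H₂` through `x` is parametrized by `x + y + z` with `y ∈ H₁`, `z ∈ H₂`.
  -- Membership in `C₁` depends on `z` only and membership in `C₂` on `y` only, so `V × U` maps into
  -- `C₂ \ C₁` and `V' × U'` into `C₁ \ C₂`.
  set U := (elts H₂).filter (fun z => x + z ∉ C₁) with hUdef
  set U' := (elts H₂).filter (fun z => ¬ (x + z ∉ C₁)) with hU'def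
  set V := (elts H₁).filter (fun y => x + y ∈ C₂) with hVdef
  set V' := (elts H₁).filter (fun y => ¬ (x + y ∈ C₂)) with hV'def
  have hUU : U.card + U'.card = Nat.card H₂ := by
    rw [← card_elts, hUdef, hU'def, Finset.card_filter_add_card_filter_not]
  have hVV : V.card + V'.card = Nat.card H₁ := by
    rw [← card_elts, hVdef, hV'def, Finset.card_filter_add_card_filter_not]
  have hE : V.card * U.card ≤ Nat.card (H₁ ⊓ H₂ : AddSubgroup G) * (C₂ \ C₁).card := by
    apply card_mul_card_le_of_sums (Finset.filter_subset _ _) (Finset.filter_subset _ _) x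
    intro y hy z hz
    simp only [Finset.mem_filter, mem_elts, hUdef, hVdef] at hy hz
    rw [Finset.mem_sdiff]
    constructor
    · rw [add_comm]; exact (mem_stab.1 hz.1 _).2 hy.2
    · rw [add_right_comm, add_comm]
      intro h; exact hz.2 ((mem_stab.1 hy.1 _).1 h)
  have hF : U'.card * V'.card ≤ Nat.card (H₁ ⊓ H₂ : AddSubgroup G) * (C₁ \ C₂).card := by
    rw [mul_comm]
    apply card_mul_card_le_of_sums (Finset.filter_subset _ _) (Finset.filter_subset _ _) x
    intro y hy z hz
    simp only [hU'def, hV'def, Finset.mem_filter, mem_elts, not_not] at hy hz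
    rw [Finset.mem_sdiff]
    constructor
    · rw [add_right_comm, add_comm]; exact (mem_stab.1 hy.1 _).2 hz.2
    · rw [add_comm]
      intro h; exact hy.2 ((mem_stab.1 hz.1 _).1 h)
  have hinv : ∀ (W : Finset G), (∀ k ∈ H₁ ⊓ H₂, ∀ w ∈ W, k + w ∈ W) → W.Nonempty →
      Nat.card (H₁ ⊓ H₂ : AddSubgroup G) ≤ W.card := by
    intro W hW hne
    exact card_le_of_le_stab hne (fun k hk => mem_stab_of_forall (hW k hk))
  have key1 : ∀ k ∈ H₁ ⊓ H₂, ∀ w, (x + (k + w) ∈ C₁ ↔ x + w ∈ C₁) := by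
    intro k hk w
    rw [show x + (k + w) = k + (x + w) by abel]
    exact mem_stab.1 hk.1 _
  have key2 : ∀ k ∈ H₁ ⊓ H₂, ∀ w, (x + (k + w) ∈ C₂ ↔ x + w ∈ C₂) := by
    intro k hk w
    rw [show x + (k + w) = k + (x + w) by abel]
    exact mem_stab.1 hk.2 _
  have hUinv : ∀ k ∈ H₁ ⊓ H₂, ∀ w ∈ U, k + w ∈ U := by
    intro k hk w hw
    simp only [hUdef, Finset.mem_filter, mem_elts] at hw ⊢
    exact ⟨add_mem hk.2 hw.1, by rw [key1 k hk]; exact hw.2⟩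
  have hUinv' : ∀ k ∈ H₁ ⊓ H₂, ∀ w ∈ U', k + w ∈ U' := by
    intro k hk w hw
    simp only [hU'def, Finset.mem_filter, mem_elts] at hw ⊢
    exact ⟨add_mem hk.2 hw.1, by rw [key1 k hk]; exact hw.2⟩
  have hVinv : ∀ k ∈ H₁ ⊓ H₂, ∀ w ∈ V, k + w ∈ V := by
    intro k hk w hw
    simp only [hVdef, Finset.mem_filter, mem_elts] at hw ⊢
    exact ⟨add_mem hk.1 hw.1, by rw [key2 k hk]; exact hw.2⟩
  have hVinv' : ∀ k ∈ H₁ ⊓ H₂, ∀ w ∈ V', k + w ∈ V' := by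
    intro k hk w hw
    simp only [hV'def, Finset.mem_filter, mem_elts] at hw ⊢
    exact ⟨add_mem hk.1 hw.1, by rw [key2 k hk]; exact hw.2⟩
  have hU0 : (0 : G) ∈ U := by simp [hUdef, hx1, zero_mem]
  have hV0 : (0 : G) ∈ V := by simp [hVdef, hx2, zero_mem]
  have ea : Nat.card H₂ - U.card = U'.card := by omega
  have eb : Nat.card H₁ - V.card = V'.card := by omega
  have zor : ∀ W : Finset G, (∀ k ∈ H₁ ⊓ H₂, ∀ w ∈ W, k + w ∈ W) →
      W.card = 0 ∨ Nat.card (H₁ ⊓ H₂ : AddSubgroup G) ≤ W.card := by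
    intro W hW
    rcases W.eq_empty_or_nonempty with h | h
    · left; simp [h]
    · right; exact hinv W hW h
  refine grid_arith (a := U.card) (b := V.card) Nat.card_pos (hinv U hUinv ⟨0, hU0⟩)
    (hinv V hVinv ⟨0, hV0⟩) (by omega) (by omega) (by rw [ea]; exact zor _ hUinv')
    (by rw [eb]; exact zor _ hVinv') hE (by rw [ea, eb]; exact hF) ?_
  intro h0
  apply hfull
  intro z hz hzC
  rw [ea, Finset.card_eq_zero] at h0
  have : z ∈ U' := by simp [hU'def, hz, hzC]
  rw [h0] at this
  simp at this

/-- **Kneser's union lemma**: the quantity `|C| + |stab C|` of a union is at least its minimum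
over the two parts. -/
theorem card_add_card_stab_union {C₁ C₂ : Finset G} (h1 : C₁.Nonempty) (h2 : C₂.Nonempty) :
    C₁.card + Nat.card (stab C₁) ≤ (C₁ ∪ C₂).card + Nat.card (stab (C₁ ∪ C₂)) ∨
    C₂.card + Nat.card (stab C₂) ≤ (C₁ ∪ C₂).card + Nat.card (stab (C₁ ∪ C₂)) := by
  have := finite_stab h1
  have := finite_stab h2
  have := finite_stab (C := C₁ ∪ C₂) (h1.mono Finset.subset_union_left)
  have hle : Nat.card (stab C₁ ⊓ stab C₂ : AddSubgroup G) ≤ Nat.card (stab (C₁ ∪ C₂)) := by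
    apply AddSubgroup.card_le_of_le
    intro k hk x
    rw [Finset.mem_union, Finset.mem_union, mem_stab.1 hk.1 x, mem_stab.1 hk.2 x]
  have hc1 : (C₁ ∪ C₂).card = C₁.card + (C₂ \ C₁).card := by
    rw [← Finset.union_sdiff_self_eq_union, Finset.card_union_of_disjoint Finset.disjoint_sdiff]
  have hc2 : (C₁ ∪ C₂).card = C₂.card + (C₁ \ C₂).card := by
    rw [Finset.union_comm, ← Finset.union_sdiff_self_eq_union,
      Finset.card_union_of_disjoint Finset.disjoint_sdiff]
  by_cases s1 : C₂ ⊆ C₁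
  · left; rw [Finset.union_eq_left.2 s1]
  by_cases s2 : C₁ ⊆ C₂
  · right; rw [Finset.union_eq_right.2 s2]
  obtain ⟨x, hx2, hx1⟩ := Finset.not_subset.1 s1
  obtain ⟨y, hy1, hy2⟩ := Finset.not_subset.1 s2
  rcases le_total (Nat.card (stab C₁)) (Nat.card (stab C₂)) with hc | hc
  · have := sdiff_card_of_coset hx2 hx1 (fun _ => hc)
    omega
  · have := sdiff_card_of_coset hy1 hy2 (fun _ => hc)
    rw [inf_comm] at this
    omega

/-- Every sum `a + b` lies in a subset `C` of `A + B` with `|C| + |stab C| ≥ |A| + |B|`. Induction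
on `|B|`: a Dyson transform that keeps `a ∈ A` and `b ∈ B` either shrinks `B`, or there is none, and
then `B - b` consists of periods of `A`. -/
theorem exists_subset_of_mem_add (n : ℕ) : ∀ (A B : Finset G) (a b : G), B.card = n → a ∈ A →
    b ∈ B → ∃ C ⊆ A + B, a + b ∈ C ∧ A.card + B.card ≤ C.card + Nat.card (stab C) := by
  induction n using Nat.strong_induction_on with
  | _ n ih =>
    intro A B a b hn ha hb
    by_cases hex : ∃ a' ∈ A, ∃ b' ∈ B, (a' - b) + b' ∉ A
    -- the transform by `e = a' - b` keeps `b` in the second set, since `b + e ∈ A`, and removes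
    -- `b'` from it
    · obtain ⟨a', ha', b', hb', hnot⟩ := hex
      set x : Finset G × Finset G := (A, B)
      set e := a' - b
      have hcard := Finset.addDysonETransform.card e x
      have hsub := Finset.addDysonETransform.subset e x
      set A1 := (Finset.addDysonETransform e x).1 with hA1
      set B1 := (Finset.addDysonETransform e x).2 with hB1
      have hB1' : B1 = B ∩ (-e +ᵥ A) := rfl
      have hA1' : A1 = A ∪ (e +ᵥ B) := rfl
      have hbB : b ∈ B1 := by
        rw [hB1', Finset.mem_inter]
        refine ⟨hb, ?_⟩
        rw [Finset.mem_vadd_finset]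
        exact ⟨a', ha', by simp [e]⟩
      have haA : a ∈ A1 := by rw [hA1']; exact Finset.mem_union_left _ ha
      have hlt : B1.card < n := by
        rw [← hn]
        apply Finset.card_lt_card
        rw [hB1', Finset.ssubset_iff_of_subset Finset.inter_subset_left]
        refine ⟨b', hb', ?_⟩
        rw [Finset.mem_inter]
        rintro ⟨_, h⟩
        obtain ⟨c, hc, hce⟩ := Finset.mem_vadd_finset.1 h
        apply hnot
        have : a' - b + b' = c := by
          rw [← hce]; simp only [vadd_eq_add, e]; abel
        rwa [this]
      obtain ⟨C, hC, hab, hle⟩ := ih B1.card hlt A1 B1 a b rfl haA hbB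
      refine ⟨C, hC.trans hsub, hab, ?_⟩
      have : A1.card + B1.card = A.card + B.card := hcard
      omega
    -- here `B - b ⊆ stab A`, and the translate `A + b` serves as `C`
    · push Not at hex
      refine ⟨A.image (· + b), ?_, Finset.mem_image_of_mem _ ha, ?_⟩
      · intro y hy
        obtain ⟨c, hc, rfl⟩ := Finset.mem_image.1 hy
        exact Finset.add_mem_add hc hb
      · rw [Finset.card_image_of_injective _ (add_left_injective b), stab_image_add]
        have := finite_stab (C := A) ⟨a, ha⟩
        rw [← card_elts, ← Finset.card_image_of_injective B (sub_left_injective (b := b))]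
        apply Nat.add_le_add_left
        apply Finset.card_le_card
        intro y hy
        obtain ⟨b', hb', rfl⟩ := Finset.mem_image.1 hy
        rw [mem_elts]
        apply mem_stab_of_forall
        intro c hc
        have := hex c hc b' hb'
        rwa [show b' - b + c = c - b + b' by abel]

/-- Kneser's theorem in the form `|A| + |B| ≤ |A + B| + |stab (A + B)|`: the sumset is the union of
the sets `C` found for its elements, and the union lemma preserves the inequality. -/
theorem kneser_weak {A B : Finset G} (hA : A.Nonempty) (hB : B.Nonempty) :
    A.card + B.card ≤ (A + B).card + Nat.card (stab (A + B)) := by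
  have hne : (A + B).Nonempty := hA.add hB
  have hex : ∀ x : G, ∃ C : Finset G, x ∈ A + B → C ⊆ A + B ∧ x ∈ C ∧
      A.card + B.card ≤ C.card + Nat.card (stab C) := by
    intro x
    by_cases hx : x ∈ A + B
    · obtain ⟨a, ha, b, hb, rfl⟩ := Finset.mem_add.1 hx
      obtain ⟨C, h1, h2, h3⟩ := exists_subset_of_mem_add B.card A B a b rfl ha hb
      exact ⟨C, fun _ => ⟨h1, h2, h3⟩⟩
    · exact ⟨∅, fun h => absurd h hx⟩
  choose C hC using hex
  have heq : (A + B).sup' hne C = A + B := by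
    apply le_antisymm
    · apply Finset.sup'_le
      intro x hx
      exact (hC x hx).1
    · intro x hx
      exact (Finset.le_sup' C hx) (hC x hx).2.1
  have := Finset.sup'_induction (s := A + B) hne C
    (p := fun D => D.Nonempty ∧ A.card + B.card ≤ D.card + Nat.card (stab D))
    (by
      rintro D₁ ⟨h1, h1'⟩ D₂ ⟨h2, h2'⟩
      refine ⟨h1.mono Finset.subset_union_left, ?_⟩
      rcases card_add_card_stab_union h1 h2 with h | h
      · exact h1'.trans h
      · exact h2'.trans h)
    (fun x hx => ⟨⟨x, (hC x hx).2.1⟩, (hC x hx).2.2⟩)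
  rw [heq] at this
  exact this.2

/-- **Kneser's theorem**, with `K` the stabilizer of `A + B`. -/
theorem kneser {A B : Finset G} (hA : A.Nonempty) (hB : B.Nonempty) [Finite (stab (A + B))] :
    (A + elts (stab (A + B))).card + (B + elts (stab (A + B))).card ≤
      (A + B).card + Nat.card (stab (A + B)) := by
  set K := stab (A + B) with hK
  have hsum : (A + elts K) + (B + elts K) = A + B := by
    rw [add_add_add_comm, ← add_assoc, add_elts_eq_self le_rfl, add_elts_eq_self le_rfl]
  have hKne : (elts K).Nonempty := ⟨0, mem_elts.2 (zero_mem _)⟩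
  have := kneser_weak (hA.add hKne) (hB.add hKne)
  rwa [hsum] at this

/-- Kneser's theorem for aperiodic sumsets. -/
theorem kneser_of_stab_eq_bot {A B : Finset G} (hA : A.Nonempty) (hB : B.Nonempty)
    (h : stab (A + B) = ⊥) : A.card + B.card ≤ (A + B).card + 1 := by
  have := kneser_weak hA hB
  rw [h] at this
  simpa using this

end Kneser

/-! ### Arithmetic progressions -/

section Runs

variable {Q : Type*} [AddCommGroup Q] [DecidableEq Q]

/-- The set of the terms `p, p + y, …, p + (k - 1) y`; it may have fewer than `k` elements. -/
def run (p y : Q) (k : ℕ) : Finset Q := (Finset.range k).image (fun i : ℕ => p + i • y)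

theorem mem_run {p y x : Q} {k : ℕ} : x ∈ run p y k ↔ ∃ i < k, p + i • y = x := by
  simp [run]

/-- `X` is a finite arithmetic progression with difference `y`. -/
def IsRun (y : Q) (X : Finset Q) : Prop := ∃ p, X = run p y X.card

theorem IsRun.injOn {p y : Q} {k : ℕ} (h : (run p y k).card = k) {i j : ℕ} (hi : i < k)
    (hj : j < k) (hij : p + i • y = p + j • y) : i = j := by
  have : Set.InjOn (fun i : ℕ => p + i • y) (Finset.range k : Finset ℕ) := by
    apply Finset.injOn_of_card_image_eq
    rw [Finset.card_range]
    exact h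
  exact this (by simpa using hi) (by simpa using hj) hij

/-- A finite set `X` with exactly one element `x ∈ X + y` outside `X` consists of an arithmetic
progression with difference `y` and a part invariant under translation by `y`. -/
theorem exists_run_of_card_sdiff {X : Finset Q} {y : Q} (h : ((X.image (· + y)) \ X).card = 1) :
    ∃ P X₀ : Finset Q, X = P ∪ X₀ ∧ Disjoint P X₀ ∧ P.Nonempty ∧ IsRun y P ∧
      ∀ x ∈ X₀, x + y ∈ X₀ := by
  obtain ⟨f, hf⟩ := Finset.card_eq_one.1 h
  have hfm : f ∈ (X.image (· + y)) \ X := by rw [hf]; simp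
  obtain ⟨hf1, hfX⟩ := Finset.mem_sdiff.1 hfm
  obtain ⟨e, heX, rfl⟩ := Finset.mem_image.1 hf1
  have huniq : ∀ x ∈ X, x + y ∉ X → x = e := by
    intro x hx hxy
    have : x + y ∈ (X.image (· + y)) \ X :=
      Finset.mem_sdiff.2 ⟨Finset.mem_image_of_mem _ hx, hxy⟩
    rw [hf, Finset.mem_singleton] at this
    exact add_right_cancel this
  -- Let `e` be the element of `X` with `e + y ∉ X`. Walking back from `e` in steps of `y` leaves
  -- `X` at some point: otherwise `y` has finite order, and `e + y` is one of the points visited.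
  have hex : ∃ k : ℕ, e - k • y ∉ X := by
    by_contra hcon
    push Not at hcon
    have hni : ¬ Set.InjOn (fun k : ℕ => e - k • y) Set.univ := by
      intro hinj
      have hinf : Set.Infinite ((fun k : ℕ => e - k • y) '' Set.univ) :=
        Set.infinite_univ.image hinj
      apply hinf
      apply (Finset.finite_toSet X).subset
      rintro _ ⟨k, _, rfl⟩
      exact hcon k
    rw [Set.injOn_univ, Function.Injective] at hni
    push Not at hni
    obtain ⟨i, j, hij, hne⟩ := hni
    wlog hlt : i < j generalizing i j
    · exact this j i hij.symm hne.symm (by omega)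
    obtain ⟨m, rfl⟩ : ∃ m, j = i + m + 1 := ⟨j - i - 1, by omega⟩
    have h0 : (m + 1) • y = 0 := by
      have : i • y = (i + m + 1) • y := sub_right_injective hij
      rw [add_assoc, add_nsmul] at this
      exact (left_eq_add.1 this)
    apply hfX
    have : e + y = e - m • y := by
      rw [succ_nsmul] at h0
      rw [sub_eq_add_neg, ← eq_neg_of_add_eq_zero_right h0]
    rw [this]
    exact hcon m
  classical
  set k := Nat.find hex with hk
  have hkX : e - k • y ∉ X := Nat.find_spec hex
  have hlt : ∀ i < k, e - i • y ∈ X := fun i hi => by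
    have := Nat.find_min hex hi
    simpa using this
  have hkpos : 0 < k := by
    rcases Nat.eq_zero_or_pos k with h0 | h0
    · rw [h0] at hkX; simp [heX] at hkX
    · exact h0
  set P := run (e - (k - 1) • y) y k with hP
  have hPmem : ∀ x, x ∈ P ↔ ∃ i < k, x = e - i • y := by
    intro x
    rw [hP, mem_run]
    constructor
    · rintro ⟨i, hi, rfl⟩
      refine ⟨k - 1 - i, by omega, ?_⟩
      have : (k - 1) • y = (k - 1 - i) • y + i • y := by rw [← add_nsmul]; congr 1; omega
      rw [this]; abel
    · rintro ⟨i, hi, rfl⟩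
      refine ⟨k - 1 - i, by omega, ?_⟩
      have : (k - 1) • y = (k - 1 - i) • y + i • y := by rw [← add_nsmul]; congr 1; omega
      rw [this]; abel
  have hPX : P ⊆ X := by
    intro x hx
    obtain ⟨i, hi, rfl⟩ := (hPmem x).1 hx
    exact hlt i hi
  have hPcard : P.card = k := by
    rw [hP, run, Finset.card_image_of_injOn, Finset.card_range]
    intro i hi j hj hij
    by_contra hne
    simp only [Finset.coe_range, Set.mem_Iio] at hi hj
    wlog hl : i < j generalizing i j
    · exact this hij.symm (Ne.symm hne) hj hi (by omega)
    have h0 : (j - i) • y = 0 := by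
      have h1 : i • y = j • y := add_left_cancel hij
      have : j • y = (j - i) • y + i • y := by rw [← add_nsmul]; congr 1; omega
      rw [this] at h1
      exact (right_eq_add.1 h1)
    apply hkX
    have : e - k • y = e - (k - (j - i)) • y := by
      have : k • y = (k - (j - i)) • y + (j - i) • y := by rw [← add_nsmul]; congr 1; omega
      rw [this, h0, add_zero]
    rw [this]
    exact hlt _ (by omega)
  refine ⟨P, X \ P, (Finset.union_sdiff_of_subset hPX).symm, Finset.disjoint_sdiff,
    ⟨e, (hPmem e).2 ⟨0, hkpos, by simp⟩⟩, ⟨e - (k - 1) • y, by rw [hPcard]⟩, ?_⟩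
  intro x hx
  rw [Finset.mem_sdiff] at hx ⊢
  have hxe : x ≠ e := by
    rintro rfl
    exact hx.2 ((hPmem _).2 ⟨0, hkpos, by simp⟩)
  have hxy : x + y ∈ X := by
    by_contra hc
    exact hxe (huniq x hx.1 hc)
  refine ⟨hxy, fun hc => ?_⟩
  obtain ⟨i, hi, hie⟩ := (hPmem _).1 hc
  have hxi : x = e - (i + 1) • y := by
    rw [succ_nsmul, ← sub_sub, ← hie]; abel
  by_cases hik : i + 1 < k
  · exact hx.2 ((hPmem _).2 ⟨i + 1, hik, hxi⟩)
  · have : i + 1 = k := by omega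
    rw [this] at hxi
    exact hkX (hxi ▸ hx.1)

/-- A nonempty set closed under translation by a generator of the group is everything. -/
theorem mem_of_forall_add_mem {X : Finset Q} {y : Q} (hy : AddSubgroup.zmultiples y = ⊤)
    (hX : X.Nonempty) (h : ∀ x ∈ X, x + y ∈ X) (z : Q) : z ∈ X := by
  have hys : y ∈ stab X := mem_stab_of_forall (fun x hx => by rw [add_comm]; exact h x hx)
  have htop : stab X = ⊤ := by
    rw [eq_top_iff, ← hy]
    exact AddSubgroup.zmultiples_le_of_mem hys
  obtain ⟨x, hx⟩ := hX
  have : z - x ∈ stab X := by rw [htop]; trivial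
  have := (mem_stab.1 this x).2 hx
  simpa using this

theorem isRun_of_card_sdiff {X : Finset Q} {y : Q} (hy : AddSubgroup.zmultiples y = ⊤)
    (h : ((X.image (· + y)) \ X).card = 1) : IsRun y X := by
  obtain ⟨P, X₀, hX, hd, ⟨p, hp⟩, hrun, hinv⟩ := exists_run_of_card_sdiff h
  rcases X₀.eq_empty_or_nonempty with h0 | h0
  · rw [h0, Finset.union_empty] at hX
    rwa [hX]
  · exact absurd (mem_of_forall_add_mem hy h0 hinv p) (Finset.disjoint_left.1 hd hp)

theorem add_run_succ (X : Finset Q) (p y : Q) (k : ℕ) :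
    X + run p y (k + 2) = (X + run p y (k + 1)) ∪ ((X + run p y (k + 1)).image (· + y)) := by
  ext z
  simp only [Finset.mem_union, Finset.mem_image, Finset.mem_add, mem_run]
  constructor
  · rintro ⟨x, hx, _, ⟨i, hi, rfl⟩, rfl⟩
    by_cases h : i < k + 1
    · exact Or.inl ⟨x, hx, _, ⟨i, h, rfl⟩, rfl⟩
    · right
      refine ⟨x + (p + k • y), ⟨x, hx, _, ⟨k, by omega, rfl⟩, rfl⟩, ?_⟩
      have : i = k + 1 := by omega
      rw [this, succ_nsmul]; abel
  · rintro (⟨x, hx, _, ⟨i, hi, rfl⟩, rfl⟩ | ⟨_, ⟨x, hx, _, ⟨i, hi, rfl⟩, rfl⟩, rfl⟩)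
    · exact ⟨x, hx, _, ⟨i, by omega, rfl⟩, rfl⟩
    · refine ⟨x, hx, _, ⟨i + 1, by omega, rfl⟩, ?_⟩
      rw [succ_nsmul]; abel

/-- Adding a progression whose difference generates the group: each further term of the
progression enlarges the sumset until it is everything. -/
theorem card_add_run {X : Finset Q} {p y : Q} (hy : AddSubgroup.zmultiples y = ⊤)
    (hX : X.Nonempty) (k : ℕ) (h : ∃ z, z ∉ X + run p y (k + 1)) (j : ℕ) (hj : j ≤ k) :
    (X + run p y (j + 1)).card + (k - j) ≤ (X + run p y (k + 1)).card := by
  induction k with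
  | zero => obtain rfl : j = 0 := by omega
            simp
  | succ k ih =>
    rcases Nat.eq_or_lt_of_le hj with rfl | hlt
    · simp
    have hsub : X + run p y (k + 1) ⊆ X + run p y (k + 2) := by
      rw [add_run_succ]; exact Finset.subset_union_left
    obtain ⟨z, hz⟩ := h
    have h1 := ih ⟨z, fun hc => hz (hsub hc)⟩ (by omega)
    have hss : X + run p y (k + 1) ⊂ X + run p y (k + 2) := by
      refine hsub.ssubset_of_ne (fun heq => hz ?_)
      apply mem_of_forall_add_mem hy
      · rw [← heq]
        exact hX.add ⟨p, mem_run.2 ⟨0, by omega, by simp⟩⟩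
      · intro x hx
        rw [← heq] at hx
        rw [add_run_succ]
        exact Finset.mem_union_right _ (Finset.mem_image_of_mem _ hx)
    have := Finset.card_lt_card hss
    have e : k + 1 - j = (k - j) + 1 := by omega
    have e' : k + 1 + 1 = k + 2 := rfl
    rw [e']
    omega

theorem add_singleton_eq_image (X : Finset Q) (p : Q) : X + {p} = X.image (· + p) := by
  ext z
  simp only [Finset.mem_add, Finset.mem_image, Finset.mem_singleton]
  constructor
  · rintro ⟨x, hx, _, rfl, rfl⟩
    exact ⟨x, hx, rfl⟩
  · rintro ⟨x, hx, rfl⟩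
    exact ⟨x, hx, p, rfl, rfl⟩

theorem add_run_one (X : Finset Q) (p y : Q) : (X + run p y 1).card = X.card := by
  have : run p y 1 = {p} := by simp [run]
  rw [this, add_singleton_eq_image, Finset.card_image_of_injective _ (add_left_injective p)]

theorem card_add_card_run_le {X : Finset Q} {p y : Q} (hy : AddSubgroup.zmultiples y = ⊤)
    (hX : X.Nonempty) (k : ℕ) (h : ∃ z, z ∉ X + run p y (k + 1)) :
    X.card + k ≤ (X + run p y (k + 1)).card := by
  have := card_add_run hy hX k h 0 (by omega)
  rwa [zero_add, add_run_one, Nat.sub_zero] at this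

/-- If a sumset with a progression of generating difference has the least possible size and is
not everything, then the other summand is a progression with the same difference. -/
theorem isRun_of_card_add_run {X : Finset Q} {p y : Q} (hy : AddSubgroup.zmultiples y = ⊤)
    (hX : X.Nonempty) (k : ℕ) (hk : 1 ≤ k) (h : ∃ z, z ∉ X + run p y (k + 1))
    (hc : (X + run p y (k + 1)).card ≤ X.card + k) : IsRun y X := by
  apply isRun_of_card_sdiff hy
  have h1 : (X + run p y 2).card + (k - 1) ≤ (X + run p y (k + 1)).card :=
    card_add_run hy hX k h 1 hk
  have h2 : (X + run p y 2).card = X.card + ((X.image (· + y)) \ X).card := by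
    have e0 : run p y 1 = {p} := by simp [run]
    have e : X + run p y 2 = (X ∪ X.image (· + y)).image (· + p) := by
      rw [add_run_succ X p y 0, zero_add, e0, add_singleton_eq_image, Finset.image_union,
        Finset.image_image, Finset.image_image]
      congr 1
      apply Finset.image_congr
      intro x _
      simp only [Function.comp]
      abel
    rw [e, Finset.card_image_of_injective _ (add_left_injective p),
      ← Finset.union_sdiff_self_eq_union, Finset.card_union_of_disjoint Finset.disjoint_sdiff]
  have h3 : 0 < ((X.image (· + y)) \ X).card := by
    rw [Finset.card_pos, Finset.sdiff_nonempty]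
    intro hsub
    obtain ⟨z, hz⟩ := h
    have hall := mem_of_forall_add_mem hy hX
      (fun x hx => hsub (Finset.mem_image_of_mem (· + y) hx))
    exact hz (Finset.mem_add.2 ⟨z - p, hall _, p, mem_run.2 ⟨0, by omega, by simp⟩, by abel⟩)
  omega

end Runs

/-! ### Atoms and their intersections -/

section Atoms

variable {Q : Type*} [AddCommGroup Q] [DecidableEq Q]

/-- `X` has at least two elements and `X + A` misses at least two elements: `X` is admissible in the
definition of the second connectivity of `A`. -/
def Adm (A X : Finset Q) : Prop :=
  2 ≤ X.card ∧ ∃ z w, z ≠ w ∧ z ∉ X + A ∧ w ∉ X + A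

/-- `M` is a `2`-atom of `A`: an admissible set with the smallest value of `|M + A| - |M|`, of
the smallest cardinality among these. -/
structure IsAtomOf (A M : Finset Q) : Prop where
  adm : Adm A M
  le : ∀ X, Adm A X → (M + A).card + X.card ≤ (X + A).card + M.card
  card_le : ∀ X, Adm A X → (X + A).card + M.card = (M + A).card + X.card → M.card ≤ X.card

theorem Adm.mono {A X Y : Finset Q} (hX : Adm A X) (hY : 2 ≤ Y.card) (h : Y ⊆ X) : Adm A Y := by
  obtain ⟨_, z, w, hzw, hz, hw⟩ := hX
  have := Finset.add_subset_add_right (t := A) h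
  exact ⟨hY, z, w, hzw, fun hc => hz (this hc), fun hc => hw (this hc)⟩

theorem image_add_add (X A : Finset Q) (g : Q) :
    X.image (· + g) + A = (X + A).image (· + g) := by
  ext z
  simp only [Finset.mem_add, Finset.mem_image]
  constructor
  · rintro ⟨_, ⟨x, hx, rfl⟩, a, ha, rfl⟩
    exact ⟨x + a, ⟨x, hx, a, ha, rfl⟩, by abel⟩
  · rintro ⟨_, ⟨x, hx, a, ha, rfl⟩, rfl⟩
    exact ⟨x + g, ⟨x, hx, rfl⟩, a, ha, by abel⟩

theorem card_image_add (X : Finset Q) (g : Q) : (X.image (· + g)).card = X.card :=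
  Finset.card_image_of_injective _ (add_left_injective g)

theorem Adm.image_add {A X : Finset Q} (hX : Adm A X) (g : Q) : Adm A (X.image (· + g)) := by
  obtain ⟨h2, z, w, hzw, hz, hw⟩ := hX
  refine ⟨by rwa [card_image_add], z + g, w + g, fun h => hzw (add_right_cancel h), ?_, ?_⟩ <;>
  · rw [image_add_add, Finset.mem_image]
    rintro ⟨u, hu, hug⟩
    rw [add_right_cancel hug] at hu
    contradiction

theorem IsAtomOf.image_add {A M : Finset Q} (h : IsAtomOf A M) (g : Q) :
    IsAtomOf A (M.image (· + g)) := by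
  refine ⟨h.adm.image_add g, fun X hX => ?_, fun X hX => ?_⟩
  · rw [image_add_add, card_image_add, card_image_add]; exact h.le X hX
  · rw [image_add_add, card_image_add, card_image_add]; exact h.card_le X hX

theorem exists_isAtomOf {A X : Finset Q} (hA : A.Nonempty) (hX : Adm A X) :
    ∃ M, IsAtomOf A M := by
  obtain ⟨M₀, hM₀, hmin₀⟩ := WellFounded.has_min
    (InvImage.wf (fun X : Finset Q => (X + A).card - X.card) Nat.lt_wfRel.wf)
    {X | Adm A X} ⟨X, hX⟩
  have hge : ∀ Y : Finset Q, Y.card ≤ (Y + A).card := fun Y => Finset.card_le_card_add_right hA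
  obtain ⟨M, hM, hmin⟩ := WellFounded.has_min
    (InvImage.wf (fun X : Finset Q => X.card) Nat.lt_wfRel.wf)
    {X | Adm A X ∧ (X + A).card + M₀.card = (M₀ + A).card + X.card} ⟨M₀, hM₀, rfl⟩
  have hle₀ : ∀ Y, Adm A Y → (M₀ + A).card + Y.card ≤ (Y + A).card + M₀.card := by
    intro Y hY
    have h1 : ¬ ((Y + A).card - Y.card < (M₀ + A).card - M₀.card) := hmin₀ Y hY
    have h2 := hge Y
    have h3 := hge M₀
    omega
  refine ⟨M, hM.1, fun Y hY => ?_, fun Y hY he => ?_⟩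
  · have h1 := hle₀ Y hY
    have h2 := hM.2
    omega
  · have h2 := hM.2
    by_contra hlt
    exact hmin Y ⟨hY, by omega⟩ (not_le.1 hlt)

theorem card_image_of_neg (M : Finset Q) : (M.image (fun x => -x)).card = M.card :=
  Finset.card_image_of_injective _ neg_injective

/-- In a finite group an atom is at most as large as the complement of its sumset: the negative
of that complement has the same boundary. -/
theorem IsAtomOf.two_mul_le {A M : Finset Q} [Finite Q] (h : IsAtomOf A M) :
    (M + A).card + M.card ≤ Nat.card Q := by
  have := Fintype.ofFinite Q
  rw [Nat.card_eq_fintype_card]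
  -- the negative `X` of the complement of `M + A` is admissible, and `X + A` misses `-M`
  set X : Finset Q := ((M + A)ᶜ).image (fun x => -x) with hX
  have hXc : X.card + (M + A).card = Fintype.card Q := by
    rw [hX, Finset.card_image_of_injective _ neg_injective, Finset.card_compl]
    have := Finset.card_le_univ (M + A)
    omega
  have hXA : ∀ x ∈ X + A, -x ∉ M := by
    intro x hx hxM
    obtain ⟨c, hc, a, ha, rfl⟩ := Finset.mem_add.1 hx
    obtain ⟨c', hc', rfl⟩ := Finset.mem_image.1 hc
    rw [Finset.mem_compl] at hc'
    exact hc' (Finset.mem_add.2 ⟨_, hxM, a, ha, by abel⟩)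
  have hXAc : (X + A).card + M.card ≤ Fintype.card Q := by
    rw [← card_image_of_neg M, ← Finset.card_union_of_disjoint]
    · exact Finset.card_le_univ _
    · rw [Finset.disjoint_left]
      intro x hx hxM
      obtain ⟨m, hm, rfl⟩ := Finset.mem_image.1 hxM
      have := hXA _ hx
      rw [neg_neg] at this
      exact this hm
  have hadm : Adm A X := by
    obtain ⟨h2, z, w, hzw, hz, hw⟩ := h.adm
    constructor
    · have h3 : ({-z, -w} : Finset Q) ⊆ X := by
        intro x hx
        rw [Finset.mem_insert, Finset.mem_singleton] at hx
        rw [hX, Finset.mem_image]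
        rcases hx with rfl | rfl
        · exact ⟨z, by simpa using hz, rfl⟩
        · exact ⟨w, by simpa using hw, rfl⟩
      have := Finset.card_le_card h3
      rwa [Finset.card_pair (fun h => hzw (neg_injective h))] at this
    · obtain ⟨m, hm, m', hm', hne⟩ := Finset.one_lt_card.1 (show 1 < M.card by omega)
      refine ⟨-m, -m', fun h => hne (neg_injective h), fun hc => ?_, fun hc => ?_⟩
      · have := hXA _ hc; rw [neg_neg] at this; exact this hm
      · have := hXA _ hc; rw [neg_neg] at this; exact this hm'
  have h1 := h.le X hadm
  by_cases he : (X + A).card + M.card = (M + A).card + X.card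
  · have := h.card_le X hadm he
    omega
  · omega

/-- **Intersection property**: distinct translates of an atom share at most one element. -/
theorem IsAtomOf.inter {A M : Finset Q} (h : IsAtomOf A M) (g : Q)
    (hg : 2 ≤ (M ∩ M.image (· + g)).card) : M.image (· + g) = M := by
  set N := M.image (· + g) with hN
  have hNat : IsAtomOf A N := h.image_add g
  have hNc : N.card = M.card := card_image_add M g
  have hNA : (N + A).card = (M + A).card := by rw [hN, image_add_add, card_image_add]
  have hI : Adm A (M ∩ N) := h.adm.mono hg Finset.inter_subset_left
  have hIle := h.le _ hI
  have hU : (M ∪ N).card + (M ∩ N).card = M.card + N.card := Finset.card_union_add_card_inter M N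
  have hUA : ((M ∪ N) + A).card + ((M ∩ N) + A).card ≤ (M + A).card + (N + A).card := by
    rw [Finset.union_add, ← Finset.card_union_add_card_inter (M + A) (N + A)]
    have hsub : (M ∩ N) + A ⊆ (M + A) ∩ (N + A) := Finset.inter_add_subset
    exact Nat.add_le_add_left (Finset.card_le_card hsub) _
  -- `|· + A| - |·|` is submodular, so if `M ∪ N` is admissible, then `M ∩ N` also attains the
  -- minimum, and the minimality of `|M|` forces `M ∩ N = M`.
  have hUadm : Adm A (M ∪ N) := by
    refine ⟨h.adm.1.trans (Finset.card_le_card Finset.subset_union_left), ?_⟩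
    rcases finite_or_infinite Q with hfin | hinf
    · have h2 := h.two_mul_le
      have := Fintype.ofFinite Q
      rw [Nat.card_eq_fintype_card] at h2
      have h3 : 1 < ((M ∪ N) + A)ᶜ.card := by
        rw [Finset.card_compl]
        omega
      obtain ⟨z, hz, w, hw, hzw⟩ := Finset.one_lt_card.1 h3
      exact ⟨z, w, hzw, Finset.mem_compl.1 hz, Finset.mem_compl.1 hw⟩
    · obtain ⟨z, hz⟩ := Infinite.exists_notMem_finset ((M ∪ N) + A)
      obtain ⟨w, hw⟩ := Infinite.exists_notMem_finset (insert z ((M ∪ N) + A))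
      rw [Finset.mem_insert, not_or] at hw
      exact ⟨z, w, fun h => hw.1 h.symm, hz, hw.2⟩
  have hUle := h.le _ hUadm
  have hle := h.card_le _ hI (by omega)
  have hMI : M ∩ N = M := Finset.eq_of_subset_of_card_le Finset.inter_subset_left hle
  exact (Finset.eq_of_subset_of_card_le (Finset.inter_eq_left.1 hMI) hNc.le).symm

/-- Distinct translates of `M` share at most one element; equivalently every nonzero element has
at most one representation as a difference of elements of `M`. -/
def IsSidonLike (M : Finset Q) : Prop := ∀ g, g ≠ 0 → (M ∩ M.image (· + g)).card ≤ 1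

/-- An atom containing `0` is a subgroup, or its distinct translates share at most one element. -/
theorem IsAtomOf.subgroup_or_sidon {A M : Finset Q} (h : IsAtomOf A M) (h0 : 0 ∈ M) :
    (∃ (L : AddSubgroup Q) (_ : Finite L), L ≠ ⊥ ∧ M = elts L) ∨ IsSidonLike M := by
  by_cases hs : IsSidonLike M
  · exact Or.inr hs
  left
  rw [IsSidonLike] at hs
  push Not at hs
  -- a translate `M + g` sharing two elements with `M` equals `M`; hence `M` is its own stabilizer
  obtain ⟨g, hg0, hg⟩ := hs
  have hgM := h.inter g hg
  have hgadd : ∀ x ∈ M, x + g ∈ M := fun x hx => by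
    have := Finset.mem_image_of_mem (· + g) hx
    rwa [hgM] at this
  refine ⟨stab M, finite_stab ⟨0, h0⟩, ?_, ?_⟩
  · intro hbot
    have : g ∈ stab M := mem_stab_of_forall (fun x hx => by rw [add_comm]; exact hgadd x hx)
    rw [hbot] at this
    exact hg0 this
  · have := finite_stab (C := M) ⟨0, h0⟩
    ext x
    rw [mem_elts]
    constructor
    · intro hx
      have hsub : ({0, g} : Finset Q) ⊆ M ∩ M.image (· + -x) := by
        intro y hy
        rw [Finset.mem_insert, Finset.mem_singleton] at hy
        rw [Finset.mem_inter, Finset.mem_image]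
        rcases hy with rfl | rfl
        · exact ⟨h0, x, hx, by simp⟩
        · exact ⟨by simpa using hgadd 0 h0, x + y, hgadd x hx, by abel⟩
      have hcard := Finset.card_le_card hsub
      rw [Finset.card_pair (Ne.symm hg0)] at hcard
      have hM := h.inter (-x) hcard
      have : -x ∈ stab M := mem_stab_of_forall (fun y hy => by
        have := Finset.mem_image_of_mem (· + -x) hy
        rw [hM] at this
        rwa [add_comm])
      simpa using neg_mem this
    · intro hx
      have := (mem_stab.1 hx 0).2 h0
      simpa using this

theorem IsSidonLike.eq_of_sub_eq {M : Finset Q} (hM : IsSidonLike M) {x y x' y' : Q}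
    (hx : x ∈ M) (hy : y ∈ M) (hx' : x' ∈ M) (hy' : y' ∈ M) (hne : x ≠ y)
    (h : x - y = x' - y') : x = x' := by
  have h1 := hM (x - y) (sub_ne_zero.2 hne)
  refine Finset.card_le_one.1 h1 x ?_ x' ?_
  · exact Finset.mem_inter.2 ⟨hx, Finset.mem_image.2 ⟨y, hy, by abel⟩⟩
  · exact Finset.mem_inter.2 ⟨hx', Finset.mem_image.2 ⟨y', hy', by rw [h]; abel⟩⟩

/-- If distinct translates of `M` share at most one element, and `M` is not contained in `L`, then
`M` is far from being a union of `L`-cosets. -/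
theorem IsSidonLike.card_add_elts {M : Finset Q} (hM : IsSidonLike M) (h0 : 0 ∈ M)
    {L : AddSubgroup Q} [Finite L] (hL : L ≠ ⊥) (hML : ¬ ∀ x ∈ M, x ∈ L) :
    Nat.card L + M.card ≤ (M + elts L).card := by
  classical
  let q : Q → Q ⧸ L := fun x => (x : Q ⧸ L)
  -- `R ⊆ M` represents the `L`-cosets met by `M`, and `ρ x ∈ R` is the representative of `x`
  obtain ⟨R, hRM, hinj, himg⟩ : ∃ R ⊆ M, Set.InjOn q R ∧ R.image q = M.image q := by
    obtain ⟨R, hR, hRi, hRq⟩ := Finset.exists_subset_injOn_image_eq_of_surjOn (f := q)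
      (M : Set Q) (M.image q) (fun z hz => by simpa using hz)
    exact ⟨R, by simpa using hR, hRi, hRq⟩
  have hrep : ∀ x ∈ M, ∃ r ∈ R, x - r ∈ L := by
    intro x hx
    have : q x ∈ R.image q := by rw [himg]; exact Finset.mem_image_of_mem q hx
    obtain ⟨r, hr, hrx⟩ := Finset.mem_image.1 this
    refine ⟨r, hr, ?_⟩
    have := QuotientAddGroup.eq.1 hrx
    rwa [neg_add_eq_sub] at this
  choose! ρ hρR hρL using hrep
  have hRL : R.card * Nat.card L ≤ (M + elts L).card := by
    have : (R ×ˢ elts L).card ≤ (M + elts L).card := by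
      apply Finset.card_le_card_of_injOn (fun p : Q × Q => p.1 + p.2)
      · intro p hp
        have hp' := Finset.mem_product.1 (Finset.mem_coe.1 hp)
        exact Finset.add_mem_add (hRM hp'.1) hp'.2
      · intro p hp p' hp' he
        have hp1 := Finset.mem_product.1 (Finset.mem_coe.1 hp)
        have hp1' := Finset.mem_product.1 (Finset.mem_coe.1 hp')
        have he' : p.1 + p.2 = p'.1 + p'.2 := he
        have h1 : p.1 = p'.1 := by
          apply hinj hp1.1 hp1'.1
          rw [QuotientAddGroup.eq]
          have : -p.1 + p'.1 = p.2 - p'.2 := by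
            rw [neg_add_eq_sub, sub_eq_sub_iff_add_eq_add, ← he', add_comm]
          rw [this]
          exact sub_mem (mem_elts.1 hp1.2) (mem_elts.1 hp1'.2)
        refine Prod.ext h1 ?_
        rw [h1] at he'
        exact add_left_cancel he'
    rwa [Finset.card_product, card_elts] at this
  -- by the uniqueness of differences, the elements `x - ρ x` and `ρ x - x`, for `x ∈ M \ R`, and
  -- `0` are distinct elements of `L`
  have hpairs : 2 * (M \ R).card + 1 ≤ Nat.card L := by
    have hne : ∀ x ∈ M \ R, x ≠ ρ x := by
      intro x hx he
      rw [Finset.mem_sdiff] at hx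
      exact hx.2 (he ▸ hρR x hx.1)
    have hc1 : ((M \ R).image (fun x => x - ρ x)).card = (M \ R).card := by
      apply Finset.card_image_of_injOn
      intro x hx y hy he
      have hx' := Finset.mem_sdiff.1 hx
      have hy' := Finset.mem_sdiff.1 hy
      exact hM.eq_of_sub_eq hx'.1 (hRM (hρR x hx'.1)) hy'.1 (hRM (hρR y hy'.1)) (hne x hx) he
    have hc2 : ((M \ R).image (fun x => ρ x - x)).card = (M \ R).card := by
      apply Finset.card_image_of_injOn
      intro x hx y hy he
      have hx' := Finset.mem_sdiff.1 hx
      have hy' := Finset.mem_sdiff.1 hy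
      have he' : x - ρ x = y - ρ y := by
        have : ρ x - x = ρ y - y := he
        rw [← neg_sub, this, neg_sub]
      exact hM.eq_of_sub_eq hx'.1 (hRM (hρR x hx'.1)) hy'.1 (hRM (hρR y hy'.1)) (hne x hx) he'
    have hd : Disjoint ((M \ R).image (fun x => x - ρ x)) ((M \ R).image (fun x => ρ x - x)) := by
      rw [Finset.disjoint_left]
      intro z hz hz'
      obtain ⟨x, hx, rfl⟩ := Finset.mem_image.1 hz
      obtain ⟨y, hy, hyx⟩ := Finset.mem_image.1 hz'
      have hx' := Finset.mem_sdiff.1 hx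
      have hy' := Finset.mem_sdiff.1 hy
      have := hM.eq_of_sub_eq hx'.1 (hRM (hρR x hx'.1)) (hRM (hρR y hy'.1)) hy'.1 (hne x hx)
        hyx.symm
      exact hx'.2 (this ▸ hρR y hy'.1)
    have hz : (0 : Q) ∉ (M \ R).image (fun x => x - ρ x) ∪ (M \ R).image (fun x => ρ x - x) := by
      rw [Finset.mem_union, Finset.mem_image, Finset.mem_image]
      rintro (⟨x, hx, he⟩ | ⟨x, hx, he⟩)
      · exact hne x hx (sub_eq_zero.1 he)
      · exact hne x hx (sub_eq_zero.1 he).symm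
    have hsub : insert 0 ((M \ R).image (fun x => x - ρ x) ∪ (M \ R).image (fun x => ρ x - x)) ⊆
        elts L := by
      intro z hz
      rw [Finset.mem_insert, Finset.mem_union, Finset.mem_image, Finset.mem_image] at hz
      rw [mem_elts]
      rcases hz with rfl | ⟨x, hx, rfl⟩ | ⟨x, hx, rfl⟩
      · exact zero_mem _
      · exact hρL x (Finset.mem_sdiff.1 hx).1
      · rw [← neg_sub]; exact neg_mem (hρL x (Finset.mem_sdiff.1 hx).1)
    have := Finset.card_le_card hsub
    rw [Finset.card_insert_of_notMem hz, Finset.card_union_of_disjoint hd, hc1, hc2,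
      card_elts] at this
    omega
  have hR2 : 2 ≤ R.card := by
    push Not at hML
    obtain ⟨x, hx, hxL⟩ := hML
    have : ρ x ≠ ρ 0 := by
      intro he
      apply hxL
      have h1 := hρL x hx
      have h2 := hρL 0 h0
      rw [he] at h1
      have := sub_mem h1 h2
      simpa using this
    exact Finset.one_lt_card.2 ⟨_, hρR x hx, _, hρR 0 h0, this⟩
  have hL2 : 2 ≤ Nat.card L := by
    have := (AddSubgroup.one_lt_card_iff_ne_bot L).2 hL
    omega
  have hMR : M.card = R.card + (M \ R).card := by
    rw [Finset.card_sdiff_of_subset hRM]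
    have := Finset.card_le_card hRM
    omega
  obtain ⟨r, hr⟩ := Nat.exists_eq_add_of_le hR2
  obtain ⟨l, hl⟩ := Nat.exists_eq_add_of_le hL2
  rw [hr, hl] at hRL
  rw [hl] at hpairs ⊢
  rw [hMR, hr]
  rcases Nat.eq_zero_or_pos l with rfl | hlpos
  · omega
  · have e : (2 + r) * (2 + l) = 4 + 2 * l + 2 * r + r * l := by ring
    have : r ≤ r * l := Nat.le_mul_of_pos_right r hlpos
    omega

theorem IsSidonLike.card_inter_image {M : Finset Q} (hM : IsSidonLike M) {b c : Q} (h : b ≠ c) :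
    (M.image (· + b) ∩ M.image (· + c)).card ≤ 1 := by
  have e : M.image (· + b) ∩ M.image (· + c) = (M ∩ M.image (· + (c - b))).image (· + b) := by
    rw [Finset.image_inter _ _ (add_left_injective b), Finset.image_image]
    congr 1
    apply Finset.image_congr
    intro x _
    simp only [Function.comp]
    abel
  rw [e, card_image_add]
  exact hM _ (sub_ne_zero.2 h.symm)

/-- Two translates of `M` by elements of `B` share at most one element, hence
`|M + B| ≥ 2 |M| - 1`. -/
theorem IsSidonLike.two_mul_card_le {M B : Finset Q} (hM : IsSidonLike M) {b₁ b₂ : Q}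
    (h1 : b₁ ∈ B) (h2 : b₂ ∈ B) (hne : b₁ ≠ b₂) : 2 * M.card ≤ (M + B).card + 1 := by
  have hsub : M.image (· + b₁) ∪ M.image (· + b₂) ⊆ M + B := by
    intro z hz
    rw [Finset.mem_union, Finset.mem_image, Finset.mem_image] at hz
    rcases hz with ⟨m, hm, rfl⟩ | ⟨m, hm, rfl⟩
    · exact Finset.add_mem_add hm h1
    · exact Finset.add_mem_add hm h2
  have := Finset.card_le_card hsub
  have h3 := hM.card_inter_image hne
  have h4 := Finset.card_union_add_card_inter (M.image (· + b₁)) (M.image (· + b₂))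
  rw [card_image_add, card_image_add] at h4
  omega

/-- Three translates of `M` by elements of `B` have pairwise intersections of at most one element,
hence `|M + B| ≥ 3 |M| - 3`. -/
theorem IsSidonLike.three_mul_card_le {M B : Finset Q} (hM : IsSidonLike M) {b₁ b₂ b₃ : Q}
    (h1 : b₁ ∈ B) (h2 : b₂ ∈ B) (h3 : b₃ ∈ B) (h12 : b₁ ≠ b₂) (h13 : b₁ ≠ b₃) (h23 : b₂ ≠ b₃) :
    3 * M.card ≤ (M + B).card + 3 := by
  have hsub : M.image (· + b₁) ∪ M.image (· + b₂) ∪ M.image (· + b₃) ⊆ M + B := by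
    intro z hz
    rw [Finset.mem_union, Finset.mem_union, Finset.mem_image, Finset.mem_image,
      Finset.mem_image] at hz
    rcases hz with (⟨m, hm, rfl⟩ | ⟨m, hm, rfl⟩) | ⟨m, hm, rfl⟩
    · exact Finset.add_mem_add hm h1
    · exact Finset.add_mem_add hm h2
    · exact Finset.add_mem_add hm h3
  have := Finset.card_le_card hsub
  have i12 := hM.card_inter_image h12
  have i13 := hM.card_inter_image h13
  have i23 := hM.card_inter_image h23
  have h4 := Finset.card_union_add_card_inter (M.image (· + b₁)) (M.image (· + b₂))
  have h5 := Finset.card_union_add_card_inter (M.image (· + b₁) ∪ M.image (· + b₂))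
    (M.image (· + b₃))
  have h6 : ((M.image (· + b₁) ∪ M.image (· + b₂)) ∩ M.image (· + b₃)).card ≤ 2 := by
    rw [Finset.union_inter_distrib_right]
    exact (Finset.card_union_le _ _).trans (by omega)
  rw [card_image_add, card_image_add] at h4
  rw [card_image_add] at h5
  omega

end Atoms

/-! ### Rigid sets and their Vosper property -/

section Vosper

variable {Q : Type*} [AddCommGroup Q] [DecidableEq Q]

/-- The properties shared by the images of a set in the quotients by its hyper-atoms: sums with `S`
do not fall below the Cauchy-Davenport bound, and sums with nonzero subgroups are larger by one
still, as long as they are not everything; and `S` is not much larger than a third of the group. -/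
structure IsRigid (S : Finset Q) : Prop where
  zero_mem : (0 : Q) ∈ S
  closure_eq : AddSubgroup.closure (S : Set Q) = ⊤
  two_le : 2 ≤ S.card
  card_add : ∀ X : Finset Q, X.Nonempty → (∃ z, z ∉ X + S) → X.card + S.card ≤ (X + S).card + 1
  card_add_elts : ∀ (L : AddSubgroup Q) [Finite L], L ≠ ⊥ → (∃ z, z ∉ S + elts L) →
    S.card + Nat.card L ≤ (S + elts L).card
  card_le : Finite Q → 3 * S.card ≤ Nat.card Q + 3

/-- A rigid set does not become `L`-periodic after removing a nonempty part of it lying in one coset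
of `L`. -/
theorem IsRigid.not_quasiperiodic {S P X₀ : Finset Q} (hS : IsRigid S) {L : AddSubgroup Q}
    (hL : L ≠ ⊥) (hSPX : S = P ∪ X₀) (hd : Disjoint P X₀) (hP : P.Nonempty)
    (hPL : ∀ x ∈ P, ∀ y ∈ P, x - y ∈ L) (hX : X₀.Nonempty) (hXL : L ≤ stab X₀) : False := by
  have hstab := finite_stab hX
  have hfin : Finite L := Finite.of_injective _ (AddSubgroup.inclusion_injective hXL)
  have hLX : Nat.card L ≤ X₀.card := card_le_of_le_stab hX hXL
  obtain ⟨p, hp⟩ := hP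
  have hc : (S + elts L).card ≤ X₀.card + Nat.card L := by
    have hsub : S + elts L ⊆ X₀ ∪ (elts L).image (· + p) := by
      intro z hz
      obtain ⟨x, hx, l, hl, rfl⟩ := Finset.mem_add.1 hz
      rw [hSPX, Finset.mem_union] at hx
      rw [Finset.mem_union, Finset.mem_image]
      rcases hx with hx | hx
      · right
        exact ⟨x - p + l, mem_elts.2 (add_mem (hPL x hx p hp) (mem_elts.1 hl)), by abel⟩
      · left
        rw [add_comm]
        exact (mem_stab.1 (hXL (mem_elts.1 hl)) x).2 hx
    refine (Finset.card_le_card hsub).trans ((Finset.card_union_le _ _).trans ?_)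
    rw [card_image_add, card_elts]
  have hPpos : 0 < P.card := Finset.card_pos.2 ⟨p, hp⟩
  have hScard : S.card = P.card + X₀.card := by rw [hSPX, Finset.card_union_of_disjoint hd]
  by_cases hz : ∃ z, z ∉ S + elts L
  · have := hS.card_add_elts L hL hz
    omega
  · push Not at hz
    have hQ : Finite Q := by
      apply Set.finite_univ_iff.1
      exact (Finset.finite_toSet (S + elts L)).subset (fun z _ => hz z)
    have := Fintype.ofFinite Q
    have h1 := hS.card_le hQ
    have h2 : Nat.card Q ≤ (S + elts L).card := by
      rw [Nat.card_eq_fintype_card]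
      exact Finset.card_le_card (fun z _ => hz z)
    have h3 : 0 < Nat.card L := Nat.card_pos
    omega

theorem IsRigid.exists_notMem {S : Finset Q} (hS : IsRigid S) : ∃ z, z ∉ S := by
  rcases finite_or_infinite Q with hfin | hinf
  · by_contra hcon
    push Not at hcon
    have := Fintype.ofFinite Q
    have h1 := hS.card_le hfin
    have h2 : Nat.card Q ≤ S.card := by
      rw [Nat.card_eq_fintype_card]
      exact Finset.card_le_card (fun z _ => hcon z)
    have := hS.two_le
    omega
  · exact Infinite.exists_notMem_finset S

theorem IsRigid.stab_eq_bot {S : Finset Q} (hS : IsRigid S) : stab S = ⊥ := by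
  by_contra hne
  have := finite_stab (C := S) ⟨0, hS.zero_mem⟩
  have h1 := add_elts_eq_self (C := S) (le_refl (stab S))
  have h2 := hS.card_add_elts (stab S) hne (by rw [h1]; exact hS.exists_notMem)
  rw [h1] at h2
  have : 0 < Nat.card (stab S) := Nat.card_pos
  omega

theorem le_stab_of_add_mem {X : Finset Q} {y : Q} (h : ∀ x ∈ X, x + y ∈ X) : y ∈ stab X :=
  mem_stab_of_forall (fun x hx => by rw [add_comm]; exact h x hx)

/-- If a rigid set grows by at most one element when a translate by `y` is adjoined, it is a
progression with difference `y`, and `y` generates the group. -/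
theorem IsRigid.isRun {S : Finset Q} (hS : IsRigid S) {y : Q} (hy : y ≠ 0)
    (h : (S ∪ S.image (· + y)).card ≤ S.card + 1) :
    AddSubgroup.zmultiples y = ⊤ ∧ IsRun y S := by
  rw [← Finset.union_sdiff_self_eq_union, Finset.card_union_of_disjoint Finset.disjoint_sdiff] at h
  have h1 : ((S.image (· + y)) \ S).card = 1 := by
    by_contra hne
    have h0 : ((S.image (· + y)) \ S).card = 0 := by omega
    rw [Finset.card_eq_zero, Finset.sdiff_eq_empty_iff_subset] at h0
    have : y ∈ stab S := le_stab_of_add_mem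
      (fun x hx => h0 (Finset.mem_image_of_mem (· + y) hx))
    rw [hS.stab_eq_bot] at this
    exact hy this
  obtain ⟨P, X₀, hX, hd, hPne, ⟨p, hp⟩, hinv⟩ := exists_run_of_card_sdiff h1
  have hPm : ∀ x ∈ P, ∃ i : ℕ, p + i • y = x := by
    intro x hx
    rw [hp, mem_run] at hx
    obtain ⟨i, _, hi⟩ := hx
    exact ⟨i, hi⟩
  rcases X₀.eq_empty_or_nonempty with h0 | h0
  · rw [h0, Finset.union_empty] at hX
    refine ⟨?_, by rw [hX]; exact ⟨p, hp⟩⟩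
    rw [eq_top_iff, ← hS.closure_eq, AddSubgroup.closure_le]
    intro x hx
    obtain ⟨i, hi⟩ := hPm x (hX ▸ hx)
    obtain ⟨j, hj⟩ := hPm 0 (hX ▸ hS.zero_mem)
    have : x = i • y - j • y := by
      rw [← hi, eq_neg_of_add_eq_zero_left hj]; abel
    rw [this]
    exact sub_mem (AddSubgroup.nsmul_mem_zmultiples y i) (AddSubgroup.nsmul_mem_zmultiples y j)
  · exfalso
    refine hS.not_quasiperiodic (L := AddSubgroup.zmultiples y) ?_ hX hd hPne ?_ h0 ?_
    · rwa [Ne, AddSubgroup.zmultiples_eq_bot]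
    · intro x hx x' hx'
      obtain ⟨i, rfl⟩ := hPm x hx
      obtain ⟨j, rfl⟩ := hPm x' hx'
      rw [add_sub_add_left_eq_sub]
      exact sub_mem (AddSubgroup.nsmul_mem_zmultiples y i) (AddSubgroup.nsmul_mem_zmultiples y j)
    · exact AddSubgroup.zmultiples_le_of_mem (le_stab_of_add_mem hinv)

/-- If distinct translates of `M` share at most one element, then adding `M` to `Y` contributes at
least `|M| - 1` elements, unless `M` consists of periods of the sumset. This follows from Kneser's
theorem together with the growth of `M` in the sum with the stabilizer. -/
theorem IsSidonLike.card_add_or {M Y : Finset Q} (hM : IsSidonLike M) (h0 : 0 ∈ M)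
    (hY : Y.Nonempty) : Y.card + M.card ≤ (M + Y).card + 1 ∨ ∀ x ∈ M, x ∈ stab (M + Y) := by
  have := finite_stab (C := M + Y) (Finset.Nonempty.add ⟨0, h0⟩ hY)
  by_cases hb : stab (M + Y) = ⊥
  · left
    have := kneser_of_stab_eq_bot ⟨0, h0⟩ hY hb
    omega
  by_cases hMs : ∀ x ∈ M, x ∈ stab (M + Y)
  · exact Or.inr hMs
  · left
    have h1 := kneser ⟨0, h0⟩ hY
    have h2 := hM.card_add_elts h0 hb hMs
    have h3 := Finset.card_le_card (subset_add_elts Y (stab (M + Y)))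
    omega

/-- **Vosper property** of rigid sets: if no two-element set has the smallest possible sumset with
`S`, then no admissible set has. Otherwise a `2`-atom `M` of `S` has it. The set `M` has at least
three elements, is not a subgroup, and so has small intersections with its translates; this is
incompatible with the equality `|M + S| = |M| + |S| - 1`. -/
theorem IsRigid.vosper {S : Finset Q} (hS : IsRigid S)
    (hno : ∀ y, y ≠ 0 → S.card + 2 ≤ (S ∪ S.image (· + y)).card) {X : Finset Q}
    (hX : Adm S X) : X.card + S.card ≤ (X + S).card := by
  by_contra hlt
  have hSne : S.Nonempty := ⟨0, hS.zero_mem⟩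
  obtain ⟨M, hM, hM0⟩ : ∃ M, IsAtomOf S M ∧ (0 : Q) ∈ M := by
    obtain ⟨M, hM⟩ := exists_isAtomOf hSne hX
    obtain ⟨m, hm⟩ := Finset.card_pos.1 (show 0 < M.card by have := hM.adm.1; omega)
    exact ⟨_, hM.image_add (-m), Finset.mem_image.2 ⟨m, hm, by simp⟩⟩
  have hMle := hM.le X hX
  have hMz : ∃ z, z ∉ M + S := by
    obtain ⟨_, z, w, _, hz, _⟩ := hM.adm
    exact ⟨z, hz⟩
  have hMge := hS.card_add M ⟨0, hM0⟩ hMz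
  have hMS : (M + S).card + 1 = M.card + S.card := by omega
  -- an atom of two elements is excluded by `hno`
  have hm3 : 3 ≤ M.card := by
    by_contra hm
    have hm2 : M.card = 2 := by have := hM.adm.1; omega
    obtain ⟨y, hy⟩ := Finset.card_eq_one.1 (show (M.erase 0).card = 1 by
      rw [Finset.card_erase_of_mem hM0, hm2])
    have hyM : y ∈ M.erase 0 := by rw [hy]; simp
    have hMe : M = {0} ∪ {y} := by
      rw [← Finset.insert_erase hM0, hy]; rfl
    have := hno y (Finset.ne_of_mem_erase hyM)
    have h2 : M + S = S ∪ S.image (· + y) := by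
      rw [hMe, Finset.union_add, add_comm ({0} : Finset Q) S, add_comm ({y} : Finset Q) S,
        add_singleton_eq_image,
        add_singleton_eq_image]
      simp
    rw [h2] at hMS
    omega
  -- an atom that is a subgroup would contradict `card_add_elts`
  rcases hM.subgroup_or_sidon hM0 with ⟨L, hLfin, hL, hML⟩ | hsid
  · rw [hML, add_comm] at hMz
    have := hS.card_add_elts L hL hMz
    rw [hML, card_elts, add_comm (elts L)] at hMS
    omega
  -- the sumset of the atom is aperiodic
  have hap : stab (M + S) = ⊥ := by
    by_contra hne
    have := finite_stab (C := M + S) (Finset.Nonempty.add ⟨0, hM0⟩ hSne)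
    have h1 := kneser ⟨0, hM0⟩ hSne
    have h2 := hS.card_add_elts (stab (M + S)) hne (by
      obtain ⟨z, hz⟩ := hMz
      refine ⟨z, fun hc => hz ?_⟩
      have := Finset.add_mem_add hM0 hc
      rwa [zero_add, ← add_assoc, add_elts_stab] at this)
    have h3 := Finset.card_le_card (subset_add_elts M (stab (M + S)))
    omega
  have hMnot : ¬ ∀ x ∈ M, x ∈ stab (M + S) := by
    intro hall
    rw [hap] at hall
    have : M ⊆ {0} := fun x hx => Finset.mem_singleton.2 (hall x hx)
    have := Finset.card_le_card this
    rw [Finset.card_singleton] at this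
    omega
  set L := AddSubgroup.closure (M : Set Q) with hLdef
  have hML : ∀ x ∈ M, x ∈ L := fun x hx => AddSubgroup.subset_closure hx
  by_cases hL : L = ⊤
  · -- the set `M` is itself generating; consider a `2`-atom of `M`
    have hadm : Adm M S := by
      obtain ⟨_, z, w, hzw, hz, hw⟩ := hM.adm
      rw [add_comm] at hz hw
      exact ⟨hS.two_le, z, w, hzw, hz, hw⟩
    obtain ⟨B, hB, hB0⟩ : ∃ B, IsAtomOf M B ∧ (0 : Q) ∈ B := by
      obtain ⟨B, hB⟩ := exists_isAtomOf ⟨0, hM0⟩ hadm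
      obtain ⟨m, hm⟩ := Finset.card_pos.1 (show 0 < B.card by have := hB.adm.1; omega)
      exact ⟨_, hB.image_add (-m), Finset.mem_image.2 ⟨m, hm, by simp⟩⟩
    have hBle := hB.le S hadm
    rw [add_comm S M] at hBle
    have hBM : (B + M).card + 1 ≤ B.card + M.card := by omega
    obtain ⟨_, z, _, _, hz, _⟩ := hB.adm
    rcases hB.subgroup_or_sidon hB0 with ⟨K, hKfin, hK, hBK⟩ | hsidB
    · by_cases hMK : ∀ x ∈ M, x ∈ K
      · have : L ≤ K := (AddSubgroup.closure_le K).2 hMK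
        apply hz
        have hzB : z ∈ B := by rw [hBK, mem_elts]; apply this; rw [hL]; trivial
        have := Finset.add_mem_add hzB hM0
        rwa [add_zero] at this
      · have := hsid.card_add_elts hM0 hK hMK
        rw [← hBK, add_comm M B, ← card_elts K, ← hBK] at this
        omega
    -- now both `M` and its atom `B` have small intersections of translates; counting `M + B` from
    -- two translates of either set gives `|B| = |M|`, and then three translates of `M` are too many
    · obtain ⟨b₁, hb₁, b₂, hb₂, hb⟩ := Finset.one_lt_card.1 (show 1 < B.card from hB.adm.1)
      obtain ⟨m₁, hm₁, m₂, hm₂, hm⟩ := Finset.one_lt_card.1 (show 1 < M.card by omega)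
      have h1 := hsid.two_mul_card_le hb₁ hb₂ hb
      have h2 := hsidB.two_mul_card_le hm₁ hm₂ hm
      rw [add_comm M B] at h1
      obtain ⟨a, b, c, ha, hb, hc, hab, hac, hbc⟩ := Finset.two_lt_card_iff.1
        (show 2 < B.card by omega)
      have h3 := hsid.three_mul_card_le ha hb hc hab hac hbc
      rw [add_comm M B] at h3
      omega
  · -- the set `M` lies in a proper subgroup `L`: all but one of the `L`-pieces of `S` are full
    classical
    let q : Q → Q ⧸ L := fun x => (x : Q ⧸ L)
    let pc : Q ⧸ L → Finset Q := fun c => S.filter (fun x => q x = c)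
    have hpcS : ∀ c, pc c ⊆ S := fun c => Finset.filter_subset _ _
    have hqadd : ∀ x ∈ M, ∀ y, q (x + y) = q y := by
      intro x hx y
      change ((x + y : Q) : Q ⧸ L) = (y : Q ⧸ L)
      rw [QuotientAddGroup.eq]
      have : -(x + y) + y = -x := by abel
      rw [this]
      exact neg_mem (hML x hx)
    have hMSq : ∀ c, (M + S).filter (fun x => q x = c) = M + pc c := by
      intro c
      ext z
      simp only [Finset.mem_filter, Finset.mem_add, pc]
      constructor
      · rintro ⟨⟨x, hx, y, hy, rfl⟩, hq⟩
        rw [hqadd x hx] at hq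
        exact ⟨x, hx, y, ⟨hy, hq⟩, rfl⟩
      · rintro ⟨x, hx, y, ⟨hy, hq⟩, rfl⟩
        exact ⟨⟨x, hx, y, hy, rfl⟩, by rwa [hqadd x hx]⟩
    have hMSsum : (M + S).card = ∑ c ∈ S.image q, (M + pc c).card := by
      rw [Finset.card_eq_sum_card_fiberwise (f := q) (t := S.image q)]
      · exact Finset.sum_congr rfl (fun c _ => by rw [hMSq])
      · intro z hz
        obtain ⟨x, hx, y, hy, rfl⟩ := Finset.mem_add.1 (Finset.mem_coe.1 hz)
        rw [hqadd x hx]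
        exact Finset.mem_coe.2 (Finset.mem_image_of_mem q hy)
    have hSsum : S.card = ∑ c ∈ S.image q, (pc c).card :=
      Finset.card_eq_sum_card_fiberwise (fun x hx => Finset.mem_coe.2
        (Finset.mem_image_of_mem q hx))
    have hne : ∀ c ∈ S.image q, (pc c).Nonempty := by
      intro c hc
      obtain ⟨x, hx, rfl⟩ := Finset.mem_image.1 hc
      exact ⟨x, Finset.mem_filter.2 ⟨hx, rfl⟩⟩
    have hsubM : ∀ Y : Finset Q, Y ⊆ M + Y := fun Y y hy => by
      have := Finset.add_mem_add hM0 hy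
      rwa [zero_add] at this
    -- in some coset of `L` the sumset grows by `|M| - 1`, which is all that is available, since
    -- otherwise `M` consists of periods of `M + S`
    have hex : ∃ c₀ ∈ S.image q, (pc c₀).card + M.card ≤ (M + pc c₀).card + 1 := by
      by_contra hcon
      push Not at hcon
      apply hMnot
      intro x hx
      apply mem_stab_of_forall
      intro z hz
      have hzc : z ∈ M + pc (q z) := by
        rw [← hMSq]; exact Finset.mem_filter.2 ⟨hz, rfl⟩
      have hc : q z ∈ S.image q := by
        obtain ⟨x, hx, y, hy, rfl⟩ := Finset.mem_add.1 hz
        rw [hqadd x hx]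
        exact Finset.mem_image_of_mem q hy
      rcases hsid.card_add_or hM0 (hne _ hc) with h | h
      · exact absurd h (not_le.2 (hcon _ hc))
      · have := (mem_stab.1 (h x hx) z).2 hzc
        rw [← hMSq] at this
        exact (Finset.mem_filter.1 this).1
    obtain ⟨c₀, hc₀, hc₀M⟩ := hex
    have hrest : ∀ c ∈ S.image q, c ≠ c₀ → M + pc c = pc c := by
      intro c hc hcc
      symm
      apply Finset.eq_of_subset_of_card_le (hsubM _)
      have e1 := Finset.add_sum_erase _ (fun c => (M + pc c).card) hc₀
      have e2 := Finset.add_sum_erase _ (fun c => (pc c).card) hc₀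
      have hc' : c ∈ (S.image q).erase c₀ := Finset.mem_erase.2 ⟨hcc, hc⟩
      have e3 := Finset.add_sum_erase _ (fun c => (M + pc c).card) hc'
      have e4 := Finset.add_sum_erase _ (fun c => (pc c).card) hc'
      have e5 : ∑ c ∈ ((S.image q).erase c₀).erase c, (pc c).card ≤
          ∑ c ∈ ((S.image q).erase c₀).erase c, (M + pc c).card :=
        Finset.sum_le_sum (fun c _ => Finset.card_le_card (hsubM _))
      omega
    have hperiodic : ∀ z ∈ S \ pc c₀, ∀ x ∈ M, x + z ∈ S \ pc c₀ := by
      intro z hz x hx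
      obtain ⟨hzS, hzc⟩ := Finset.mem_sdiff.1 hz
      have hqz : q z ≠ c₀ := fun h => hzc (Finset.mem_filter.2 ⟨hzS, h⟩)
      have := hrest (q z) (Finset.mem_image_of_mem q hzS) hqz
      have hmem : x + z ∈ pc (q z) := by
        rw [← this]
        exact Finset.add_mem_add hx (Finset.mem_filter.2 ⟨hzS, rfl⟩)
      refine Finset.mem_sdiff.2 ⟨hpcS _ hmem, fun hc => hqz ?_⟩
      rw [← hqadd x hx]
      exact (Finset.mem_filter.1 hc).2
    have hstab : L ≤ stab (S \ pc c₀) := by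
      rw [hLdef, AddSubgroup.closure_le]
      intro x hx
      exact mem_stab_of_forall (fun z hz => hperiodic z hz x hx)
    refine hS.not_quasiperiodic (L := L) (P := pc c₀) (X₀ := S \ pc c₀) ?_
      (Finset.union_sdiff_of_subset (hpcS c₀)).symm Finset.disjoint_sdiff (hne c₀ hc₀) ?_ ?_ hstab
    · intro hbot
      have : M ⊆ {0} := fun x hx => by
        have := hML x hx
        rw [hbot] at this
        exact Finset.mem_singleton.2 this
      have := Finset.card_le_card this
      rw [Finset.card_singleton] at this
      omega
    · intro x hx y hy
      have : q y = q x := (Finset.mem_filter.1 hy).2.trans (Finset.mem_filter.1 hx).2.symm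
      have := QuotientAddGroup.eq.1 this
      rwa [neg_add_eq_sub] at this
    · by_contra hemp
      rw [Finset.not_nonempty_iff_eq_empty, Finset.sdiff_eq_empty_iff_subset] at hemp
      apply hL
      rw [eq_top_iff, ← hS.closure_eq, AddSubgroup.closure_le]
      intro x hx
      have : q 0 = q x := (Finset.mem_filter.1 (hemp hS.zero_mem)).2.trans
        (Finset.mem_filter.1 (hemp hx)).2.symm
      have := QuotientAddGroup.eq.1 this
      rwa [neg_zero, zero_add] at this

end Vosper

/-! ### Fibres of a homomorphism and level sets -/

section Fibres

variable {G Q : Type*} [AddCommGroup G] [DecidableEq G] [AddCommGroup Q] [DecidableEq Q]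

/-- The fibre of `Y` over `q`, that is, the intersection of `Y` with a coset of the kernel. -/
def fib (φ : G →+ Q) (Y : Finset G) (q : Q) : Finset G := Y.filter (fun x => φ x = q)

/-- The points over which `Y` has at least `c` elements. -/
def lev (φ : G →+ Q) (Y : Finset G) (c : ℕ) : Finset Q :=
  (Y.image φ).filter (fun q => c ≤ (fib φ Y q).card)

variable {φ : G →+ Q}

theorem mem_fib {Y : Finset G} {q : Q} {x : G} : x ∈ fib φ Y q ↔ x ∈ Y ∧ φ x = q :=
  Finset.mem_filter

theorem fib_subset (Y : Finset G) (q : Q) : fib φ Y q ⊆ Y := Finset.filter_subset _ _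

theorem fib_nonempty {Y : Finset G} {q : Q} : (fib φ Y q).Nonempty ↔ q ∈ Y.image φ := by
  constructor
  · rintro ⟨x, hx⟩
    exact Finset.mem_image.2 ⟨x, mem_fib.1 hx⟩
  · intro hq
    obtain ⟨x, hx⟩ := Finset.mem_image.1 hq
    exact ⟨x, mem_fib.2 hx⟩

theorem card_fib_pos {Y : Finset G} {q : Q} (hq : q ∈ Y.image φ) : 0 < (fib φ Y q).card :=
  Finset.card_pos.2 (fib_nonempty.2 hq)

theorem mem_image_of_card_fib_pos {Y : Finset G} {q : Q} (h : 0 < (fib φ Y q).card) :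
    q ∈ Y.image φ := fib_nonempty.1 (Finset.card_pos.1 h)

theorem fib_add_subset (A B : Finset G) (p q : Q) :
    fib φ A p + fib φ B q ⊆ fib φ (A + B) (p + q) := by
  intro z hz
  obtain ⟨x, hx, y, hy, rfl⟩ := Finset.mem_add.1 hz
  rw [mem_fib] at hx hy
  exact mem_fib.2 ⟨Finset.add_mem_add hx.1 hy.1, by rw [map_add, hx.2, hy.2]⟩

theorem image_add_hom (A B : Finset G) : (A + B).image φ = A.image φ + B.image φ :=
  Finset.image_add φ

theorem card_eq_sum_fib {Y : Finset G} {I : Finset Q} (h : Y.image φ ⊆ I) :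
    Y.card = ∑ q ∈ I, (fib φ Y q).card :=
  Finset.card_eq_sum_card_fiberwise (fun _ hx => Finset.mem_coe.2
    (h (Finset.mem_image_of_mem φ hx)))

variable [Finite φ.ker]

theorem card_fib_le (Y : Finset G) (q : Q) : (fib φ Y q).card ≤ Nat.card φ.ker := by
  rcases (fib φ Y q).eq_empty_or_nonempty with h0 | ⟨x₀, hx₀⟩
  · rw [h0]; exact Nat.zero_le _
  · rw [← card_elts, ← card_image_add (elts φ.ker) x₀]
    apply Finset.card_le_card
    intro x hx
    rw [mem_fib] at hx hx₀
    refine Finset.mem_image.2 ⟨x - x₀, ?_, by abel⟩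
    rw [mem_elts, AddMonoidHom.mem_ker, map_sub, hx.2, hx₀.2, sub_self]

/-- A fibre as large as the kernel is a whole coset of it. -/
theorem mem_of_card_fib {Y : Finset G} {q : Q} (h : Nat.card φ.ker ≤ (fib φ Y q).card) {x : G}
    (hx : φ x = q) : x ∈ Y := by
  have hsub : fib φ Y q ⊆ (elts φ.ker).image (· + x) := by
    intro y hy
    rw [mem_fib] at hy
    refine Finset.mem_image.2 ⟨y - x, ?_, by abel⟩
    rw [mem_elts, AddMonoidHom.mem_ker, map_sub, hy.2, hx, sub_self]
  have he := Finset.eq_of_subset_of_card_le hsub (by rwa [card_image_add, card_elts])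
  have : x ∈ fib φ Y q := by
    rw [he]
    exact Finset.mem_image.2 ⟨0, mem_elts.2 (zero_mem _), by simp⟩
  exact (mem_fib.1 this).1

theorem card_fib_eq_iff (hφ : Function.Surjective φ) {Y : Finset G} {q : Q} :
    (fib φ Y q).card = Nat.card φ.ker ↔ ∀ x, φ x = q → x ∈ Y := by
  constructor
  · exact fun h x hx => mem_of_card_fib h.ge hx
  · intro h
    apply le_antisymm (card_fib_le Y q)
    obtain ⟨x, hx⟩ := hφ q
    rw [← card_elts, ← card_image_add (elts φ.ker) x]
    apply Finset.card_le_card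
    intro y hy
    obtain ⟨k, hk, rfl⟩ := Finset.mem_image.1 hy
    have : φ (k + x) = q := by
      rw [map_add, hx, AddMonoidHom.mem_ker.1 (mem_elts.1 hk), zero_add]
    exact mem_fib.2 ⟨h _ this, this⟩

/-- Pigeonhole principle in a coset: two fibres with more than `|ker φ|` elements in total have a
whole coset as their sum. -/
theorem card_fib_add_of_lt (hφ : Function.Surjective φ) {A B : Finset G} {p q : Q}
    (h : Nat.card φ.ker < (fib φ A p).card + (fib φ B q).card) :
    (fib φ (A + B) (p + q)).card = Nat.card φ.ker := by
  rw [card_fib_eq_iff hφ]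
  intro z hz
  by_contra hcon
  have hd : Disjoint (fib φ A p) ((fib φ B q).image (fun x => z - x)) := by
    rw [Finset.disjoint_left]
    intro x hx hx'
    obtain ⟨y, hy, rfl⟩ := Finset.mem_image.1 hx'
    exact hcon (Finset.mem_add.2 ⟨_, (mem_fib.1 hx).1, y, (mem_fib.1 hy).1, by abel⟩)
  have hsub : fib φ A p ∪ (fib φ B q).image (fun x => z - x) ⊆
      fib φ (A ∪ (fib φ B q).image (fun x => z - x)) p := by
    intro x hx
    rcases Finset.mem_union.1 hx with hx | hx
    · exact mem_fib.2 ⟨Finset.mem_union_left _ (mem_fib.1 hx).1, (mem_fib.1 hx).2⟩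
    · refine mem_fib.2 ⟨Finset.mem_union_right _ hx, ?_⟩
      obtain ⟨y, hy, rfl⟩ := Finset.mem_image.1 hx
      rw [map_sub, hz, (mem_fib.1 hy).2, add_sub_cancel_right]
  have h1 := (Finset.card_le_card hsub).trans (card_fib_le _ _)
  rw [Finset.card_union_of_disjoint hd,
    Finset.card_image_of_injective _ sub_right_injective] at h1
  omega

theorem card_fib_add_left {A B : Finset G} {p q : Q} (hq : q ∈ B.image φ) :
    (fib φ A p).card ≤ (fib φ (A + B) (p + q)).card :=
  (Finset.card_le_card_add_right (fib_nonempty.2 hq)).trans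
    (Finset.card_le_card (fib_add_subset A B p q))

theorem card_fib_add_right {A B : Finset G} {p q : Q} (hp : p ∈ A.image φ) :
    (fib φ B q).card ≤ (fib φ (A + B) (p + q)).card :=
  (Finset.card_le_card_add_left (fib_nonempty.2 hp)).trans
    (Finset.card_le_card (fib_add_subset A B p q))

theorem mem_lev {Y : Finset G} {c : ℕ} (hc : 1 ≤ c) {q : Q} :
    q ∈ lev φ Y c ↔ c ≤ (fib φ Y q).card := by
  rw [lev, Finset.mem_filter]
  exact ⟨fun h => h.2, fun h => ⟨mem_image_of_card_fib_pos (by omega), h⟩⟩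

theorem lev_subset (Y : Finset G) (c : ℕ) : lev φ Y c ⊆ Y.image φ := Finset.filter_subset _ _

/-- The layer-cake formula: a set is counted by its level sets. -/
theorem card_eq_sum_lev (Y : Finset G) :
    Y.card = ∑ c ∈ Finset.Icc 1 (Nat.card φ.ker), (lev φ Y c).card := by
  rw [card_eq_sum_fib (φ := φ) (Finset.Subset.refl (Y.image φ))]
  simp only [lev, Finset.card_filter]
  rw [Finset.sum_comm]
  refine Finset.sum_congr rfl (fun q _ => ?_)
  rw [← Finset.card_filter]
  have : (Finset.Icc 1 (Nat.card φ.ker)).filter (fun c => c ≤ (fib φ Y q).card) =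
      Finset.Icc 1 (fib φ Y q).card := by
    ext c
    have := card_fib_le (φ := φ) Y q
    simp only [Finset.mem_filter, Finset.mem_Icc]
    omega
  rw [this, Nat.card_Icc, Nat.add_sub_cancel]

theorem lev_add_subset {Y S : Finset G} {c : ℕ} (hc : 1 ≤ c) :
    lev φ Y c + S.image φ ⊆ lev φ (Y + S) c := by
  intro z hz
  obtain ⟨y, hy, p, hp, rfl⟩ := Finset.mem_add.1 hz
  rw [mem_lev hc] at hy ⊢
  exact hy.trans (card_fib_add_left hp)

/-- Outside the fibres over `I`, every fibre is at most a whole coset. -/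
theorem card_le_sum_fib_add {Y : Finset G} {I : Finset Q} (hI : I ⊆ Y.image φ) :
    Y.card ≤ ∑ q ∈ I, (fib φ Y q).card + Nat.card φ.ker * ((Y.image φ).card - I.card) := by
  rw [card_eq_sum_fib (φ := φ) (Finset.Subset.refl (Y.image φ)), ← Finset.sum_sdiff hI, add_comm]
  apply Nat.add_le_add_left
  rw [← Finset.card_sdiff_of_subset hI, mul_comm, ← smul_eq_mul]
  exact Finset.sum_le_card_nsmul _ _ _ (fun q _ => card_fib_le Y q)

/-- The preimage of a finite set. -/
noncomputable def pre (φ : G →+ Q) [Finite φ.ker] (X : Finset Q) : Finset G :=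
  Set.Finite.toFinset (s := φ ⁻¹' (X : Set Q)) (X.finite_toSet.preimage' (fun q _ => by
    rcases (φ ⁻¹' {q}).eq_empty_or_nonempty with h | ⟨x, hx⟩
    · rw [h]; exact Set.finite_empty
    · refine ((elts φ.ker).image (· + x)).finite_toSet.subset (fun y hy => ?_)
      refine Finset.mem_coe.2 (Finset.mem_image.2 ⟨y - x, ?_, by abel⟩)
      have hx' : φ x = q := hx
      have hy' : φ y = q := hy
      rw [mem_elts, AddMonoidHom.mem_ker, map_sub, hx', hy', sub_self]))

theorem mem_pre {X : Finset Q} {x : G} : x ∈ pre φ X ↔ φ x ∈ X := by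
  simp [pre]

theorem image_pre (hφ : Function.Surjective φ) (X : Finset Q) : (pre φ X).image φ = X := by
  ext q
  rw [Finset.mem_image]
  constructor
  · rintro ⟨x, hx, rfl⟩; exact mem_pre.1 hx
  · intro hq
    obtain ⟨x, rfl⟩ := hφ q
    exact ⟨x, mem_pre.2 hq, rfl⟩

theorem card_pre (hφ : Function.Surjective φ) (X : Finset Q) :
    (pre φ X).card = Nat.card φ.ker * X.card := by
  rw [card_eq_sum_fib (φ := φ) (image_pre hφ X).subset, mul_comm, ← smul_eq_mul]
  apply Finset.sum_const_nat
  intro q hq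
  rw [card_fib_eq_iff hφ]
  rintro x rfl
  exact mem_pre.2 hq

theorem pre_add (X : Finset Q) (S : Finset G) : pre φ X + S = pre φ (X + S.image φ) := by
  ext z
  rw [mem_pre]
  constructor
  · intro hz
    obtain ⟨x, hx, s, hs, rfl⟩ := Finset.mem_add.1 hz
    rw [map_add]
    exact Finset.add_mem_add (mem_pre.1 hx) (Finset.mem_image_of_mem φ hs)
  · intro hz
    obtain ⟨x, hx, p, hp, hxp⟩ := Finset.mem_add.1 hz
    obtain ⟨s, hs, rfl⟩ := Finset.mem_image.1 hp
    refine Finset.mem_add.2 ⟨z - s, mem_pre.2 ?_, s, hs, by abel⟩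
    rwa [map_sub, ← hxp, add_sub_cancel_right]

theorem ker_le_stab_of_full {Y : Finset G}
    (h : ∀ q ∈ Y.image φ, (fib φ Y q).card = Nat.card φ.ker) :
    φ.ker ≤ stab Y := by
  intro k hk
  apply mem_stab_of_forall
  intro x hx
  refine mem_of_card_fib (h _ (Finset.mem_image_of_mem φ hx)).ge ?_
  rw [map_add, AddMonoidHom.mem_ker.1 hk, zero_add]

/-- If the cosets met by `Y` have at most `|Y|` elements in total, then `Y` is their union. -/
theorem ker_le_stab_of_card {Y : Finset G} (h : Nat.card φ.ker * (Y.image φ).card ≤ Y.card) :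
    φ.ker ≤ stab Y := by
  apply ker_le_stab_of_full
  intro q hq
  have h1 := card_le_sum_fib_add (φ := φ) (Finset.singleton_subset_iff.2 hq)
  rw [Finset.sum_singleton, Finset.card_singleton] at h1
  have h2 := card_fib_le (φ := φ) Y q
  have h3 : 0 < (Y.image φ).card := Finset.card_pos.2 ⟨q, hq⟩
  have h4 : Nat.card φ.ker * (Y.image φ).card =
      Nat.card φ.ker * ((Y.image φ).card - 1) + Nat.card φ.ker := by
    rw [← Nat.mul_succ]; congr 1; omega
  omega

end Fibres

/-! ### Small sumsets over the quotient by a hyper-atom -/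

section Config

variable {G Q : Type*} [AddCommGroup G] [DecidableEq G] [AddCommGroup Q] [DecidableEq Q]

/-- A pair of sets with small sumset, seen over the quotient by a hyper-atom of the first one, which
is the kernel of `φ` and has order `h`. The field `test` says that `h * |φ(S)| - h` is the second
connectivity of `S`, as the hyper-atom is a `2`-fragment. -/
structure Config (φ : G →+ Q) (S T : Finset G) (h μ : ℕ) : Prop where
  surj : Function.Surjective φ
  fin : Finite φ.ker
  card_ker : Nat.card φ.ker = h
  two_le : 2 ≤ h
  rigid : IsRigid (S.image φ)
  test : ∀ X, Adm S X → X.card + h * (S.image φ).card ≤ (X + S).card + h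
  adm : Adm S T
  hμ : μ ≤ 1
  card_S : 3 ≤ S.card + μ
  card_T : 4 ≤ T.card + 2 * μ
  card_S_le : S.card ≤ T.card
  aper : stab (T + S) = ⊥
  card : (T + S).card + μ = S.card + T.card
  small : Finite Q → 3 * (T + S).card ≤ 2 * (h * Nat.card Q) + 2 * μ

/-- Suppose that `S` covers its cosets up to fewer than one coset, that `Y` contains a whole coset,
and that `|Y + S| ≤ |Y| + |S|`. Then the images in the quotient satisfy
`|φ(Y + S)| < |φ(Y)| + |φ(S)|`. Otherwise the levels of `Y + S` exceed those of `Y` by so much that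
`|Y + S| > |Y| + |S|`. -/
theorem IsRigid.card_image_add_le {φ : G →+ Q} [Finite φ.ker] (hφ : Function.Surjective φ)
    {Y S : Finset G} (hS : IsRigid (S.image φ))
    (h1 : Nat.card φ.ker * (S.image φ).card ≤ S.card + Nat.card φ.ker)
    (h2 : S.card < Nat.card φ.ker * (S.image φ).card)
    (hfull : ∃ y, (fib φ Y y).card = Nat.card φ.ker) (hYS : (Y + S).card ≤ Y.card + S.card) :
    ((Y + S).image φ).card + 1 ≤ (Y.image φ).card + (S.image φ).card := by
  by_contra hcon
  have hbig : (Y.image φ).card + (S.image φ).card ≤ ((Y + S).image φ).card := by omega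
  set h := Nat.card φ.ker with hh
  set s := (S.image φ).card with hs
  -- `S` has `e + 1` holes in the cosets it meets
  obtain ⟨e, he⟩ := Nat.exists_eq_add_of_lt h2
  have hs2 : 2 ≤ s := hS.two_le
  have hhs : h * s = h * (s - 1) + h := by
    rw [← Nat.mul_succ]; congr 1; omega
  have hσ : ∀ p ∈ S.image φ, h ≤ (fib φ S p).card + (e + 1) := by
    intro p hp
    have := card_le_sum_fib_add (φ := φ) (Finset.singleton_subset_iff.2 hp)
    rw [Finset.sum_singleton, Finset.card_singleton, ← hh, ← hs] at this
    omega
  obtain ⟨y, hy⟩ := hfull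
  -- the Cauchy-Davenport bound in each level: the gain is at least `s - 1`
  have hbase : ∀ c ∈ Finset.Icc 1 h, (lev φ Y c).card + s ≤ (lev φ (Y + S) c).card + 1 := by
    intro c hc
    rw [Finset.mem_Icc] at hc
    have hsub := Finset.card_le_card (lev_add_subset (φ := φ) (Y := Y) (S := S) hc.1)
    have hyc : y ∈ lev φ Y c := (mem_lev hc.1).2 (by omega)
    by_cases hz : ∃ z, z ∉ lev φ Y c + S.image φ
    · have := hS.card_add _ ⟨y, hyc⟩ hz
      omega
    · push Not at hz
      have h3 : ((Y + S).image φ).card ≤ (lev φ Y c + S.image φ).card :=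
        Finset.card_le_card (fun z _ => hz z)
      have h4 := Finset.card_le_card (lev_subset (φ := φ) Y c)
      omega
  have hsumR := card_eq_sum_lev (φ := φ) (Y + S)
  have hsumY := card_eq_sum_lev (φ := φ) Y
  rw [← hh] at hsumR hsumY
  -- it remains to gain one more in enough levels: in all of them if one fibre of `S` contains all
  -- the holes, and in the levels up to `h - e` if every fibre of `S` has at most `e` holes
  by_cases hp : ∃ p ∈ S.image φ, (fib φ S p).card + (e + 1) = h
  · -- a single fibre of `S` is not full
    obtain ⟨p, hp, hpe⟩ := hp
    have hothers : ∀ i ∈ S.image φ, i ≠ p → (fib φ S i).card = h := by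
      intro i hi hip
      have h3 := card_le_sum_fib_add (φ := φ) (Y := S) (I := {i, p}) (by
        intro x hx
        rw [Finset.mem_insert, Finset.mem_singleton] at hx
        rcases hx with rfl | rfl <;> assumption)
      rw [Finset.sum_pair hip, Finset.card_pair hip, ← hh, ← hs] at h3
      have h4 := card_fib_le (φ := φ) S i
      have : h * s = h * (s - 2) + h + h := by
        rw [← Nat.mul_succ, ← Nat.mul_succ]; congr 1; omega
      omega
    have hgood : ∀ c ∈ Finset.Icc 1 h, (lev φ Y c).card + s ≤ (lev φ (Y + S) c).card := by
      intro c hc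
      rw [Finset.mem_Icc] at hc
      have hsub : (Y + S).image φ ⊆
          lev φ (Y + S) c ∪ (Y.image φ \ lev φ Y c).image (· + p) := by
        intro z hz
        rw [image_add_hom] at hz
        obtain ⟨q, hq, i, hi, rfl⟩ := Finset.mem_add.1 hz
        rw [Finset.mem_union, mem_lev hc.1]
        by_cases hip : i = p
        · by_cases hqc : q ∈ lev φ Y c
          · left
            exact (mem_lev hc.1).1 (lev_add_subset hc.1 (Finset.add_mem_add hqc hi))
          · right
            exact Finset.mem_image.2 ⟨q, Finset.mem_sdiff.2 ⟨hq, hqc⟩, by rw [hip]⟩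
        · left
          have := card_fib_add_right (φ := φ) (B := S) (q := i) hq
          rw [hothers i hi hip] at this
          omega
      have h3 := Finset.card_le_card hsub
      have h4 := Finset.card_union_le (lev φ (Y + S) c) ((Y.image φ \ lev φ Y c).image (· + p))
      have h5 := Finset.card_le_card (lev_subset (φ := φ) Y c)
      rw [card_image_add, Finset.card_sdiff_of_subset (lev_subset Y c)] at h4
      omega
    have := Finset.sum_le_sum hgood
    rw [Finset.sum_add_distrib, Finset.sum_const, Nat.card_Icc, Nat.add_sub_cancel,
      smul_eq_mul] at this
    omega
  · push Not at hp
    have hgood : ∀ c ∈ Finset.Icc 1 h, (lev φ Y c).card + (s - 1) +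
        (if c ≤ h - e then 1 else 0) ≤ (lev φ (Y + S) c).card := by
      intro c hc
      have h3 := hbase c hc
      rw [Finset.mem_Icc] at hc
      split_ifs with hce
      · have hsub : (Y + S).image φ ⊆ lev φ (Y + S) c := by
          intro z hz
          rw [image_add_hom] at hz
          obtain ⟨q, hq, i, hi, rfl⟩ := Finset.mem_add.1 hz
          rw [mem_lev hc.1]
          have h4 := card_fib_add_right (φ := φ) (B := S) (q := i) hq
          have h5 := hp i hi
          have h6 := hσ i hi
          omega
        have h4 := Finset.card_le_card hsub
        have h5 := Finset.card_le_card (lev_subset (φ := φ) Y c)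
        omega
      · omega
    have := Finset.sum_le_sum hgood
    rw [Finset.sum_add_distrib, Finset.sum_add_distrib, Finset.sum_const, Nat.card_Icc,
      Nat.add_sub_cancel, smul_eq_mul, ← Finset.card_filter] at this
    have hf : (Finset.Icc 1 h).filter (fun c => c ≤ h - e) = Finset.Icc 1 (h - e) := by
      ext c
      simp only [Finset.mem_filter, Finset.mem_Icc]
      omega
    rw [hf, Nat.card_Icc] at this
    omega

variable {φ : G →+ Q} {S T : Finset G} {h μ : ℕ}

namespace Config

/-- As `T` itself is admissible, `S` has at most `h - μ` holes in the cosets that it meets. -/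
theorem h_mul_le (C : Config φ S T h μ) : h * (S.image φ).card + μ ≤ S.card + h := by
  have h1 := C.test T C.adm
  have h2 := C.card
  omega

theorem not_periodic_S (C : Config φ S T h μ) : S.card < h * (S.image φ).card := by
  have := C.fin
  by_contra hcon
  have h1 : φ.ker ≤ stab S := ker_le_stab_of_card (by rw [C.card_ker]; omega)
  have h2 := h1.trans (stab_le_stab_add_right T S)
  rw [C.aper, le_bot_iff] at h2
  have h3 := C.two_le
  rw [← C.card_ker, h2, AddSubgroup.card_bot] at h3
  omega

theorem not_periodic_T (C : Config φ S T h μ) : T.card < h * (T.image φ).card := by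
  have := C.fin
  by_contra hcon
  have h1 : φ.ker ≤ stab T := ker_le_stab_of_card (by rw [C.card_ker]; omega)
  have h2 := h1.trans (stab_le_stab_add_left T S)
  rw [C.aper, le_bot_iff] at h2
  have h3 := C.two_le
  rw [← C.card_ker, h2, AddSubgroup.card_bot] at h3
  omega

theorem ker_not_le (C : Config φ S T h μ) : ¬ φ.ker ≤ stab (T + S) := by
  intro h2
  rw [C.aper, le_bot_iff] at h2
  have h3 := C.two_le
  rw [← C.card_ker, h2, AddSubgroup.card_bot] at h3
  omega

/-- The defining property of the hyper-atom, applied to a fibre of `T`. -/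
theorem test_fib (C : Config φ S T h μ) {x : Q} (hx : 2 ≤ (fib φ T x).card) :
    (fib φ T x).card + h * (S.image φ).card ≤ (fib φ T x + S).card + h :=
  C.test _ (C.adm.mono hx (fib_subset T x))

/-- `T` together with the whole coset over `x`. -/
noncomputable def fill (φ : G →+ Q) [Finite φ.ker] (T : Finset G) (x : Q) : Finset G :=
  T ∪ pre φ {x}

theorem card_fill [Finite φ.ker] (hφ : Function.Surjective φ) (T : Finset G) (x : Q) :
    (fill φ T x).card + (fib φ T x).card = T.card + Nat.card φ.ker := by
  have h1 := Finset.card_union_add_card_inter T (pre φ {x})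
  have h2 : T ∩ pre φ {x} = fib φ T x := by
    ext y
    rw [Finset.mem_inter, mem_pre, Finset.mem_singleton, mem_fib]
  rw [h2, card_pre hφ, Finset.card_singleton, mul_one] at h1
  exact h1

theorem image_fill [Finite φ.ker] (hφ : Function.Surjective φ) {T : Finset G} {x : Q}
    (hx : x ∈ T.image φ) : (fill φ T x).image φ = T.image φ := by
  rw [fill, Finset.image_union, image_pre hφ, Finset.union_eq_left]
  exact Finset.singleton_subset_iff.2 hx

/-- Submodularity of the sumset with `S`, for `T` and the whole coset over `x`. -/
theorem card_fill_add [Finite φ.ker] (hφ : Function.Surjective φ) (S T : Finset G) (x : Q) :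
    (fill φ T x + S).card + (fib φ T x + S).card ≤
      (T + S).card + Nat.card φ.ker * (S.image φ).card := by
  have h1 := Finset.card_union_add_card_inter (T + S) (pre φ {x} + S)
  have h2 : fib φ T x + S ⊆ (T + S) ∩ (pre φ {x} + S) := by
    refine Finset.subset_inter (Finset.add_subset_add_right (fib_subset T x))
      (Finset.add_subset_add_right (fun y hy => ?_))
    rw [mem_pre, (mem_fib.1 hy).2]
    exact Finset.mem_singleton_self x
  have h3 := Finset.card_le_card h2
  have h4 : (pre φ {x} + S).card = Nat.card φ.ker * (S.image φ).card := by
    rw [pre_add, card_pre hφ, add_comm, add_singleton_eq_image, card_image_add]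
  rw [fill, Finset.union_add]
  omega

/-- In the quotient the sumset is as small as the Cauchy-Davenport bound. If `T` has a fibre with at
least two elements, then filling it up does not increase `|T + S| - |T|` by the choice of the
hyper-atom, so that `IsRigid.card_image_add_le` applies. -/
theorem card_image_add_le (C : Config φ S T h μ) :
    ((T + S).image φ).card + 1 ≤ (T.image φ).card + (S.image φ).card := by
  have := C.fin
  have hker := C.card_ker
  have h1 : Nat.card φ.ker * (S.image φ).card ≤ S.card + Nat.card φ.ker := by
    have := C.h_mul_le; rw [hker]; omega
  have h2 : S.card < Nat.card φ.ker * (S.image φ).card := by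
    have := C.not_periodic_S; rwa [hker]
  have hfullfill : ∀ x, (fib φ (fill φ T x) x).card = Nat.card φ.ker := by
    intro x
    rw [card_fib_eq_iff C.surj]
    rintro y rfl
    exact Finset.mem_union_right _ (mem_pre.2 (Finset.mem_singleton_self _))
  have hcard := C.card
  by_cases hx : ∃ x, 2 ≤ (fib φ T x).card
  · obtain ⟨x, hx⟩ := hx
    have hxT : x ∈ T.image φ := mem_image_of_card_fib_pos (by omega)
    have h3 := C.test_fib hx
    have h4 := card_fill_add C.surj S T x
    have h5 := card_fill C.surj T x
    have h6 := C.rigid.card_image_add_le C.surj (Y := fill φ T x) h1 h2 ⟨x, hfullfill x⟩ (by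
      rw [hker] at h4 h5
      omega)
    rwa [image_add_hom, image_fill C.surj hxT, ← image_add_hom] at h6
  · -- all fibres of `T` are singletons, and `test` does not apply to them. If the bound fails, then
    -- the levels of `fill φ T x + S`, of which the second one contains a translate of `φ(T)`, give
    -- `|T| ≤ |φ(S)|`, but `|φ(S)| < |S| ≤ |T|`.
    push Not at hx
    by_contra hcon
    have hone : ∀ x ∈ T.image φ, (fib φ T x).card = 1 := by
      intro x hxT
      have := card_fib_pos hxT
      have := hx x
      omega
    have hT : T.card = (T.image φ).card := by
      rw [card_eq_sum_fib (φ := φ) (Finset.Subset.refl _), Finset.sum_congr rfl hone]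
      simp
    obtain ⟨x, hxT⟩ : (T.image φ).Nonempty := by
      rw [Finset.image_nonempty, ← Finset.card_pos]
      have := C.adm.1
      omega
    have hR : (fill φ T x + S).image φ = (T + S).image φ := by
      rw [image_add_hom, image_fill C.surj hxT, ← image_add_hom]
    have h3 := card_fill_add C.surj S T x
    have h4 : S.card ≤ (fib φ T x + S).card :=
      Finset.card_le_card_add_left (fib_nonempty.2 hxT)
    have h5 := card_eq_sum_lev (φ := φ) (fill φ T x + S)
    rw [hker] at h3 h5
    set s := (S.image φ).card with hs
    have hh := C.two_le
    have hlev : ∀ c ∈ Finset.Icc 1 h, s ≤ (lev φ (fill φ T x + S) c).card := by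
      intro c hc
      rw [Finset.mem_Icc] at hc
      rw [hs, ← card_image_add (S.image φ) x]
      apply Finset.card_le_card
      intro z hz
      obtain ⟨i, hi, rfl⟩ := Finset.mem_image.1 hz
      rw [mem_lev hc.1, add_comm i x]
      have := card_fib_add_left (φ := φ) (A := fill φ T x) (p := x) hi
      rw [hfullfill, hker] at this
      omega
    have hl1 : (lev φ (fill φ T x + S) 1).card = ((T + S).image φ).card := by
      rw [← hR]
      congr 1
      ext z
      rw [mem_lev le_rfl]
      exact ⟨fun hz => mem_image_of_card_fib_pos hz, fun hz => card_fib_pos hz⟩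
    have hsum : ∑ c ∈ Finset.Icc 1 h, (lev φ (fill φ T x + S) c).card =
        (lev φ (fill φ T x + S) 1).card + ((lev φ (fill φ T x + S) 2).card +
          ∑ c ∈ Finset.Icc 3 h, (lev φ (fill φ T x + S) c).card) := by
      rw [← Finset.add_sum_Ioc_eq_sum_Icc (by omega), ← Finset.Icc_add_one_left_eq_Ioc,
        ← Finset.add_sum_Ioc_eq_sum_Icc (by omega), ← Finset.Icc_add_one_left_eq_Ioc]
      rfl
    have h6 : (h - 2) * s ≤ ∑ c ∈ Finset.Icc 3 h, (lev φ (fill φ T x + S) c).card := by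
      have e : (Finset.Icc 3 h).card = h - 2 := by rw [Nat.card_Icc]; omega
      rw [← e, ← smul_eq_mul]
      apply Finset.card_nsmul_le_sum
      intro c hc
      apply hlev
      rw [Finset.mem_Icc] at hc ⊢
      omega
    have h7 : h * s = (h - 2) * s + s + s := by
      rw [← Nat.succ_mul, ← Nat.succ_mul]; congr 1; omega
    have h8 := hlev 2 (by rw [Finset.mem_Icc]; omega)
    -- in this case `μ = 0`, hence `|S| ≥ 3`, and some fibre of `S` has two elements
    have hμ0 : μ = 0 := by omega
    have hS3 := C.card_S
    have hSs : s < S.card := by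
      by_contra hle
      have hSle := C.h_mul_le
      have hs3 : 3 ≤ s := by have := Finset.card_image_le (s := S) (f := φ); omega
      obtain ⟨r, hr⟩ := Nat.exists_eq_add_of_le hs3
      obtain ⟨l, hl⟩ := Nat.exists_eq_add_of_le hh
      have : s = (S.image φ).card := hs
      rw [← this, hr, hl] at hSle
      rw [hr] at hle
      have : (2 + l) * (3 + r) = 6 + 2 * r + 3 * l + l * r := by ring
      omega
    obtain ⟨i, hi2⟩ : ∃ i, 2 ≤ (fib φ S i).card := by
      by_contra hcon2
      push Not at hcon2
      have : S.card ≤ s := by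
        rw [card_eq_sum_fib (φ := φ) (Finset.Subset.refl (S.image φ)), hs, Finset.card_eq_sum_ones]
        exact Finset.sum_le_sum (fun p _ => by have := hcon2 p; omega)
      omega
    have h9 : T.card ≤ (lev φ (fill φ T x + S) 2).card := by
      rw [hT, ← card_image_add (T.image φ) i]
      apply Finset.card_le_card
      intro z hz
      obtain ⟨q, hq, rfl⟩ := Finset.mem_image.1 hz
      rw [mem_lev (by omega)]
      have := card_fib_add_right (φ := φ) (A := fill φ T x) (B := S) (p := q) (q := i)
        (by rwa [image_fill C.surj hxT])
      omega
    have := C.card_S_le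
    omega

end Config

end Config

/-! ### Sumsets meeting all cosets -/

section Shape

variable {G Q : Type*} [AddCommGroup G] [DecidableEq G] [AddCommGroup Q] [DecidableEq Q]
variable {φ : G →+ Q} {S T : Finset G} {h μ : ℕ}

/-- The fibres over `A` have at least `m` elements, all fibres at least `l`, and one of them at
least `m + g`; the total number of elements is bounded accordingly. -/
theorem card_ge_of_fib {R : Finset G} {A : Finset Q} {m l g : ℕ}
    (hA : A ⊆ R.image φ) (hm : ∀ z ∈ A, m ≤ (fib φ R z).card)
    (hl : ∀ z ∈ R.image φ, l ≤ (fib φ R z).card) (hlm : l ≤ m)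
    (hg : g = 0 ∨ ∃ z ∈ R.image φ, m + g ≤ (fib φ R z).card) :
    A.card * m + ((R.image φ).card - A.card) * l + g ≤ R.card := by
  rw [card_eq_sum_fib (φ := φ) (Finset.Subset.refl (R.image φ)), ← Finset.sum_sdiff hA]
  have h1 : ((R.image φ).card - A.card) * l ≤ ∑ z ∈ R.image φ \ A, (fib φ R z).card := by
    rw [← Finset.card_sdiff_of_subset hA, ← smul_eq_mul]
    exact Finset.card_nsmul_le_sum _ _ _ (fun z hz => hl z (Finset.mem_sdiff.1 hz).1)
  have h2 : A.card * m ≤ ∑ z ∈ A, (fib φ R z).card := by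
    rw [← smul_eq_mul]
    exact Finset.card_nsmul_le_sum _ _ _ hm
  rcases hg with rfl | ⟨z, hz, hzg⟩
  · omega
  by_cases hzA : z ∈ A
  · have h3 := Finset.add_sum_erase A (fun z => (fib φ R z).card) hzA
    have h4 : (A.card - 1) * m ≤ ∑ z ∈ A.erase z, (fib φ R z).card := by
      rw [← Finset.card_erase_of_mem hzA, ← smul_eq_mul]
      exact Finset.card_nsmul_le_sum _ _ _ (fun z hz => hm z (Finset.mem_of_mem_erase hz))
    have h5 : A.card * m = (A.card - 1) * m + m := by
      rw [← Nat.succ_mul]; congr 1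
      have : 0 < A.card := Finset.card_pos.2 ⟨z, hzA⟩
      omega
    omega
  · have hzs : z ∈ R.image φ \ A := Finset.mem_sdiff.2 ⟨hz, hzA⟩
    have h3 := Finset.add_sum_erase (R.image φ \ A) (fun z => (fib φ R z).card) hzs
    have h4 : ((R.image φ).card - A.card - 1) * l ≤
        ∑ z ∈ (R.image φ \ A).erase z, (fib φ R z).card := by
      rw [← Finset.card_sdiff_of_subset hA, ← Finset.card_erase_of_mem hzs, ← smul_eq_mul]
      exact Finset.card_nsmul_le_sum _ _ _
        (fun z hz => hl z (Finset.mem_sdiff.1 (Finset.mem_of_mem_erase hz)).1)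
    have h5 : ((R.image φ).card - A.card) * l = ((R.image φ).card - A.card - 1) * l + l := by
      rw [← Nat.succ_mul]; congr 1
      have : 0 < (R.image φ \ A).card := Finset.card_pos.2 ⟨z, hzs⟩
      rw [Finset.card_sdiff_of_subset hA] at this
      omega
    omega

theorem card_le_of_fib {Y : Finset G} {I : Finset Q} {m : ℕ}
    (hI : I ⊆ Y.image φ) (hm : ∀ z ∈ Y.image φ \ I, (fib φ Y z).card ≤ m) :
    Y.card ≤ ∑ z ∈ I, (fib φ Y z).card + ((Y.image φ).card - I.card) * m := by
  rw [card_eq_sum_fib (φ := φ) (Finset.Subset.refl (Y.image φ)), ← Finset.sum_sdiff hI, add_comm]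
  apply Nat.add_le_add_left
  rw [← Finset.card_sdiff_of_subset hI, ← smul_eq_mul]
  exact Finset.sum_le_card_nsmul _ _ _ hm

/-- If `T` meets all cosets and all fibres of `S` and of `T + S` have the same cardinality, then
`T + S` is periodic: all fibres of `T + S` are translates of fibres of `S` by elements of `T`, and
the difference of two elements of `T` in different cosets is a period. -/
theorem Config.not_equal_fibers (C : Config φ S T h μ) {m : ℕ} (hT : ∀ q, q ∈ T.image φ)
    (hσ : ∀ i ∈ S.image φ, (fib φ S i).card = m) (hρ : ∀ z, (fib φ (T + S) z).card = m) :
    False := by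
  have htr : ∀ t ∈ T, ∀ i ∈ S.image φ, fib φ (T + S) (φ t + i) = (fib φ S i).image (· + t) := by
    intro t ht i hi
    symm
    apply Finset.eq_of_subset_of_card_le
    · intro x hx
      obtain ⟨y, hy, rfl⟩ := Finset.mem_image.1 hx
      rw [mem_fib] at hy ⊢
      exact ⟨by rw [add_comm y t]; exact Finset.add_mem_add ht hy.1,
        by rw [map_add, hy.2, add_comm]⟩
    · rw [card_image_add, hσ i hi, hρ]
  obtain ⟨i₁, hi₁, hi₁0⟩ : ∃ i ∈ S.image φ, i ≠ 0 := by
    by_contra hcon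
    push Not at hcon
    have : S.image φ ⊆ {0} := fun i hi => Finset.mem_singleton.2 (hcon i hi)
    have := Finset.card_le_card this
    have := C.rigid.two_le
    rw [Finset.card_singleton] at *
    omega
  obtain ⟨t₀, ht₀, hφt₀⟩ := Finset.mem_image.1 (hT 0)
  obtain ⟨t₁, ht₁, hφt₁⟩ := Finset.mem_image.1 (hT i₁)
  set c := t₁ - t₀ with hc
  -- being shifted by `c` to another fibre propagates along `S`
  have hstep : ∀ z, (fib φ (T + S) z).image (· + c) = fib φ (T + S) (z + i₁) →
      ∀ i ∈ S.image φ, (fib φ (T + S) (z + i)).image (· + c) = fib φ (T + S) (z + i + i₁) := by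
    intro z hz i hi
    obtain ⟨t, ht, rfl⟩ := Finset.mem_image.1 (hT z)
    obtain ⟨t', ht', htt'⟩ := Finset.mem_image.1 (hT (φ t + i₁))
    have h0 := C.rigid.zero_mem
    have e1 := htr t ht 0 h0
    have e2 := htr t' ht' 0 h0
    have e3 := htr t ht i hi
    have e4 := htr t' ht' i hi
    -- two elements `u`, `v` with the same image in the quotient induce the same translation on
    -- the fibre of `S` over `0` if and only if they do so on the fibre over `i`
    obtain ⟨u, hu, hφu⟩ := Finset.mem_image.1 (hT (φ t - i))
    have e5 := htr u hu i hi
    rw [hφu, sub_add_cancel] at e5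
    rw [add_zero] at e1 e2
    have e6 : fib φ S i = (fib φ S 0).image (· + (t - u)) := by
      have := congrArg (Finset.image (· + -u)) (e5.symm.trans e1)
      rw [Finset.image_image, Finset.image_image] at this
      simp only [Function.comp_def, add_neg_cancel_right, Finset.image_id'] at this
      rw [this]
      apply Finset.image_congr
      intro x _
      simp only
      abel
    have e7 : φ t + i + i₁ = φ t' + i := by rw [htt']; abel
    rw [← htt', e2, e1] at hz
    rw [e7, e4, e3, e6]
    have := congrArg (Finset.image (· + (t - u))) hz
    simp only [Finset.image_image, Function.comp_def] at this ⊢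
    convert this using 2 <;> · funext x; abel
  classical
  have hQ : Finite Q := by
    apply Set.finite_univ_iff.1
    exact (T.image φ).finite_toSet.subset (fun q _ => hT q)
  have := Fintype.ofFinite Q
  set W : Finset Q := Finset.univ.filter
    (fun z => (fib φ (T + S) z).image (· + c) = fib φ (T + S) (z + i₁)) with hW
  have hWm : ∀ z, z ∈ W ↔ (fib φ (T + S) z).image (· + c) = fib φ (T + S) (z + i₁) := by
    intro z; rw [hW, Finset.mem_filter]; exact ⟨fun h => h.2, fun h => ⟨Finset.mem_univ _, h⟩⟩
  have hW0 : (0 : Q) ∈ W := by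
    have h0 := C.rigid.zero_mem
    have e1 := htr t₀ ht₀ 0 h0
    have e2 := htr t₁ ht₁ 0 h0
    rw [hφt₀, add_zero] at e1
    rw [hφt₁, add_zero] at e2
    rw [hWm, zero_add, e1, e2, Finset.image_image]
    apply Finset.image_congr
    intro x _
    simp only [Function.comp, hc]
    abel
  have hstab : stab W = ⊤ := by
    rw [eq_top_iff, ← C.rigid.closure_eq, AddSubgroup.closure_le]
    intro i hi
    apply mem_stab_of_forall
    intro z hz
    rw [add_comm, hWm]
    exact hstep z ((hWm z).1 hz) i (Finset.mem_coe.1 hi)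
  have hall : ∀ z, z ∈ W := by
    intro z
    have : z ∈ stab W := by rw [hstab]; trivial
    have := (mem_stab.1 this 0).2 hW0
    rwa [add_zero] at this
  have hcR : c ∈ stab (T + S) := by
    apply mem_stab_of_forall
    intro x hx
    have h1 := (hWm (φ x)).1 (hall _)
    have h2 : x + c ∈ fib φ (T + S) (φ x + i₁) := by
      rw [← h1]
      exact Finset.mem_image_of_mem _ (mem_fib.2 ⟨hx, rfl⟩)
    rw [add_comm c x]
    exact (mem_fib.1 h2).1
  rw [C.aper, AddSubgroup.mem_bot] at hcR
  apply hi₁0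
  have : φ c = i₁ := by rw [hc, map_sub, hφt₁, hφt₀, sub_zero]
  rw [← this, hcR, map_zero]

/-- The inequalities for a sumset that meets all `t + k` cosets, `k` of which are missed by `T`. The
largest fibre of `S` has `σM` elements and `α` holes, the smallest one `σm` elements and `β` holes.
If `S` meets more than two cosets, it meets three, and all the estimates are tight. -/
theorem covering_arith {h t k s α β μ σM σm : ℕ} (hM : σM + α = h) (hm : σm + β = h)
    (hαβ : α ≤ β) (hβ : β < h) (hsum : β + s * α + μ ≤ h + α) (hk : k + 1 ≤ s)
    (hs : 3 * s ≤ t + k + 3) (hs2 : 2 ≤ s) (hμ : μ ≤ 1)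
    (hR : 3 * (t * σM + k * σm) ≤ 2 * (h * (t + k)) + 2 * μ) :
    1 ≤ α ∧ (s = 2 ∨ (s = 3 ∧ μ = 0 ∧ β + 2 * α = h ∧
      2 * (h * (t + k)) ≤ 3 * (t * σM + k * σm))) := by
  obtain ⟨r, rfl⟩ := Nat.exists_eq_add_of_le hs2
  obtain ⟨n, hn⟩ : ∃ n, n = t + k := ⟨_, rfl⟩
  zify at *
  -- `n = t + k ≥ 3 k` and `α ≤ β`
  have h1 : (0 : ℤ) ≤ (n - 3 * k) * (β - α) := mul_nonneg (by omega) (by omega)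
  have h2 : (n : ℤ) * (h - 2 * α - β) ≤ 2 * μ := by
    have e1 : (σM : ℤ) = h - α := by omega
    have e2 : (σm : ℤ) = h - β := by omega
    have e3 : (t : ℤ) = n - k := by omega
    rw [e1, e2, e3] at hR
    nlinarith
  have h3 : (μ : ℤ) + (r - 1) * α ≤ h - 2 * α - β := by nlinarith
  have hn3 : (3 : ℤ) ≤ n := by omega
  have h4 : (n : ℤ) * (μ + (r - 1) * α) ≤ 2 * μ :=
    (mul_le_mul_of_nonneg_left h3 (by omega)).trans h2
  have hα : (1 : ℤ) ≤ α := by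
    by_contra hcon
    have hα0 : (α : ℤ) = 0 := by omega
    rw [hα0] at h2
    have : (n : ℤ) * 1 ≤ n * (h - 2 * 0 - β) := mul_le_mul_of_nonneg_left (by omega) (by omega)
    omega
  refine ⟨hα, ?_⟩
  rcases Nat.lt_or_ge r 2 with hr | hr
  · rcases (by omega : r = 0 ∨ r = 1) with rfl | rfl
    · left; norm_num
    · right
      have hμ0 : (μ : ℤ) = 0 := by
        by_contra hne
        have : (μ : ℤ) = 1 := by omega
        rw [this] at h4
        norm_num at h4
        omega
      have hβ' : (h : ℤ) - 2 * α - β ≤ 0 := by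
        by_contra hcon
        have : (n : ℤ) * 1 ≤ n * (h - 2 * α - β) := mul_le_mul_of_nonneg_left (by omega) (by omega)
        omega
      have hβe : (β : ℤ) + 2 * α = h := by
        rw [hμ0] at h3
        norm_num at h3
        omega
      refine ⟨by norm_num, hμ0, hβe, ?_⟩
      have e1 : (σM : ℤ) = h - α := by omega
      have e2 : (σm : ℤ) = h - β := by omega
      have e3 : (t : ℤ) = n - k := by omega
      rw [e1, e2, e3]
      nlinarith
  · exfalso
    have h5 : (1 : ℤ) ≤ (r - 1) * α := by
      have : (1 : ℤ) * 1 ≤ (r - 1) * α := mul_le_mul (by omega) hα (by omega) (by omega)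
      omega
    have h6 : (n : ℤ) * (μ + 1) ≤ 2 * μ :=
      (mul_le_mul_of_nonneg_left (by omega) (by omega)).trans h4
    nlinarith

/-- A sumset meeting all cosets is only possible if `S` meets just two. Over each coset met by `T`,
shifted suitably, the sumset is at least as large as the largest fibre of `S`, and over the others
as large as the smallest fibre; with `3 |T + S| ≤ 2 |G| + 2 μ` this leaves one further case, in
which all fibres of `S` and of `T + S` have the same size. -/
theorem Config.card_image_eq_two (C : Config φ S T h μ) (hR : ∀ z, z ∈ (T + S).image φ) :
    (S.image φ).card = 2 := by
  have hfin := C.fin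
  have hker := C.card_ker
  have hQ : Finite Q := by
    apply Set.finite_univ_iff.1
    exact ((T + S).image φ).finite_toSet.subset (fun q _ => hR q)
  have := Fintype.ofFinite Q
  have hRn : ((T + S).image φ).card = Nat.card Q := by
    rw [Nat.card_eq_fintype_card, ← Finset.card_univ]
    congr 1
    exact Finset.eq_univ_of_forall hR
  have htn : (T.image φ).card ≤ Nat.card Q := by
    rw [Nat.card_eq_fintype_card]; exact Finset.card_le_univ _
  have hst := C.card_image_add_le
  rw [hRn] at hst
  have hn3 := C.rigid.card_le hQ
  have hs2 := C.rigid.two_le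
  have hSne : (S.image φ).Nonempty := Finset.card_pos.1 (by omega)
  obtain ⟨p, hp, hpmax⟩ := Finset.exists_max_image (S.image φ) (fun i => (fib φ S i).card) hSne
  obtain ⟨q, hq, hqmin⟩ := Finset.exists_min_image (S.image φ) (fun i => (fib φ S i).card) hSne
  have hple := card_fib_le (φ := φ) S p
  have hqle := card_fib_le (φ := φ) S q
  have hqpos := card_fib_pos hq
  rw [hker] at hple hqle
  obtain ⟨α, hα⟩ := Nat.exists_eq_add_of_le hple
  obtain ⟨β, hβ⟩ := Nat.exists_eq_add_of_le hqle
  obtain ⟨k, hk⟩ := Nat.exists_eq_add_of_le htn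
  have hSle := C.h_mul_le
  have hScard := card_le_of_fib (φ := φ) (Y := S) (I := {q}) (m := (fib φ S p).card)
    (Finset.singleton_subset_iff.2 hq) (fun z hz => hpmax z (Finset.mem_sdiff.1 hz).1)
  rw [Finset.sum_singleton, Finset.card_singleton] at hScard
  -- every fibre of `T + S` contains a translate of a fibre of `S`
  have hcover : ∀ z ∈ (T + S).image φ, (fib φ S q).card ≤ (fib φ (T + S) z).card := by
    intro z hz
    rw [image_add_hom] at hz
    obtain ⟨x, hx, i, hi, rfl⟩ := Finset.mem_add.1 hz
    exact (hqmin i hi).trans (card_fib_add_right hx)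
  have hcover' : ∀ z ∈ (T.image φ).image (· + p), (fib φ S p).card ≤ (fib φ (T + S) z).card := by
    intro z hz
    obtain ⟨x, hx, rfl⟩ := Finset.mem_image.1 hz
    exact card_fib_add_right hx
  have hlow : ∀ g, (g = 0 ∨ ∃ z ∈ (T + S).image φ, (fib φ S p).card + g ≤ (fib φ (T + S) z).card) →
      (T.image φ).card * (fib φ S p).card + k * (fib φ S q).card + g ≤ (T + S).card := by
    intro g hg
    have := card_ge_of_fib (φ := φ) (R := T + S) (A := (T.image φ).image (· + p))
      (fun z _ => hR z) hcover' hcover (hqmin p hp) hg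
    rwa [card_image_add, hRn, hk, Nat.add_sub_cancel_left] at this
  have hsmall := C.small hQ
  have hlow0 := hlow 0 (Or.inl rfl)
  set s := (S.image φ).card with hs
  set t := (T.image φ).card with ht
  have hsum : β + s * α + μ ≤ h + α := by
    obtain ⟨r, hr⟩ := Nat.exists_eq_add_of_le hs2
    rw [hr] at hScard hSle ⊢
    have e1 : 2 + r - 1 = r + 1 := by omega
    rw [e1] at hScard
    have e2 : h * (2 + r) = h + (r + 1) * ((fib φ S p).card + α) := by rw [← hα]; ring
    rw [e2] at hSle
    have e3 : (2 + r) * α = (r + 1) * α + α := by ring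
    rw [mul_add] at hSle
    omega
  have hmain := covering_arith (h := h) (t := t) (k := k) (s := s) (α := α) (β := β) (μ := μ)
    hα.symm hβ.symm (by have := hqmin p hp; omega) (by omega) hsum (by omega) (by omega) hs2 C.hμ
    (by rw [hk] at hsmall; omega)
  obtain ⟨hα1, h2 | ⟨hs3, hμ0, hβα, hR3⟩⟩ := hmain
  · exact h2
  exfalso
  have hσ3 : S.card = 2 * h := by
    rw [hs3] at hScard hSle
    omega
  -- since `3 |T + S|` equals `2 |G|`, no fibre of `T + S` is full, and hence the fibres of `T` have
  -- at most `α` elements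
  have hnofull : ∀ z, (fib φ (T + S) z).card < h := by
    intro z
    by_contra hcon
    have := hlow α (Or.inr ⟨z, hR z, by omega⟩)
    rw [hk] at hsmall
    omega
  have hτ : ∀ x, (fib φ T x).card ≤ α := by
    intro x
    by_contra hcon
    have h1 := card_fib_add_of_lt C.surj (A := T) (B := S) (p := x) (q := p) (by
      rw [hker]; omega)
    have h2 := hnofull (x + p)
    omega
  have hTle : T.card ≤ t * α := by
    have := card_le_of_fib (φ := φ) (Y := T) (I := ∅) (m := α) (Finset.empty_subset _)
      (fun z _ => hτ z)
    simpa [ht] using this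
  have hcard := C.card
  have hST := C.card_S_le
  have h3α : 3 * α ≤ h := by have := hqmin p hp; omega
  have hh := C.two_le
  -- all the inequalities used so far are equalities
  have hn : Nat.card Q ≤ 6 := by
    have h1 : 2 * (h * Nat.card Q) ≤ 6 * h + 3 * (t * α) := by
      rw [hk]; omega
    have h2 : t * (3 * α) ≤ t * h := Nat.mul_le_mul_left t h3α
    have h3 : t * h ≤ Nat.card Q * h := Nat.mul_le_mul_right h htn
    have h4 : h * Nat.card Q ≤ h * 6 := by
      have : t * (3 * α) = 3 * (t * α) := by ring
      rw [mul_comm (Nat.card Q)] at h3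
      omega
    exact Nat.le_of_mul_le_mul_left h4 (by omega)
  have hn6 : Nat.card Q = 6 := by omega
  have ht6 : t = 6 := by
    by_contra hne
    have h2 : t * α ≤ 5 * α := Nat.mul_le_mul_right α (by omega)
    rw [← hk, hn6] at hR3
    omega
  have hk0 : k = 0 := by omega
  rw [ht6, hk0] at hR3 hlow0
  rw [ht6] at hTle
  have hαh : 3 * α = h := by omega
  refine C.not_equal_fibers (m := 2 * α) ?_ ?_ ?_
  · intro z
    have : T.image φ = Finset.univ := by
      apply Finset.eq_univ_of_card
      rw [← ht, ht6, ← Nat.card_eq_fintype_card, hn6]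
    rw [this]
    exact Finset.mem_univ z
  · intro i hi
    have h1 := hpmax i hi
    have h2 := hqmin i hi
    omega
  · intro z
    have h1 := hcover z (hR z)
    by_contra hne
    have := hlow 1 (Or.inr ⟨z, hR z, by omega⟩)
    rw [ht6, hk0] at this
    rw [hn6] at hsmall
    omega

end Shape

/-! ### Sumsets missing a coset -/

section NonProgression

variable {G Q : Type*} [AddCommGroup G] [DecidableEq G] [AddCommGroup Q] [DecidableEq Q]
variable {φ : G →+ Q} {S T : Finset G} {h μ : ℕ}

theorem image_add_image_add (X : Finset Q) (b c : Q) :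
    (X.image (· + b)).image (· + c) = X.image (· + (b + c)) := by
  rw [Finset.image_image]
  simp only [Function.comp_def, add_assoc]

/-- The final inequality for `Config.exists_small_union`; `a` is the number of holes in the second
smallest fibre of `S`, and `α` is that in the largest one. -/
theorem complement_arith {h a α s n μ : ℤ} (hs : 3 ≤ s) (hn : 3 * s ≤ n + 3)
    (hn7 : s = 3 → 7 ≤ n) (hα : 0 ≤ α) (hαa : α ≤ a) (hμ : 0 ≤ μ) (hh : 1 ≤ h)
    (hsum : 2 * a + (s - 2) * α + μ ≤ h) :
    (n - 4) * a + (n - 2 * s + 1) * α - μ < (n - s - 2) * h := by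
  have h1 : 1 ≤ n - 2 * s := by
    rcases hs.lt_or_eq with h | h
    · omega
    · have := hn7 h.symm; omega
  have h2 : 0 ≤ (n - s - 2) * (s - 2) - (n - 2 * s + 1) := by
    rcases hs.lt_or_eq with h | h
    · nlinarith
    · rw [← h]; linarith
  rcases (show 0 ≤ a by omega).lt_or_eq with ha | ha
  · have h3 : (n - s - 2) * (2 * a + (s - 2) * α + μ) ≤ (n - s - 2) * h :=
      mul_le_mul_of_nonneg_left hsum (by omega)
    have h4 : 0 ≤ ((n - s - 2) * (s - 2) - (n - 2 * s + 1)) * α := mul_nonneg h2 hα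
    have h5 : 1 * 1 ≤ (n - 2 * s) * a := mul_le_mul h1 ha (by omega) (by omega)
    have h6 : 0 ≤ (n - s - 2) * μ := mul_nonneg (by omega) hμ
    nlinarith
  · have hα0 : α = 0 := by omega
    rw [← ha, hα0]
    have : 1 * 1 ≤ (n - s - 2) * h := mul_le_mul (by omega) hh (by omega) (by omega)
    omega

set_option maxHeartbeats 1000000 in
/-- If the sumset does not meet all cosets, then the image of `S` grows by at most one element when
a suitable translate is adjoined. Otherwise `S` has the Vosper property in the quotient, so the
sumset misses exactly one coset. The same property, applied to the negative of the complement of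
`T + S`, shows that few cosets are contained in `T + S`. Hence at most one fibre of `T` is larger
than the number of holes in the second smallest fibre of `S`, and `T` is too small. -/
theorem Config.exists_small_union (C : Config φ S T h μ) (hR : ∃ z, z ∉ (T + S).image φ) :
    ∃ y, y ≠ 0 ∧ (S.image φ ∪ (S.image φ).image (· + y)).card ≤ (S.image φ).card + 1 := by
  by_contra hcon
  have hno : ∀ y, y ≠ 0 →
      (S.image φ).card + 2 ≤ (S.image φ ∪ (S.image φ).image (· + y)).card := by
    intro y hy
    by_contra h
    exact hcon ⟨y, hy, by omega⟩
  clear hcon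
  have hfin := C.fin
  have hker := C.card_ker
  have hs2 := C.rigid.two_le
  have hμ := C.hμ
  have hh := C.two_le
  have hrig := C.rigid
  have hle := C.card_image_add_le
  have hcard := C.card
  have hST := C.card_S_le
  have hSle := C.h_mul_le
  have hTle := C.not_periodic_T
  rw [image_add_hom] at hle
  obtain ⟨z₀, hz₀⟩ := hR
  have hz₀' : z₀ ∉ T.image φ + S.image φ := by rwa [image_add_hom] at hz₀
  set s := (S.image φ).card with hs
  set t := (T.image φ).card with ht
  have hTne : (T.image φ).Nonempty := by
    rw [← Finset.card_pos, ← ht]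
    by_contra h0
    have : t = 0 := by omega
    rw [this] at hTle
    omega
  have hF1 := hrig.card_add _ hTne ⟨z₀, hz₀'⟩
  -- translates of the image of `S` meet in few elements
  have hV : ∀ b c, b ≠ c →
      ((S.image φ).image (· + b) ∩ (S.image φ).image (· + c)).card + 2 ≤ s := by
    intro b c hbc
    have h1 := Finset.card_union_add_card_inter ((S.image φ).image (· + b))
      ((S.image φ).image (· + c))
    have h2 : (S.image φ).image (· + b) ∪ (S.image φ).image (· + c) =
        (S.image φ ∪ (S.image φ).image (· + (c - b))).image (· + b) := by
      rw [Finset.image_union, image_add_image_add, sub_add_cancel]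
    rw [h2, card_image_add, card_image_add, card_image_add] at h1
    have h3 := hno (c - b) (sub_ne_zero.2 hbc.symm)
    omega
  have hs3 : 3 ≤ s := by
    by_contra hlt
    obtain ⟨y, hy, hy0⟩ := Finset.exists_mem_ne (show 1 < (S.image φ).card by omega) 0
    have h1 := hno y hy0
    have h2 := Finset.card_union_add_card_inter (S.image φ) ((S.image φ).image (· + y))
    have h3 : 0 < (S.image φ ∩ (S.image φ).image (· + y)).card :=
      Finset.card_pos.2 ⟨y, Finset.mem_inter.2 ⟨hy, Finset.mem_image.2 ⟨0, hrig.zero_mem, by simp⟩⟩⟩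
    rw [card_image_add] at h2
    omega
  have ht2 : 2 ≤ t := by
    by_contra hlt
    have h1 : h * t ≤ h * 1 := Nat.mul_le_mul_left h (by omega)
    have h2 : h * 3 ≤ h * s := Nat.mul_le_mul_left h hs3
    omega
  have hnadm : ¬ Adm (S.image φ) (T.image φ) := by
    intro hadm
    have := hrig.vosper hno hadm
    omega
  have hmiss : ∀ z, z ∉ T.image φ + S.image φ → z = z₀ := by
    intro z hz
    by_contra hne
    exact hnadm ⟨ht2, z, z₀, hne, hz, hz₀'⟩
  have hQ : Finite Q := by
    apply Set.finite_univ_iff.1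
    refine (insert z₀ (T.image φ + S.image φ)).finite_toSet.subset (fun q _ => ?_)
    rw [Finset.mem_coe, Finset.mem_insert]
    by_cases hq : q ∈ T.image φ + S.image φ
    · exact Or.inr hq
    · exact Or.inl (hmiss q hq)
  have := Fintype.ofFinite Q
  have hR' : T.image φ + S.image φ = Finset.univ.erase z₀ := by
    ext z
    rw [Finset.mem_erase]
    refine ⟨fun hz => ⟨?_, Finset.mem_univ z⟩, fun hz => ?_⟩
    · rintro rfl; exact hz₀' hz
    · by_contra hc; exact hz.1 (hmiss z hc)
  set n := Nat.card Q with hn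
  have hR'c : (T.image φ + S.image φ).card + 1 = n := by
    rw [hR', Finset.card_erase_of_mem (Finset.mem_univ _), Finset.card_univ,
      ← Nat.card_eq_fintype_card]
    have : 0 < Nat.card Q := Nat.card_pos
    omega
  have htn : t + s = n := by omega
  have hn3 := hrig.card_le hQ
  -- for `s = 3` the differences of distinct elements of the image of `S` are six nonzero elements
  have hn7 : s = 3 → 7 ≤ n := by
    intro h3
    have hsid : IsSidonLike (S.image φ) := by
      intro g hg
      have := hV 0 g hg.symm
      simp only [add_zero, Finset.image_id'] at this
      omega
    have h1 : ((S.image φ).offDiag.image (fun p => p.1 - p.2)).card = 6 := by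
      rw [Finset.card_image_of_injOn, Finset.offDiag_card, ← hs, h3]
      intro p hp p' hp' he
      have hp := Finset.mem_offDiag.1 (Finset.mem_coe.1 hp)
      have hp' := Finset.mem_offDiag.1 (Finset.mem_coe.1 hp')
      have he : p.1 - p.2 = p'.1 - p'.2 := he
      have h5 := hsid.eq_of_sub_eq hp.1 hp.2.1 hp'.1 hp'.2.1 hp.2.2 he
      rw [h5] at he
      exact Prod.ext h5 (sub_right_injective he)
    have h2 : ((S.image φ).offDiag.image (fun p => p.1 - p.2)) ⊆ Finset.univ.erase 0 := by
      intro z hz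
      obtain ⟨p, hp, rfl⟩ := Finset.mem_image.1 hz
      rw [Finset.mem_offDiag] at hp
      exact Finset.mem_erase.2 ⟨sub_ne_zero.2 hp.2.2, Finset.mem_univ _⟩
    have h4 := Finset.card_le_card h2
    rw [h1, Finset.card_erase_of_mem (Finset.mem_univ _), Finset.card_univ,
      ← Nat.card_eq_fintype_card, ← hn] at h4
    omega
  -- the image of `T` is the complement of a translate of the negative of the image of `S`
  have hTc : ∀ x, x ∈ T.image φ ↔ z₀ - x ∉ S.image φ := by
    have hsub : T.image φ ⊆ ((S.image φ).image (fun i => z₀ - i))ᶜ := by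
      intro x hx
      rw [Finset.mem_compl, Finset.mem_image]
      rintro ⟨i, hi, rfl⟩
      apply hz₀'
      have := Finset.add_mem_add hx hi
      rwa [sub_add_cancel] at this
    have heq := Finset.eq_of_subset_of_card_le hsub (by
      rw [Finset.card_compl, Finset.card_image_of_injective _ sub_right_injective,
        ← Nat.card_eq_fintype_card]
      omega)
    intro x
    rw [heq, Finset.mem_compl, not_iff_not, Finset.mem_image]
    constructor
    · rintro ⟨i, hi, rfl⟩
      rwa [sub_sub_cancel]
    · intro hx
      exact ⟨_, hx, sub_sub_cancel _ _⟩
  have hSne : (S.image φ).Nonempty := Finset.card_pos.1 (by omega)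
  obtain ⟨p, hp, hpmin⟩ := Finset.exists_min_image (S.image φ) (fun i => (fib φ S i).card) hSne
  obtain ⟨r, hr, hrmax⟩ := Finset.exists_max_image (S.image φ) (fun i => (fib φ S i).card) hSne
  set J := (S.image φ).erase p with hJ
  have hJc : J.card + 1 = s := by
    rw [hJ, Finset.card_erase_of_mem hp]; omega
  have hJS : J ⊆ S.image φ := Finset.erase_subset _ _
  have hJne : J.Nonempty := Finset.card_pos.1 (by omega)
  obtain ⟨q, hq, hqmin⟩ := Finset.exists_min_image J (fun i => (fib φ S i).card) hJne
  -- the smallest fibre of `S`, over `p`, is not needed to reach the cosets of `T + S`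
  have hTJ : ∀ z, z ≠ z₀ → ∃ x ∈ T.image φ, ∃ i ∈ J, x + i = z := by
    intro z hz
    by_contra hcon
    push Not at hcon
    have hsub : J ⊆ (S.image φ).image (· + 0) ∩ (S.image φ).image (· + (z - z₀)) := by
      intro i hi
      rw [Finset.mem_inter, Finset.mem_image, Finset.mem_image]
      refine ⟨⟨i, hJS hi, add_zero i⟩, ⟨i - (z - z₀), ?_, by abel⟩⟩
      by_contra hc
      have e : i - (z - z₀) = z₀ - (z - i) := by abel
      rw [e] at hc
      exact hcon _ ((hTc _).2 hc) i hi (by abel)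
    have h1 := Finset.card_le_card hsub
    have h2 := hV 0 (z - z₀) (Ne.symm (sub_ne_zero.2 hz))
    omega
  have hqle := card_fib_le (φ := φ) S q
  have hrle := card_fib_le (φ := φ) S r
  rw [hker] at hqle hrle
  obtain ⟨a, ha⟩ := Nat.exists_eq_add_of_le hqle
  obtain ⟨α, hα⟩ := Nat.exists_eq_add_of_le hrle
  have hqr := hrmax q (hJS hq)
  have hpq := hpmin q (hJS hq)
  -- the full cosets in `T + S` are few
  set F := lev φ (T + S) h with hF
  have hFm : ∀ z, z ∈ F ↔ (fib φ (T + S) z).card = h := by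
    intro z
    rw [hF, mem_lev (by omega)]
    have := card_fib_le (φ := φ) (T + S) z
    omega
  have hFz₀ : z₀ ∉ F := fun hc => hz₀ (lev_subset _ _ hc)
  have hfill : ∀ x, a < (fib φ T x).card → J.image (· + x) ⊆ F := by
    intro x hx z hz
    obtain ⟨i, hi, rfl⟩ := Finset.mem_image.1 hz
    have h1 := hqmin i hi
    rw [hFm, add_comm, card_fib_add_of_lt C.surj (by rw [hker]; omega), hker]
  obtain ⟨hFs, hFs'⟩ : F.card ≤ s ∧ (F.card = s → ∃ w, F = (S.image φ).image (· + w)) := by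
    have hGfin : Finite G := by
      apply Set.finite_univ_iff.1
      refine (pre φ Finset.univ).finite_toSet.subset (fun x _ => ?_)
      exact Finset.mem_coe.2 (mem_pre.2 (Finset.mem_univ _))
    have := Fintype.ofFinite G
    -- `D` is the negative of the complement of `T + S`; its image consists of the `-z` with
    -- `z ∉ F`, and `D + S` misses `-T`
    set D : Finset G := ((T + S)ᶜ).image (fun x => -x) with hD
    have hDm : ∀ d, d ∈ D ↔ -d ∉ T + S := by
      intro d
      rw [hD, Finset.mem_image]
      constructor
      · rintro ⟨x, hx, rfl⟩
        rw [neg_neg]; exact Finset.mem_compl.1 hx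
      · intro hd
        exact ⟨-d, Finset.mem_compl.2 hd, neg_neg d⟩
    have hDc : D.card + (T + S).card = Fintype.card G := by
      rw [hD, Finset.card_image_of_injective _ neg_injective, Finset.card_compl]
      have := Finset.card_le_univ (T + S)
      omega
    have hDS : (D + S).card + T.card ≤ Fintype.card G := by
      rw [← card_image_of_neg T, ← Finset.card_union_of_disjoint]
      · exact Finset.card_le_univ _
      · rw [Finset.disjoint_left]
        intro x hx hxT
        obtain ⟨d, hd, i, hi, rfl⟩ := Finset.mem_add.1 hx
        obtain ⟨y, hy, hyx⟩ := Finset.mem_image.1 hxT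
        have e : -d = y + i := by
          have : y = -(d + i) := by rw [← hyx, neg_neg]
          rw [this]; abel
        apply (hDm d).1 hd
        rw [e]
        exact Finset.add_mem_add hy hi
    have hDfull : (fib φ D (-z₀)).card = Nat.card φ.ker := by
      rw [card_fib_eq_iff C.surj]
      intro x hx
      rw [hDm]
      intro hc
      apply hz₀
      have := Finset.mem_image_of_mem φ hc
      rwa [map_neg, hx, neg_neg] at this
    have hcore := hrig.card_image_add_le C.surj (Y := D) (by rw [hker, ← hs]; omega)
      (by rw [hker]; exact C.not_periodic_S) ⟨_, hDfull⟩ (by omega)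
    rw [image_add_hom, ← hs] at hcore
    have hDF : ∀ z, z ∈ D.image φ ↔ -z ∉ F := by
      intro z
      rw [hFm, ← hker, card_fib_eq_iff C.surj, Finset.mem_image]
      constructor
      · rintro ⟨d, hd, rfl⟩ hc
        exact (hDm d).1 hd (hc _ (by rw [map_neg]))
      · intro hc
        push Not at hc
        obtain ⟨x, hx, hxR⟩ := hc
        exact ⟨-x, (hDm _).2 (by rwa [neg_neg]), by rw [map_neg, hx, neg_neg]⟩
    have hDFc : (D.image φ).card + F.card = n := by
      have : D.image φ = (Fᶜ).image (fun x => -x) := by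
        ext z
        rw [hDF, Finset.mem_image]
        constructor
        · intro hz; exact ⟨-z, Finset.mem_compl.2 hz, neg_neg z⟩
        · rintro ⟨y, hy, rfl⟩
          rw [neg_neg]; exact Finset.mem_compl.1 hy
      rw [this, Finset.card_image_of_injective _ neg_injective, Finset.card_compl,
        ← Nat.card_eq_fintype_card]
      have := Finset.card_le_univ F
      rw [← Nat.card_eq_fintype_card] at this
      omega
    have hnadm' : ¬ Adm (S.image φ) (D.image φ) := by
      intro hadm
      have := hrig.vosper hno hadm
      omega
    have hD2 : 2 ≤ (D.image φ).card := by
      by_contra hlt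
      apply C.ker_not_le
      apply ker_le_stab_of_full
      intro z hz
      by_contra hne
      have hz1 : -z ∈ D.image φ := by
        rw [hDF, neg_neg, hFm, ← hker]; exact hne
      have hz2 : -z₀ ∈ D.image φ := by
        rw [hDF, neg_neg]; exact hFz₀
      have := Finset.card_le_one.1 (show (D.image φ).card ≤ 1 by omega) _ hz1 _ hz2
      rw [neg_injective this] at hz
      exact hz₀ hz
    -- by the Vosper property, `D + S` misses at most one coset
    have hDSc : n ≤ (D.image φ + S.image φ).card + 1 := by
      by_contra hlt
      apply hnadm'
      have h1 : 1 < (D.image φ + S.image φ)ᶜ.card := by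
        rw [Finset.card_compl, ← Nat.card_eq_fintype_card]
        omega
      obtain ⟨z, hz, w, hw, hzw⟩ := Finset.one_lt_card.1 h1
      exact ⟨hD2, z, w, hzw, Finset.mem_compl.1 hz, Finset.mem_compl.1 hw⟩
    refine ⟨by omega, fun hFeq => ?_⟩
    have h1 : 0 < (D.image φ + S.image φ)ᶜ.card := by
      rw [Finset.card_compl, ← Nat.card_eq_fintype_card]
      omega
    obtain ⟨w, hw⟩ := Finset.card_pos.1 h1
    rw [Finset.mem_compl] at hw
    refine ⟨-w, (Finset.eq_of_subset_of_card_le ?_ ?_).symm⟩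
    · intro z hz
      obtain ⟨i, hi, rfl⟩ := Finset.mem_image.1 hz
      by_contra hc
      apply hw
      have h2 : w - i ∈ D.image φ := by
        rw [hDF]
        have e : -(w - i) = i + -w := by abel
        rwa [e]
      have := Finset.add_mem_add h2 hi
      rwa [sub_add_cancel] at this
    · rw [card_image_add]; omega
  -- hence at most one fibre of `T` is large
  have huniq : ∀ x₁ x₂, a < (fib φ T x₁).card → a < (fib φ T x₂).card → x₁ = x₂ := by
    intro x₁ x₂ h₁ h₂
    by_contra hne
    have h1 := hfill _ h₁
    have h2 := hfill _ h₂
    have h3 := Finset.card_le_card (Finset.union_subset h1 h2)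
    have h4 := Finset.card_union_add_card_inter (J.image (· + x₁)) (J.image (· + x₂))
    have h5 := hV x₁ x₂ hne
    have h6 : (J.image (· + x₁) ∩ J.image (· + x₂)).card ≤
        ((S.image φ).image (· + x₁) ∩ (S.image φ).image (· + x₂)).card :=
      Finset.card_le_card (Finset.inter_subset_inter (Finset.image_subset_image hJS)
        (Finset.image_subset_image hJS))
    rw [card_image_add, card_image_add] at h4
    obtain ⟨w, hw⟩ := hFs' (by omega)
    have h7 : ∀ x, J.image (· + x) ⊆ F → x = w := by
      intro x hx
      by_contra hxw
      have h8 : J.image (· + x) ⊆ (S.image φ).image (· + x) ∩ (S.image φ).image (· + w) := by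
        rw [hw] at hx
        exact Finset.subset_inter (Finset.image_subset_image hJS) hx
      have h9 := Finset.card_le_card h8
      rw [card_image_add] at h9
      have := hV x w hxw
      omega
    exact hne ((h7 _ h1).trans (h7 _ h2).symm)
  -- bounds for the cardinalities
  -- `T + S` has `|φ(T)|` fibres as large as the largest fibre of `S`, and the others are as large
  -- as the one over `q`
  have hlow : ∀ g, (g = 0 ∨ ∃ z ∈ (T + S).image φ, (fib φ S r).card + g ≤ (fib φ (T + S) z).card) →
      t * (fib φ S r).card + (s - 1) * (fib φ S q).card + g ≤ (T + S).card := by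
    intro g hg
    have h1 : ∀ z ∈ (T + S).image φ, (fib φ S q).card ≤ (fib φ (T + S) z).card := by
      intro z hz
      obtain ⟨x, hx, i, hi, rfl⟩ := hTJ z (fun hc => hz₀ (hc ▸ hz))
      exact (hqmin i hi).trans (card_fib_add_right hx)
    have h2 := card_ge_of_fib (φ := φ) (R := T + S) (A := (T.image φ).image (· + r))
      (m := (fib φ S r).card) (l := (fib φ S q).card)
      (by
        intro z hz
        obtain ⟨x, hx, rfl⟩ := Finset.mem_image.1 hz
        rw [image_add_hom]
        exact Finset.add_mem_add hx hr)
      (by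
        intro z hz
        obtain ⟨x, hx, rfl⟩ := Finset.mem_image.1 hz
        exact card_fib_add_right hx) h1 hqr hg
    have e : ((T + S).image φ).card - t = s - 1 := by
      rw [image_add_hom]; omega
    rwa [card_image_add, ← ht, e] at h2
  have hScard := card_le_of_fib (φ := φ) (Y := S) (I := {q, p}) (m := (fib φ S r).card)
    (by
      intro z hz
      rw [Finset.mem_insert, Finset.mem_singleton] at hz
      rcases hz with rfl | rfl
      · exact hJS hq
      · exact hp) (fun z hz => hrmax z (Finset.mem_sdiff.1 hz).1)
  have hqp : q ≠ p := Finset.ne_of_mem_erase hq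
  rw [Finset.sum_pair hqp, Finset.card_pair hqp, ← hs] at hScard
  have hT : ∃ g, (g = 0 ∨ ∃ z ∈ (T + S).image φ, (fib φ S r).card + g ≤ (fib φ (T + S) z).card) ∧
      T.card + α ≤ h + (t - 1) * a + g := by
    by_cases hx : ∃ x ∈ T.image φ, a < (fib φ T x).card
    · obtain ⟨x, hxT, hx⟩ := hx
      refine ⟨α, Or.inr ?_, ?_⟩
      · obtain ⟨i, hi⟩ := hJne
        have h1 := hfill x hx (Finset.mem_image_of_mem _ hi)
        exact ⟨_, lev_subset _ _ h1, by rw [(hFm _).1 h1]; omega⟩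
      · have h1 := card_le_of_fib (φ := φ) (Y := T) (I := {x}) (m := a)
          (Finset.singleton_subset_iff.2 hxT) (fun z hz => by
            by_contra hc
            rw [Finset.mem_sdiff, Finset.mem_singleton] at hz
            exact hz.2 (huniq _ _ (by omega) hx))
        have h2 := card_fib_le (φ := φ) T x
        rw [Finset.sum_singleton, Finset.card_singleton, ← ht] at h1
        omega
    · push Not at hx
      refine ⟨0, Or.inl rfl, ?_⟩
      have h1 := card_le_of_fib (φ := φ) (Y := T) (I := ∅) (m := a) (Finset.empty_subset _)
        (fun z hz => hx z (Finset.mem_sdiff.1 hz).1)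
      rw [Finset.sum_empty, Finset.card_empty, ← ht, Nat.sub_zero] at h1
      have h2 : t * a = (t - 1) * a + a := by
        rw [← Nat.succ_mul]; congr 1; omega
      have h3 : (fib φ S p).card + (s - 1) * h ≥ S.card := by
        have := card_le_sum_fib_add (φ := φ) (Finset.singleton_subset_iff.2 hp)
        rw [Finset.sum_singleton, Finset.card_singleton, hker, ← hs, mul_comm] at this
        exact this
      have h4 : S.card ≤ (fib φ S p).card + ((fib φ S q).card + (s - 2) * h) := by
        have := Nat.mul_le_mul_left (s - 2) hrle
        omega
      have h5 : h * s = (s - 2) * h + h + h := by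
        rw [← Nat.succ_mul, ← Nat.succ_mul, mul_comm]; congr 1; omega
      omega
  obtain ⟨g, hg, hTg⟩ := hT
  have hlowg := hlow g hg
  obtain ⟨s', hs'⟩ := Nat.exists_eq_add_of_le hs3
  obtain ⟨t', ht'⟩ := Nat.exists_eq_add_of_le ht2
  have hfinal := complement_arith (h := h) (a := a) (α := α) (s := s) (n := n) (μ := μ)
    (by exact_mod_cast hs3) (by exact_mod_cast hn3)
    (fun h => by exact_mod_cast hn7 (by exact_mod_cast h))
    (by positivity) (by omega) (by positivity) (by omega) (by
      have e1 : ((fib φ S r).card : ℤ) = h - α := by omega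
      have e2 : ((fib φ S q).card : ℤ) = h - a := by omega
      have e3 : s - 2 = s' + 1 := by omega
      rw [e3] at hScard
      zify at hScard hSle hs' hpq
      rw [e1, e2] at hScard
      rw [hs'] at hSle ⊢
      rw [e2] at hpq
      nlinarith)
  have e1 : ((fib φ S r).card : ℤ) = h - α := by omega
  have e2 : ((fib φ S q).card : ℤ) = h - a := by omega
  have e3 : s - 1 = s' + 2 := by omega
  have e4 : t - 1 = t' + 1 := by omega
  have e5 : s - 2 = s' + 1 := by omega
  have hSc : S.card ≤ (fib φ S q).card + (fib φ S q).card + (s' + 1) * (fib φ S r).card := by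
    rw [← e5]; omega
  rw [e3] at hlowg
  rw [e4] at hTg
  have hnn : (n : ℤ) = 5 + t' + s' := by omega
  have hss : (s : ℤ) = 3 + s' := by omega
  have htt : (t : ℤ) = 2 + t' := by omega
  zify at hlowg hTg hSc hcard
  rw [hnn, hss] at hfinal
  rw [e1, e2, htt] at hlowg
  rw [e1, e2] at hSc
  nlinarith

end NonProgression

/-! ### Counting holes in chains of partial cosets -/

section HoleChain

theorem add_le_sum_range {f : ℕ → ℕ} {n i j : ℕ} (hi : i < n) (hj : j < n) (hij : i ≠ j) :
    f i + f j ≤ ∑ k ∈ Finset.range n, f k := by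
  rw [← Finset.sum_pair hij]
  apply Finset.sum_le_sum_of_subset
  intro x hx
  rw [Finset.mem_insert, Finset.mem_singleton] at hx
  rw [Finset.mem_range]
  rcases hx with rfl | rfl <;> assumption

theorem add_add_le_sum_range {f : ℕ → ℕ} {n i j l : ℕ} (hi : i < n) (hj : j < n) (hl : l < n)
    (hij : i ≠ j) (hil : i ≠ l) (hjl : j ≠ l) :
    f i + f j + f l ≤ ∑ k ∈ Finset.range n, f k := by
  have : f i + f j + f l = ∑ k ∈ {i, j, l}, f k := by
    rw [Finset.sum_insert (by simp [hij, hil]), Finset.sum_pair hjl, add_assoc]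
  rw [this]
  apply Finset.sum_le_sum_of_subset
  intro x hx
  simp only [Finset.mem_insert, Finset.mem_singleton] at hx
  rw [Finset.mem_range]
  rcases hx with rfl | rfl | rfl <;> assumption

/-- Summing along a lattice path from `(0, 0)` to `(u, v)` which uses the column `x`. -/
theorem sum_path_le {d m : ℕ → ℕ} {u v x : ℕ} (hx : x ≤ v) (h1 : ∀ j < x, d j ≤ m j)
    (h2 : ∀ j, x < j → j ≤ v → d (u + j) ≤ m j) :
    ∑ k ∈ Finset.range (u + v + 1), d k + m x ≤
      ∑ j ∈ Finset.range (v + 1), m j + ∑ i ∈ Finset.range (u + 1), d (i + x) := by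
  obtain ⟨w, rfl⟩ := Nat.exists_eq_add_of_le hx
  have e1 : u + (x + w) + 1 = x + ((u + 1) + w) := by omega
  have e2 : x + w + 1 = x + (1 + w) := by omega
  rw [e1, e2, Finset.sum_range_add d x, Finset.sum_range_add _ (u + 1) w,
    Finset.sum_range_add m x, Finset.sum_range_add _ 1 w, Finset.sum_range_one]
  have i1 : ∑ k ∈ Finset.range x, d k ≤ ∑ k ∈ Finset.range x, m k :=
    Finset.sum_le_sum (fun j hj => h1 j (Finset.mem_range.1 hj))
  have i2 : ∑ k ∈ Finset.range w, d (x + (u + 1 + k)) ≤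
      ∑ k ∈ Finset.range w, m (x + (1 + k)) := by
    apply Finset.sum_le_sum
    intro k hk
    rw [Finset.mem_range] at hk
    have := h2 (x + (1 + k)) (by omega) (by omega)
    have e : u + (x + (1 + k)) = x + (u + 1 + k) := by omega
    rwa [e] at this
  have i3 : ∑ k ∈ Finset.range (u + 1), d (x + k) = ∑ k ∈ Finset.range (u + 1), d (k + x) :=
    Finset.sum_congr rfl (fun k _ => by rw [add_comm])
  rw [add_zero]
  omega

/-- A sum over all lattice points of a rectangle, split into a path along two sides and the
remaining rectangle. -/
theorem sum_grid (f : ℕ → ℕ) (u v : ℕ) :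
    ∑ x ∈ Finset.range (v + 1), ∑ i ∈ Finset.range (u + 1), f (i + x) =
      ∑ k ∈ Finset.range (u + v + 1), f k +
        ∑ x ∈ Finset.range v, ∑ i ∈ Finset.range u, f (i + 1 + x) := by
  have e : u + v + 1 = (v + 1) + u := by omega
  rw [e, Finset.sum_range_add f (v + 1) u]
  simp only [Finset.sum_range_succ' _ u]
  rw [Finset.sum_add_distrib, Finset.sum_range_succ _ v]
  have e1 : ∑ x ∈ Finset.range (v + 1), f (0 + x) = ∑ x ∈ Finset.range (v + 1), f x :=
    Finset.sum_congr rfl (fun x _ => by rw [zero_add])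
  have e2 : ∑ i ∈ Finset.range u, f (i + 1 + v) = ∑ i ∈ Finset.range u, f (v + 1 + i) :=
    Finset.sum_congr rfl (fun x _ => by congr 1; omega)
  rw [e1, e2]
  omega

theorem sum_range_ends (d : ℕ → ℕ) (n : ℕ) :
    ∑ k ∈ Finset.range (n + 2), d k = d 0 + ∑ k ∈ Finset.range n, d (k + 1) + d (n + 1) := by
  rw [Finset.sum_range_succ, Finset.sum_range_succ']
  omega

/-- The numbers of holes in the fibres of two progressions of partial cosets, `S` and `T`, and of
their sum: `a i`, `b j`, `d k` are the differences between the order `h` of the subgroup and the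
cardinalities of the fibres of `S`, `T` and `T + S`. The field `le_add` is the pigeonhole principle
in a coset, `test` is the property of the hyper-atom for a fibre of `T` with at least two elements,
and `sum_d` expresses `|T + S| = |S| + |T| - μ`; the remaining fields translate the bounds for `|S|`
and `|T|`. -/
structure HoleChain (h μ u v : ℕ) (a b d : ℕ → ℕ) : Prop where
  two_le : 2 ≤ h
  hμ : μ ≤ 1
  hu : 1 ≤ u
  hv : 1 ≤ v
  a_lt : ∀ i ≤ u, a i < h
  b_lt : ∀ j ≤ v, b j < h
  d_le_a : ∀ i ≤ u, ∀ j ≤ v, d (i + j) ≤ a i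
  d_le_b : ∀ i ≤ u, ∀ j ≤ v, d (i + j) ≤ b j
  le_add : ∀ i ≤ u, ∀ j ≤ v, d (i + j) ≠ 0 → h ≤ a i + b j
  test : ∀ j ≤ v, b j + 2 ≤ h → ∑ i ∈ Finset.range (u + 1), d (i + j) ≤ b j
  sum_a : ∑ i ∈ Finset.range (u + 1), a i + μ ≤ h
  sum_d : ∑ k ∈ Finset.range (u + v + 1), d k + h =
    ∑ i ∈ Finset.range (u + 1), a i + ∑ j ∈ Finset.range (v + 1), b j + μ
  card_S : 3 + ∑ i ∈ Finset.range (u + 1), a i ≤ h * (u + 1) + μ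
  card_T : 4 + ∑ j ∈ Finset.range (v + 1), b j ≤ h * (v + 1) + 2 * μ
  card_le : h * (u + 1) + ∑ j ∈ Finset.range (v + 1), b j ≤
    h * (v + 1) + ∑ i ∈ Finset.range (u + 1), a i

namespace HoleChain

variable {h μ u v : ℕ} {a b d : ℕ → ℕ}

/-- The same chain read backwards. -/
theorem reverse (N : HoleChain h μ u v a b d) :
    HoleChain h μ u v (fun i => a (u - i)) (fun j => b (v - j)) (fun k => d (u + v - k)) := by
  have ea := Finset.sum_flip (n := u) a
  have eb := Finset.sum_flip (n := v) b
  have ed := Finset.sum_flip (n := u + v) d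
  have key : ∀ i ≤ u, ∀ j ≤ v, u + v - (i + j) = (u - i) + (v - j) := fun i hi j hj => by omega
  refine ⟨N.two_le, N.hμ, N.hu, N.hv, fun i _ => N.a_lt _ (by omega),
    fun j _ => N.b_lt _ (by omega), fun i hi j hj => ?_, fun i hi j hj => ?_,
    fun i hi j hj => ?_, fun j hj hb => ?_, ?_, ?_, ?_, ?_, ?_⟩
  · simp only [key i hi j hj]; exact N.d_le_a _ (by omega) _ (by omega)
  · simp only [key i hi j hj]; exact N.d_le_b _ (by omega) _ (by omega)
  · simp only [key i hi j hj]; exact N.le_add _ (by omega) _ (by omega)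
  · have := N.test (v - j) (by omega) hb
    rw [← Finset.sum_flip (n := u) (fun i => d (i + (v - j)))] at this
    refine le_trans (le_of_eq (Finset.sum_congr rfl (fun i hi => ?_))) this
    rw [Finset.mem_range] at hi
    rw [key i (by omega) j hj]
  · rw [ea]; exact N.sum_a
  · rw [ea, eb, ed]; exact N.sum_d
  · rw [ea]; exact N.card_S
  · rw [eb]; exact N.card_T
  · rw [ea, eb]; exact N.card_le

theorem exists_rep {u v k : ℕ} (hk : k ≤ u + v) : ∃ i j, i ≤ u ∧ j ≤ v ∧ k = i + j :=
  ⟨min k u, k - min k u, by omega, by omega, by omega⟩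

/-- The indices of fibres of `T` consisting of a single element whose sum with `S` has `h` holes. As
the property `test` is not available for single elements, such a column has one hole more than the
bound it states. -/
def tightCols (h u v : ℕ) (b d : ℕ → ℕ) : Finset ℕ :=
  (Finset.range (v + 1)).filter
    (fun x => b x + 1 = h ∧ ∑ i ∈ Finset.range (u + 1), d (i + x) = h)

/-- An interior hole of the sumset occurs in at least two columns when the inequalities `test` are
summed over all columns; the tight columns are the only ones violating `test`. -/
theorem inner_le (N : HoleChain h μ u v a b d) :
    ∑ k ∈ Finset.range (u + v - 1), d (k + 1) + ∑ k ∈ Finset.range (u + v + 1), d k ≤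
      ∑ j ∈ Finset.range (v + 1), b j + (tightCols h u v b d).card := by
  have hcol : ∀ x ∈ Finset.range (v + 1), ∑ i ∈ Finset.range (u + 1), d (i + x) ≤
      b x + if b x + 1 = h ∧ ∑ i ∈ Finset.range (u + 1), d (i + x) = h then 1 else 0 := by
    intro x hx
    rw [Finset.mem_range] at hx
    by_cases hb : b x + 2 ≤ h
    · exact (N.test x (by omega) hb).trans (Nat.le_add_right _ _)
    · have h1 := N.b_lt x (by omega)
      have h2 : ∑ i ∈ Finset.range (u + 1), d (i + x) ≤ ∑ i ∈ Finset.range (u + 1), a i :=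
        Finset.sum_le_sum (fun i hi => N.d_le_a i (by rw [Finset.mem_range] at hi; omega) x
          (by omega))
      have h3 := N.sum_a
      split_ifs with hc <;> omega
  have hDS := Finset.sum_le_sum hcol
  rw [Finset.sum_add_distrib, ← Finset.card_filter, sum_grid] at hDS
  obtain ⟨u', rfl⟩ := Nat.exists_eq_add_of_le' N.hu
  obtain ⟨v', rfl⟩ := Nat.exists_eq_add_of_le' N.hv
  have h2 := sum_grid (fun k => d (k + 1)) u' v'
  have e : ∑ x ∈ Finset.range (v' + 1), ∑ i ∈ Finset.range (u' + 1), d (i + 1 + x) =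
      ∑ x ∈ Finset.range (v' + 1), ∑ i ∈ Finset.range (u' + 1), d (i + x + 1) :=
    Finset.sum_congr rfl (fun x _ => Finset.sum_congr rfl (fun i _ => by congr 1; omega))
  have e' : u' + 1 + (v' + 1) - 1 = u' + v' + 1 := by omega
  rw [e] at hDS
  rw [e', tightCols]
  omega

theorem sum_ends (N : HoleChain h μ u v a b d) : ∑ k ∈ Finset.range (u + v + 1), d k =
    d 0 + ∑ k ∈ Finset.range (u + v - 1), d (k + 1) + d (u + v) := by
  have hu := N.hu
  have e : u + v + 1 = (u + v - 1) + 2 := by omega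
  have e' : u + v - 1 + 1 = u + v := by omega
  rw [e, sum_range_ends, e']

theorem d_zero_le (N : HoleChain h μ u v a b d) : d 0 ≤ a 0 ∧ d 0 ≤ b 0 := by
  have h1 := N.d_le_a 0 (by omega) 0 (by omega)
  have h2 := N.d_le_b 0 (by omega) 0 (by omega)
  simp only [add_zero] at h1 h2
  exact ⟨h1, h2⟩

theorem d_last_le (N : HoleChain h μ u v a b d) : d (u + v) ≤ a u ∧ d (u + v) ≤ b v :=
  ⟨N.d_le_a u le_rfl v le_rfl, N.d_le_b u le_rfl v le_rfl⟩

theorem add_le_sum_a (N : HoleChain h μ u v a b d) :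
    a 0 + a u ≤ ∑ i ∈ Finset.range (u + 1), a i :=
  add_le_sum_range (by omega) (by omega) (by have := N.hu; omega)

theorem add_le_sum_b (N : HoleChain h μ u v a b d) :
    b 0 + b v ≤ ∑ i ∈ Finset.range (v + 1), b i :=
  add_le_sum_range (by omega) (by omega) (by have := N.hv; omega)

/-- Without interior holes, the holes of the sumset are bounded by those of the two end fibres of
`S`. -/
theorem sum_d_le_of_inner (N : HoleChain h μ u v a b d)
    (h0 : ∑ k ∈ Finset.range (u + v - 1), d (k + 1) = 0) :
    ∑ k ∈ Finset.range (u + v + 1), d k ≤ ∑ i ∈ Finset.range (u + 1), a i := by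
  have h1 := N.sum_ends
  have h2 := N.d_zero_le
  have h3 := N.d_last_le
  have h4 := N.add_le_sum_a
  omega

/-- The two adjacent representations of an interior index. -/
theorem exists_two_reps (N : HoleChain h μ u v a b d) {k : ℕ} (hk : k < u + v - 1) :
    ∃ i j, i + 1 ≤ u ∧ j + 1 ≤ v ∧ k = i + j := by
  have := N.hu
  have := N.hv
  exact ⟨min k (u - 1), k - min k (u - 1), by omega, by omega, by omega⟩

theorem le_of_inner (N : HoleChain h μ u v a b d) {i j : ℕ} (hi : i + 1 ≤ u) (hj : j + 1 ≤ v)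
    (hd : d (i + j + 1) ≠ 0) : h ≤ a i + b (j + 1) ∧ h ≤ a (i + 1) + b j := by
  have e1 : i + j + 1 = i + (j + 1) := by omega
  have e2 : i + j + 1 = (i + 1) + j := by omega
  exact ⟨N.le_add i (by omega) (j + 1) hj (e1 ▸ hd), N.le_add (i + 1) hi j (by omega) (e2 ▸ hd)⟩

/-- The bound of `sum_d_le` when a tight column is followed by a column with at least two
elements. -/
theorem sum_d_le_of_tight (N : HoleChain h μ u v a b d) (ha : ∀ i ≤ u, 1 ≤ a i) {x x₀ : ℕ}
    (hx : x ∈ tightCols h u v b d) (hx₀ : b x₀ + 2 ≤ h) (hx₀v : x₀ ≤ v) (hlt : x < x₀) :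
    ∑ k ∈ Finset.range (u + v + 1), d k ≤ ∑ i ∈ Finset.range (u + 1), a i := by
  have hh := N.two_le
  have hu := N.hu
  have htight : ∀ y ∈ tightCols h u v b d, b y + 1 = h ∧ y ≤ v ∧ μ = 0 ∧
      ∑ i ∈ Finset.range (u + 1), a i = h ∧ ∀ i ≤ u, d (i + y) = a i := by
    intro y hy
    rw [tightCols, Finset.mem_filter, Finset.mem_range] at hy
    obtain ⟨hyv, hby, hsum⟩ := hy
    have hle : ∀ i ∈ Finset.range (u + 1), d (i + y) ≤ a i := fun i hi =>
      N.d_le_a i (by rw [Finset.mem_range] at hi; omega) y (by omega)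
    have h1 := Finset.sum_le_sum hle
    have h2 := N.sum_a
    have h3 := (Finset.sum_eq_sum_iff_of_le hle).1 (by omega)
    exact ⟨hby, by omega, by omega, by omega, fun i hi => h3 i (Finset.mem_range.2 (by omega))⟩
  obtain ⟨hbx, hxv, hμ0, hsum, hda⟩ := htight x hx
  have hsd := N.sum_d
  have h3 : 3 ≤ h := by
    by_contra hlt
    have hh2 : h = 2 := by omega
    have h1 : ∑ i ∈ Finset.range (u + 1), 1 ≤ ∑ i ∈ Finset.range (u + 1), a i :=
      Finset.sum_le_sum (fun i hi => ha i (by rw [Finset.mem_range] at hi; omega))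
    rw [Finset.sum_const, Finset.card_range, smul_eq_mul, mul_one] at h1
    have h2 := N.card_S
    rw [hh2] at h2
    omega
  -- a path through the column `x₀` bounds the number of holes by `∑ b`; if the bound `b y` could be
  -- lowered to `c`, then this would already be too small
  have hpath : ∀ y, y ≠ x₀ → y ≤ v → ∀ c, (y < x₀ → d y ≤ c) → (x₀ < y → d (u + y) ≤ c) →
      b y ≤ c := by
    intro y hyx hyv c hc1 hc2
    by_contra hcb
    have h1 := sum_path_le (d := d) (m := fun j => if j = y then c else b j) (u := u) hx₀v
      (fun j hj => by
        split_ifs with hjy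
        · exact hjy ▸ hc1 (hjy ▸ hj)
        · have := N.d_le_b 0 (by omega) j (by omega); rwa [zero_add] at this)
      (fun j hj hjv => by
        split_ifs with hjy
        · exact hjy ▸ hc2 (hjy ▸ hj)
        · exact N.d_le_b u le_rfl j hjv)
    have h2 := N.test x₀ hx₀v hx₀
    have h3 : ∑ j ∈ Finset.range (v + 1), (if j = y then c else b j) <
        ∑ j ∈ Finset.range (v + 1), b j := by
      apply Finset.sum_lt_sum
      · intro j _
        split_ifs with hjy
        · rw [hjy]; omega
        · exact le_rfl
      · exact ⟨y, Finset.mem_range.2 (by omega), by rw [if_pos rfl]; omega⟩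
    rw [if_neg (Ne.symm hyx)] at h1
    omega
  have hax : b x ≤ a 0 := by
    refine hpath x (by omega) hxv _ (fun _ => ?_) (fun h => by omega)
    have := N.d_le_a 0 (by omega) x hxv
    rwa [zero_add] at this
  have ha0 := N.a_lt 0 (by omega)
  have hau := ha u le_rfl
  have hends := N.add_le_sum_a
  -- `a 0 = h - 1` and `∑ a = h` leave one hole, so `S` has just two fibres
  have hu1 : u = 1 := by
    by_contra hne
    have h1 := add_add_le_sum_range (f := a) (n := u + 1) (i := 0) (j := 1) (l := u) (by omega)
      (by omega) (by omega) (by omega) (by omega) (by omega)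
    have h2 := ha 1 (by omega)
    omega
  subst hu1
  -- as `a 1 = 1 < a 0`, no other column is tight
  have hW : tightCols h 1 v b d ⊆ {0} := by
    intro y hy
    obtain ⟨_, hyv, _, _, hdy⟩ := htight y hy
    rw [Finset.mem_singleton]
    by_contra hne
    have h1 := hdy 0 (by omega)
    have h2 := N.d_le_a 1 le_rfl (y - 1) (by omega)
    have e : 1 + (y - 1) = 0 + y := by omega
    rw [e] at h2
    omega
  have hWc := Finset.card_le_card hW
  rw [Finset.card_singleton] at hWc
  have hbv : b v + 2 ≤ h := by
    by_cases hv : v = x₀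
    · rw [hv]; exact hx₀
    · have := hpath v hv le_rfl (a 1) (fun h => by omega) (fun _ => N.d_le_a 1 le_rfl v le_rfl)
      omega
  have hdl : d (1 + v) = 0 := by
    by_contra hne
    have := N.le_add 1 le_rfl v le_rfl hne
    omega
  have h1 := N.inner_le
  have h2 := N.sum_ends
  have h3 := N.d_zero_le
  omega

/-- The sumset has at most as many holes as the first summand. If some fibre of `S` is full, this
follows from a path through its row; otherwise from counting interior holes twice, with special
attention to tight columns. -/
theorem sum_d_le (N : HoleChain h μ u v a b d) :
    ∑ k ∈ Finset.range (u + v + 1), d k ≤ ∑ i ∈ Finset.range (u + 1), a i := by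
  have hh := N.two_le
  have hu := N.hu
  have hv := N.hv
  have hsd := N.sum_d
  have hsa := N.sum_a
  -- a path through the row `r`
  have hrow : ∀ r ≤ u, ∑ k ∈ Finset.range (u + v + 1), d k + a r ≤
      ∑ i ∈ Finset.range (u + 1), a i + ∑ j ∈ Finset.range (v + 1), d (j + r) := by
    intro r hr
    have := sum_path_le (d := d) (m := a) (u := v) hr
      (fun j hj => by have := N.d_le_a j (by omega) 0 (by omega); rwa [add_zero] at this)
      (fun j hj hju => by have := N.d_le_a j hju v le_rfl; rwa [add_comm])
    rwa [add_comm v u] at this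
  by_cases h0 : ∃ r ≤ u, a r = 0
  · obtain ⟨r, hr, har⟩ := h0
    have h1 := hrow r hr
    have h2 : ∑ j ∈ Finset.range (v + 1), d (j + r) = 0 := by
      apply Finset.sum_eq_zero
      intro j hj
      rw [Finset.mem_range] at hj
      have := N.d_le_a r hr j (by omega)
      rw [add_comm]
      omega
    omega
  push Not at h0
  have ha : ∀ i ≤ u, 1 ≤ a i := fun i hi => Nat.one_le_iff_ne_zero.2 (h0 i hi)
  have hinner := N.inner_le
  -- without tight columns, an interior hole would force `u = v = 1`, contrary to `card_le`
  rcases (tightCols h u v b d).eq_empty_or_nonempty with hW | ⟨x, hx⟩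
  · rw [hW, Finset.card_empty, add_zero] at hinner
    by_cases hin : ∑ k ∈ Finset.range (u + v - 1), d (k + 1) = 0
    · exact N.sum_d_le_of_inner hin
    exfalso
    obtain ⟨k, hk, hdk⟩ : ∃ k ∈ Finset.range (u + v - 1), d (k + 1) ≠ 0 := by
      by_contra hcon
      push Not at hcon
      exact hin (Finset.sum_eq_zero hcon)
    obtain ⟨i, j, hi, hj, rfl⟩ := N.exists_two_reps (Finset.mem_range.1 hk)
    obtain ⟨h1, h2⟩ := N.le_of_inner hi hj hdk
    have h3 := add_le_sum_range (f := a) (n := u + 1) (i := i) (j := i + 1) (by omega) (by omega)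
      (by omega)
    have h4 := add_le_sum_range (f := b) (n := v + 1) (i := j) (j := j + 1) (by omega) (by omega)
      (by omega)
    have hends := N.sum_ends
    have hd0 := N.d_zero_le
    have hdl := N.d_last_le
    have h5 := N.add_le_sum_a
    have ha0 := ha 0 (by omega)
    have hau := ha u le_rfl
    have hu1 : u = 1 := by
      by_contra hne
      have h6 := add_add_le_sum_range (f := a) (n := u + 1) (i := 0) (j := 1) (l := u) (by omega)
        (by omega) (by omega) (by omega) (by omega) (by omega)
      have h7 := ha 1 (by omega)
      omega
    have hv1 : v = 1 := by
      by_contra hne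
      by_cases hj0 : j = 0
      · have h6 := add_add_le_sum_range (f := b) (n := v + 1) (i := j) (j := j + 1) (l := v)
          (by omega) (by omega) (by omega) (by omega) (by omega) (by omega)
        omega
      · have h6 := add_add_le_sum_range (f := b) (n := v + 1) (i := j) (j := j + 1) (l := 0)
          (by omega) (by omega) (by omega) (by omega) (by omega) (by omega)
        omega
    have h8 := N.card_le
    subst hu1
    subst hv1
    obtain rfl : i = 0 := by omega
    obtain rfl : j = 0 := by omega
    simp only [zero_add] at h1 h2 h3 h4
    omega
  · obtain ⟨hxv, hbx, hsum⟩ : x < v + 1 ∧ b x + 1 = h ∧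
        ∑ i ∈ Finset.range (u + 1), d (i + x) = h := by
      rwa [tightCols, Finset.mem_filter, Finset.mem_range] at hx
    -- in the presence of a tight column, another one with two elements gives the bound, up to
    -- reversal
    by_cases hall : ∃ x₀ ≤ v, b x₀ + 2 ≤ h
    · obtain ⟨x₀, hx₀v, hx₀⟩ := hall
      rcases Nat.lt_trichotomy x x₀ with hlt | rfl | hlt
      · exact N.sum_d_le_of_tight ha hx hx₀ hx₀v hlt
      · omega
      · have h1 := N.reverse.sum_d_le_of_tight (x := v - x) (x₀ := v - x₀)
          (fun i _ => ha _ (by omega)) (by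
            rw [tightCols, Finset.mem_filter, Finset.mem_range]
            have e : v - (v - x) = x := by omega
            refine ⟨by omega, by rw [e]; exact hbx, ?_⟩
            rw [← hsum, ← Finset.sum_flip (n := u) (fun i => d (i + x))]
            apply Finset.sum_congr rfl
            intro i hi
            rw [Finset.mem_range] at hi
            congr 1
            omega) (by
            have e : v - (v - x₀) = x₀ := by omega
            simp only [e]
            exact hx₀) (by omega) (by omega)
        rwa [Finset.sum_flip, Finset.sum_flip] at h1
    · exfalso
      -- if `T` consists of single elements, then a path through a row with `a r ≤ h - 2`
      -- contradicts `|T| ≥ 4`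
      push Not at hall
      have hb1 : ∀ j ∈ Finset.range (v + 1), b j = h - 1 := by
        intro j hj
        rw [Finset.mem_range] at hj
        have h1 := hall j (by omega)
        have h2 := N.b_lt j (by omega)
        omega
      have hsb : ∑ j ∈ Finset.range (v + 1), b j = (v + 1) * (h - 1) := by
        rw [Finset.sum_congr rfl hb1, Finset.sum_const, Finset.card_range, smul_eq_mul]
      have hle : ∑ i ∈ Finset.range (u + 1), d (i + x) ≤ ∑ i ∈ Finset.range (u + 1), a i :=
        Finset.sum_le_sum (fun i hi => N.d_le_a i (by rw [Finset.mem_range] at hi; omega) x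
          (by omega))
      have h3 : 3 ≤ h := by
        by_contra hlt
        have hh2 : h = 2 := by omega
        have h1 : ∑ i ∈ Finset.range (u + 1), 1 ≤ ∑ i ∈ Finset.range (u + 1), a i :=
          Finset.sum_le_sum (fun i hi => ha i (by rw [Finset.mem_range] at hi; omega))
        rw [Finset.sum_const, Finset.card_range, smul_eq_mul, mul_one] at h1
        have h2 := N.card_S
        rw [hh2] at h2
        omega
      obtain ⟨r, hr, har⟩ : ∃ r ≤ u, a r + 2 ≤ h := by
        by_contra hcon
        push Not at hcon
        have h1 := hcon 0 (by omega)
        have h2 := hcon u le_rfl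
        have h3 := N.add_le_sum_a
        omega
      have h1 := hrow r hr
      have h2 : ∑ j ∈ Finset.range (v + 1), d (j + r) ≤ (v + 1) * a r := by
        have := Finset.sum_le_card_nsmul (Finset.range (v + 1)) (fun j => d (j + r)) (a r)
          (fun j hj => by
            rw [Finset.mem_range] at hj
            rw [add_comm]
            exact N.d_le_a r hr j (by omega))
        rwa [Finset.card_range, smul_eq_mul] at this
      have h5 := N.card_T
      obtain ⟨l, rfl⟩ := Nat.exists_eq_add_of_le har
      have e1 : a r + 2 + l - 1 = a r + l + 1 := by omega
      rw [e1] at hsb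
      have e2 : (v + 1) * (a r + l + 1) = (v + 1) * a r + (v * l + l + v + 1) := by ring
      have e3 : (a r + 2 + l) * (v + 1) = (v + 1) * a r + (2 * v + 2 + v * l + l) := by ring
      omega

theorem sum_b_le (N : HoleChain h μ u v a b d) :
    ∑ j ∈ Finset.range (v + 1), b j + μ ≤ h := by
  have h1 := N.sum_d_le
  have h2 := N.sum_d
  omega

/-- The possible positions of the holes of the sumset: an interior hole next to one of the ends, the
same number of holes at both ends, or holes at one end only. -/
theorem classify (N : HoleChain h μ u v a b d) :
    (μ = 0 ∧ ∑ i ∈ Finset.range (u + 1), a i = h ∧ ∑ j ∈ Finset.range (v + 1), b j = h ∧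
      a u + 1 = h ∧ a (u - 1) = 1 ∧ b v + 1 = h ∧ b (v - 1) = 1 ∧ d (u + v - 1) = 1) ∨
    (μ = 0 ∧ ∑ i ∈ Finset.range (u + 1), a i = h ∧ ∑ j ∈ Finset.range (v + 1), b j = h ∧
      a 0 + 1 = h ∧ a 1 = 1 ∧ b 0 + 1 = h ∧ b 1 = 1 ∧ d 1 = 1) ∨
    (μ = 0 ∧ ∑ i ∈ Finset.range (u + 1), a i = h ∧ ∑ j ∈ Finset.range (v + 1), b j = h ∧
      2 * a 0 = h ∧ 2 * a u = h ∧ 2 * b 0 = h ∧ 2 * b v = h ∧ 2 * d 0 = h ∧ 2 * d (u + v) = h ∧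
      ∀ k, 0 < k → k < u + v → d k = 0) ∨
    (∀ k < u + v, d k = 0) ∨ (∀ k, 0 < k → k ≤ u + v → d k = 0) := by
  have hh := N.two_le
  have hu := N.hu
  have hv := N.hv
  have hsd := N.sum_d
  have hsa := N.sum_a
  have hsb := N.sum_b_le
  by_cases hin : ∃ k < u + v - 1, d (k + 1) ≠ 0
  -- an interior hole at `i + j + 1` comes from two pairs of fibres, which contain all holes of `S`
  -- and of `T`; so the sumset has holes at most in three consecutive fibres
  · obtain ⟨k, hk, hdk⟩ := hin
    obtain ⟨i, j, hi, hj, rfl⟩ := N.exists_two_reps hk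
    obtain ⟨h1, h2⟩ := N.le_of_inner hi hj hdk
    have h3 := add_le_sum_range (f := a) (n := u + 1) (i := i) (j := i + 1) (by omega) (by omega)
      (by omega)
    have h4 := add_le_sum_range (f := b) (n := v + 1) (i := j) (j := j + 1) (by omega) (by omega)
      (by omega)
    have ha0 : ∀ i' ≤ u, a i' ≠ 0 → i' = i ∨ i' = i + 1 := by
      intro i' hi' hne
      by_contra hcon
      push Not at hcon
      have := add_add_le_sum_range (f := a) (n := u + 1) (i := i) (j := i + 1) (l := i')
        (by omega) (by omega) (by omega) (by omega) (Ne.symm hcon.1) (Ne.symm hcon.2)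
      omega
    have hb0 : ∀ j' ≤ v, b j' ≠ 0 → j' = j ∨ j' = j + 1 := by
      intro j' hj' hne
      by_contra hcon
      push Not at hcon
      have := add_add_le_sum_range (f := b) (n := v + 1) (i := j) (j := j + 1) (l := j')
        (by omega) (by omega) (by omega) (by omega) (Ne.symm hcon.1) (Ne.symm hcon.2)
      omega
    have hrep : ∀ i' ≤ u, ∀ j' ≤ v, d (i' + j') ≠ 0 →
        (i' = i ∨ i' = i + 1) ∧ (j' = j ∨ j' = j + 1) := by
      intro i' hi' j' hj' hne
      have h5 := N.le_add i' hi' j' hj' hne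
      have h6 := N.a_lt i' hi'
      have h7 := N.b_lt j' hj'
      exact ⟨ha0 i' hi' (by omega), hb0 j' hj' (by omega)⟩
    have hsum : ∑ k ∈ Finset.range (u + v + 1), d k =
        d (i + j) + d (i + j + 1) + d (i + j + 2) := by
      have e : d (i + j) + d (i + j + 1) + d (i + j + 2) =
          ∑ k ∈ {i + j, i + j + 1, i + j + 2}, d k := by
        rw [Finset.sum_insert (by simp), Finset.sum_pair (by simp), add_assoc]
      rw [e]
      symm
      apply Finset.sum_subset
      · intro x hx
        simp only [Finset.mem_insert, Finset.mem_singleton] at hx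
        rw [Finset.mem_range]
        omega
      · intro x hx hxn
        simp only [Finset.mem_insert, Finset.mem_singleton] at hxn
        rw [Finset.mem_range] at hx
        by_contra hne
        obtain ⟨i', j', hi', hj', rfl⟩ := exists_rep (u := u) (v := v) (k := x) (by omega)
        have := hrep i' hi' j' hj' hne
        omega
    have hai := N.a_lt i (by omega)
    have hai' := N.a_lt (i + 1) (by omega)
    have e1 : i + 1 + j = i + j + 1 := by omega
    have e2 : i + (j + 1) = i + j + 1 := by omega
    have e3 : i + 1 + (j + 1) = i + j + 2 := by omega
    have d0 := N.d_le_a i (by omega) j (by omega)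
    have d1 := N.d_le_a i (by omega) (j + 1) (by omega)
    have d1' := N.d_le_a (i + 1) (by omega) j (by omega)
    have d2 := N.d_le_a (i + 1) (by omega) (j + 1) (by omega)
    have l0 := N.le_add i (by omega) j (by omega)
    have l2 := N.le_add (i + 1) (by omega) (j + 1) (by omega)
    rw [e2] at d1
    rw [e1] at d1'
    rw [e3] at d2 l2
    have t0 : b j + 2 ≤ h → d (i + j) + d (i + j + 1) ≤ b j := by
      intro hb
      have h5 := N.test j (by omega) hb
      have h6 := add_le_sum_range (f := fun i => d (i + j)) (n := u + 1) (i := i) (j := i + 1)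
        (by omega) (by omega) (by omega)
      simp only [e1] at h6
      omega
    have t1 : b (j + 1) + 2 ≤ h → d (i + j + 1) + d (i + j + 2) ≤ b (j + 1) := by
      intro hb
      have h5 := N.test (j + 1) (by omega) hb
      have h6 := add_le_sum_range (f := fun i => d (i + (j + 1))) (n := u + 1) (i := i)
        (j := i + 1) (by omega) (by omega) (by omega)
      simp only [e2, e3] at h6
      omega
    -- the holes not accounted for are in one neighbouring fibre, which must be the last or the
    -- first one
    by_cases hd0 : d (i + j) = 0
    · left
      have hd2 : d (i + j + 2) ≠ 0 := by omega
      have hiu : i + 1 = u := by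
        by_contra hne
        have h5 := hrep (i + 2) (by omega) j (by omega)
          (by rw [show i + 2 + j = i + j + 2 by omega]; exact hd2)
        omega
      have hjv : j + 1 = v := by
        by_contra hne
        have h5 := hrep i (by omega) (j + 2) (by omega)
          (by rw [show i + (j + 2) = i + j + 2 by omega]; exact hd2)
        omega
      subst hiu
      subst hjv
      have e4 : i + 1 + (j + 1) - 1 = i + j + 1 := by omega
      rw [e4, Nat.add_sub_cancel, Nat.add_sub_cancel]
      have := l2 hd2
      omega
    · right; left
      have hi0 : i = 0 := by
        by_contra hne
        have h5 := hrep (i - 1) (by omega) (j + 1) (by omega)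
          (by rw [show i - 1 + (j + 1) = i + j by omega]; exact hd0)
        omega
      have hj0 : j = 0 := by
        by_contra hne
        have h5 := hrep (i + 1) (by omega) (j - 1) (by omega)
          (by rw [show i + 1 + (j - 1) = i + j by omega]; exact hd0)
        omega
      subst hi0
      subst hj0
      simp only [zero_add] at *
      have := l0 hd0
      omega
  · push Not at hin
    have hin' : ∀ k, 0 < k → k < u + v → d k = 0 := by
      intro k h1 h2
      have := hin (k - 1) (by omega)
      rwa [Nat.sub_add_cancel h1] at this
    by_cases hd0 : d 0 = 0
    · right; right; right; left
      intro k hk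
      rcases Nat.eq_zero_or_pos k with rfl | h1
      · exact hd0
      · exact hin' k h1 hk
    by_cases hdl : d (u + v) = 0
    · right; right; right; right
      intro k h1 hk
      rcases hk.lt_or_eq with h2 | rfl
      · exact hin' k h1 h2
      · exact hdl
    -- holes at both ends only
    right; right; left
    have h1 := N.le_add 0 (by omega) 0 (by omega) hd0
    have h2 := N.le_add u le_rfl v le_rfl hdl
    have h3 := N.add_le_sum_a
    have h4 := N.add_le_sum_b
    have h5 := N.d_zero_le
    have h6 := N.d_last_le
    have h7 := N.sum_ends
    have h8 : ∑ k ∈ Finset.range (u + v - 1), d (k + 1) = 0 :=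
      Finset.sum_eq_zero (fun k hk => hin k (Finset.mem_range.1 hk))
    refine ⟨by omega, by omega, by omega, by omega, by omega, by omega, by omega, by omega,
      by omega, hin'⟩

end HoleChain

end HoleChain

/-! ### Chains of partial cosets -/

section CosetChain

variable {G Q : Type*} [AddCommGroup G] [DecidableEq G] [AddCommGroup Q] [DecidableEq Q]

/-- Two sets of the same cardinality whose sumset is not larger are cosets of one subgroup. -/
theorem exists_isTranslateOf {X Y : Finset G} (hX : X.Nonempty) (hY : Y.Nonempty)
    (hXY : X.card = Y.card) (hc : (X + Y).card ≤ X.card) :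
    ∃ K : AddSubgroup G, Nat.card K = X.card ∧ IsTranslateOf X K ∧ IsTranslateOf Y K ∧
      K = stab X := by
  have hfin := finite_stab hX
  obtain ⟨x₀, hx₀⟩ := hX
  obtain ⟨y₀, hy₀⟩ := hY
  -- all translates `X + y` equal `X + Y`, so the elements of `Y` differ by periods of `X`
  have h1 : ∀ y ∈ Y, X.image (· + y) = X + Y := by
    intro y hy
    apply Finset.eq_of_subset_of_card_le
    · intro z hz
      obtain ⟨x, hx, rfl⟩ := Finset.mem_image.1 hz
      exact Finset.add_mem_add hx hy
    · rwa [card_image_add]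
  have h2 : ∀ y ∈ Y, y - y₀ ∈ stab X := by
    intro y hy
    apply mem_stab_of_forall
    intro x hx
    have : x + y ∈ X.image (· + y₀) := by
      rw [h1 y₀ hy₀]; exact Finset.add_mem_add hx hy
    obtain ⟨x', hx', he⟩ := Finset.mem_image.1 this
    have : y - y₀ + x = x' := by rw [sub_add_eq_add_sub, add_comm y x, ← he, add_sub_cancel_right]
    rwa [this]
  have h3 : Y ⊆ (elts (stab X)).image (· + y₀) := by
    intro y hy
    exact Finset.mem_image.2 ⟨y - y₀, mem_elts.2 (h2 y hy), by abel⟩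
  have h4 : (elts (stab X)).image (· + x₀) ⊆ X := by
    intro z hz
    obtain ⟨k, hk, rfl⟩ := Finset.mem_image.1 hz
    exact (mem_stab.1 (mem_elts.1 hk) x₀).2 hx₀
  have c3 := Finset.card_le_card h3
  have c4 := Finset.card_le_card h4
  rw [card_image_add, card_elts] at c3 c4
  have e3 := Finset.eq_of_subset_of_card_le h3 (by rw [card_image_add, card_elts]; omega)
  have e4 := Finset.eq_of_subset_of_card_le h4 (by rw [card_image_add, card_elts]; omega)
  have htr : ∀ (Z : Finset G) (z₀ : G), (elts (stab X)).image (· + z₀) = Z →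
      IsTranslateOf Z (stab X) := by
    rintro Z z₀ rfl
    refine ⟨z₀, ?_⟩
    ext z
    rw [Finset.mem_coe, Finset.mem_image, Set.mem_vadd_set]
    constructor
    · rintro ⟨k, hk, rfl⟩
      exact ⟨k, mem_elts.1 hk, by rw [vadd_eq_add, add_comm]⟩
    · rintro ⟨k, hk, rfl⟩
      exact ⟨k, mem_elts.2 hk, by rw [vadd_eq_add, add_comm]⟩
  exact ⟨stab X, by omega, htr X x₀ e4, htr Y y₀ e3.symm, rfl⟩

/-- The product of two independent subgroups is contained in `L`. -/
theorem card_mul_card_le_of_inf {K₀ K₁ L : AddSubgroup G} [Finite L] (h₀ : K₀ ≤ L) (h₁ : K₁ ≤ L)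
    (h : K₀ ⊓ K₁ = ⊥) : Nat.card K₀ * Nat.card K₁ ≤ Nat.card L := by
  rw [← Nat.card_prod]
  refine Nat.card_le_card_of_injective
    (fun p : K₀ × K₁ => (⟨p.1 + p.2, add_mem (h₀ p.1.2) (h₁ p.2.2)⟩ : L)) ?_
  intro p p' he
  have he' : (p.1 : G) + p.2 = p'.1 + p'.2 := congrArg Subtype.val he
  have h2 : (p.1 : G) - p'.1 = p'.2 - p.2 := by
    rw [sub_eq_sub_iff_add_eq_add, he', add_comm]
  have h3 : (p.1 : G) - p'.1 ∈ K₀ ⊓ K₁ :=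
    ⟨K₀.sub_mem p.1.2 p'.1.2, h2 ▸ K₁.sub_mem p'.2.2 p.2.2⟩
  rw [h, AddSubgroup.mem_bot] at h3
  rw [h3] at h2
  exact Prod.ext (Subtype.ext (sub_eq_zero.1 h3)) (Subtype.ext (sub_eq_zero.1 h2.symm).symm)

/-- Two progressions `A 0, …, A u` and `B 0, …, B v` of parts of cosets of the kernel of `φ`, and
the parts `C 0, …, C (u + v)` of their sum. The field `aper` says that the union of the `C k` is
aperiodic. -/
structure CosetChain (φ : G →+ Q) (h μ u v : ℕ) (A B C : ℕ → Finset G) : Prop where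
  fin : Finite φ.ker
  card_ker : Nat.card φ.ker = h
  holes : HoleChain h μ u v (fun i => h - (A i).card) (fun j => h - (B j).card)
    (fun k => h - (C k).card)
  card_A : ∀ i, (A i).card ≤ h
  card_B : ∀ j, (B j).card ≤ h
  card_C : ∀ k, (C k).card ≤ h
  sub : ∀ i ≤ u, ∀ j ≤ v, B j + A i ⊆ C (i + j)
  cover : ∀ k ≤ u + v, ∀ x ∈ C k, ∃ i ≤ u, ∃ j ≤ v, i + j = k ∧ x ∈ B j + A i
  coset : ∀ k, ∀ x ∈ C k, ∀ y ∈ C k, φ x = φ y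
  aper : ∀ K : AddSubgroup G, (∀ k ≤ u + v, K ≤ stab (C k)) → K = ⊥

/-- The possible shapes of two progressions of partial cosets with small sumset, as seen from
their final terms: an essential pair, or a pair of almost periodic sets. -/
def ChainEnd (L : AddSubgroup G) (h μ u v : ℕ) (A B : ℕ → Finset G) : Prop :=
  (μ = 0 ∧ ∑ i ∈ Finset.range (u + 1), (h - (A i).card) = h ∧
    ∑ j ∈ Finset.range (v + 1), (h - (B j).card) = h ∧
    ((h = 2 ∧ (A 0).card = 1 ∧ (A u).card = 1 ∧ (B 0).card = 1 ∧ (B v).card = 1) ∨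
      ((A u).card = 1 ∧ (B v).card = 1 ∧ (A (u - 1)).card + 1 = h ∧ (B (v - 1)).card + 1 = h ∧
        B (v - 1) + A u = B v + A (u - 1)) ∨
      (∃ K₀ K₁ : AddSubgroup G, Nat.card K₀ = 2 ∧ Nat.card K₁ = 2 ∧
        K₀ ⊔ K₁ = L ∧ K₀ ⊓ K₁ = ⊥ ∧ IsTranslateOf (A 0) K₀ ∧ IsTranslateOf (B 0) K₀ ∧
        IsTranslateOf (A u) K₁ ∧ IsTranslateOf (B v) K₁))) ∨
  ∃ ν ≤ 1 - μ,
    ((∑ i ∈ Finset.range u, (h - (A i).card) = 0 ∧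
        ∑ j ∈ Finset.range v, (h - (B j).card) = ν) ∨
      (∑ j ∈ Finset.range v, (h - (B j).card) = 0 ∧
        ∑ i ∈ Finset.range u, (h - (A i).card) = ν)) ∧
    (B v + A u).card + ν + μ = (B v).card + (A u).card

namespace CosetChain

variable {φ : G →+ Q} {h μ u v : ℕ} {A B C : ℕ → Finset G}

theorem reverse (N : CosetChain φ h μ u v A B C) :
    CosetChain φ h μ u v (fun i => A (u - i)) (fun j => B (v - j))
      (fun k => if k ≤ u + v then C (u + v - k) else ∅) := by
  refine ⟨N.fin, N.card_ker, ?_, fun i => N.card_A _, fun j => N.card_B _, fun k => ?_,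
    fun i hi j hj => ?_, fun k hk x hx => ?_, fun k x hx y hy => ?_, fun K hK => N.aper K ?_⟩
  · have key := N.holes.reverse
    have e : ∀ i ≤ u, ∀ j ≤ v, i + j ≤ u + v := fun i hi j hj => by omega
    refine ⟨key.two_le, key.hμ, key.hu, key.hv, key.a_lt, key.b_lt, fun i hi j hj => ?_,
      fun i hi j hj => ?_, fun i hi j hj => ?_, fun j hj hb => ?_, key.sum_a, ?_, key.card_S,
      key.card_T, key.card_le⟩
    · rw [if_pos (e i hi j hj)]; exact key.d_le_a i hi j hj
    · rw [if_pos (e i hi j hj)]; exact key.d_le_b i hi j hj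
    · rw [if_pos (e i hi j hj)]; exact key.le_add i hi j hj
    · refine (Finset.sum_congr rfl (fun i hi => ?_)).trans_le (key.test j hj hb)
      rw [if_pos (e i (by rw [Finset.mem_range] at hi; omega) j hj)]
    · rw [← key.sum_d]
      congr 1
      refine Finset.sum_congr rfl (fun i hi => ?_)
      rw [if_pos (by rw [Finset.mem_range] at hi; omega)]
  · split_ifs
    · exact N.card_C _
    · exact Nat.zero_le _
  · rw [if_pos (by omega)]
    have := N.sub (u - i) (by omega) (v - j) (by omega)
    rwa [show u - i + (v - j) = u + v - (i + j) by omega] at this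
  · rw [if_pos hk] at hx
    obtain ⟨i, hi, j, hj, hij, hxs⟩ := N.cover _ (by omega) x hx
    refine ⟨u - i, by omega, v - j, by omega, by omega, ?_⟩
    rwa [show u - (u - i) = i by omega, show v - (v - j) = j by omega]
  · split_ifs at hx hy with hk
    · exact N.coset _ x hx y hy
    · simp at hx
  · intro k hk
    have := hK (u + v - k) (by omega)
    rwa [if_pos (by omega), show u + v - (u + v - k) = k by omega] at this

theorem ker_le_stab (N : CosetChain φ h μ u v A B C) {k : ℕ} (hk : h - (C k).card = 0) :
    φ.ker ≤ stab (C k) := by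
  have hfin := N.fin
  have hh := N.holes.two_le
  have hc := N.card_C k
  obtain ⟨x, hx⟩ := Finset.card_pos.1 (show 0 < (C k).card by omega)
  apply ker_le_stab_of_full (φ := φ)
  intro q hq
  obtain ⟨y, hy, rfl⟩ := Finset.mem_image.1 hq
  have : fib φ (C k) (φ y) = C k := by
    ext z
    rw [mem_fib]
    exact ⟨fun h => h.1, fun h => ⟨h, N.coset k z h y hy⟩⟩
  rw [this, N.card_ker]
  omega

theorem nonempty_A (N : CosetChain φ h μ u v A B C) {i : ℕ} (hi : i ≤ u) : (A i).Nonempty := by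
  have h1 := N.holes.a_lt i hi
  have h2 := N.card_A i
  exact Finset.card_pos.1 (by omega)

theorem nonempty_B (N : CosetChain φ h μ u v A B C) {j : ℕ} (hj : j ≤ v) : (B j).Nonempty := by
  have h1 := N.holes.b_lt j hj
  have h2 := N.card_B j
  exact Finset.card_pos.1 (by omega)

theorem stab_le_ker (N : CosetChain φ h μ u v A B C) {k : ℕ} (hk : (C k).Nonempty) :
    stab (C k) ≤ φ.ker := by
  obtain ⟨x, hx⟩ := hk
  intro g hg
  have := N.coset k _ ((mem_stab.1 hg x).2 hx) x hx
  rw [map_add, add_eq_right] at this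
  exact this

theorem nonempty_C (N : CosetChain φ h μ u v A B C) {k : ℕ} (hk : k ≤ u + v) :
    (C k).Nonempty := by
  obtain ⟨i, j, hi, hj, rfl⟩ := HoleChain.exists_rep hk
  exact ((N.nonempty_B hj).add (N.nonempty_A hi)).mono (N.sub i hi j hj)

/-- An interior incomplete coset. -/
theorem chainEnd_of_interior (N : CosetChain φ h μ u v A B C) (hμ : μ = 0)
    (hA : ∑ i ∈ Finset.range (u + 1), (h - (A i).card) = h)
    (hB : ∑ j ∈ Finset.range (v + 1), (h - (B j).card) = h)
    (hAu : h - (A u).card + 1 = h) (hAu' : h - (A (u - 1)).card = 1)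
    (hBv : h - (B v).card + 1 = h) (hBv' : h - (B (v - 1)).card = 1)
    (hC : h - (C (u + v - 1)).card = 1) : ChainEnd φ.ker h μ u v A B := by
  have hh := N.holes.two_le
  have hu := N.holes.hu
  have hv := N.holes.hv
  have c1 := N.card_A u
  have c2 := N.card_A (u - 1)
  have c3 := N.card_B v
  have c4 := N.card_B (v - 1)
  have c5 := N.card_C (u + v - 1)
  refine Or.inl ⟨hμ, hA, hB, Or.inr (Or.inl ⟨by omega, by omega, by omega, by omega, ?_⟩)⟩
  have s1 := N.sub u le_rfl (v - 1) (by omega)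
  have s2 := N.sub (u - 1) (by omega) v le_rfl
  rw [show u + (v - 1) = u + v - 1 by omega] at s1
  rw [show u - 1 + v = u + v - 1 by omega] at s2
  rw [Finset.eq_of_subset_of_card_le s1, Finset.eq_of_subset_of_card_le s2]
  · refine le_trans ?_ (Finset.card_le_card_add_left (N.nonempty_B le_rfl))
    omega
  · refine le_trans ?_ (Finset.card_le_card_add_right (N.nonempty_A le_rfl))
    omega

/-- Two incomplete cosets at the ends: they are cosets of subgroups of index two in the kernel,
and these subgroups have trivial intersection, so that the kernel has order two or four. -/
theorem chainEnd_of_ends (N : CosetChain φ h μ u v A B C) (hμ : μ = 0)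
    (hA : ∑ i ∈ Finset.range (u + 1), (h - (A i).card) = h)
    (hB : ∑ j ∈ Finset.range (v + 1), (h - (B j).card) = h)
    (hA0 : 2 * (h - (A 0).card) = h) (hAu : 2 * (h - (A u).card) = h)
    (hB0 : 2 * (h - (B 0).card) = h) (hBv : 2 * (h - (B v).card) = h)
    (hC0 : 2 * (h - (C 0).card) = h) (hCl : 2 * (h - (C (u + v)).card) = h)
    (hC : ∀ k, 0 < k → k < u + v → h - (C k).card = 0) : ChainEnd φ.ker h μ u v A B := by
  have hfin := N.fin
  have hh := N.holes.two_le
  have c1 := N.card_A 0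
  have c2 := N.card_A u
  have c3 := N.card_B 0
  have c4 := N.card_B v
  have c5 := N.card_C 0
  have c6 := N.card_C (u + v)
  have s0 := N.sub 0 (by omega) 0 (by omega)
  have sl := N.sub u le_rfl v le_rfl
  rw [zero_add] at s0
  have e0 := Finset.eq_of_subset_of_card_le s0
    (le_trans (by omega) (Finset.card_le_card_add_right (N.nonempty_A (Nat.zero_le u))))
  have el := Finset.eq_of_subset_of_card_le sl
    (le_trans (by omega) (Finset.card_le_card_add_right (N.nonempty_A le_rfl)))
  obtain ⟨K₀, k0c, k0B, k0A, k0s⟩ := exists_isTranslateOf (N.nonempty_B (Nat.zero_le v))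
    (N.nonempty_A (Nat.zero_le u)) (by omega) (by rw [e0]; omega)
  obtain ⟨K₁, k1c, k1B, k1A, k1s⟩ := exists_isTranslateOf (N.nonempty_B (le_refl v))
    (N.nonempty_A (le_refl u)) (by omega) (by rw [el]; omega)
  have hK0 : K₀ ≤ stab (C 0) := by rw [k0s, ← e0]; exact stab_le_stab_add_left _ _
  have hK1 : K₁ ≤ stab (C (u + v)) := by rw [k1s, ← el]; exact stab_le_stab_add_left _ _
  have hK0k := hK0.trans (N.stab_le_ker (N.nonempty_C (Nat.zero_le _)))
  have hK1k := hK1.trans (N.stab_le_ker (N.nonempty_C le_rfl))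
  -- a common period of the first and the last term is a period of all terms
  have hinf : K₀ ⊓ K₁ = ⊥ := by
    apply N.aper
    intro k hk
    rcases Nat.eq_zero_or_pos k with rfl | hpos
    · exact inf_le_left.trans hK0
    rcases hk.lt_or_eq with hlt | rfl
    · exact (inf_le_left.trans hK0k).trans (N.ker_le_stab (hC k hpos hlt))
    · exact inf_le_right.trans hK1
  have hcard := card_mul_card_le_of_inf hK0k hK1k hinf
  obtain ⟨m, hm⟩ : ∃ m, h = 2 * m := ⟨h - (A 0).card, hA0.symm⟩
  have a0 : (A 0).card = m := by clear hA hB hC; omega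
  have au : (A u).card = m := by clear hA hB hC; omega
  have b0 : (B 0).card = m := by clear hA hB hC; omega
  have bv : (B v).card = m := by clear hA hB hC; omega
  have hK0c : Nat.card K₀ = m := k0c.trans b0
  have hK1c : Nat.card K₁ = m := k1c.trans bv
  rw [hK0c, hK1c, N.card_ker, hm] at hcard
  have hm0 : 0 < m := by clear hA hB hC; omega
  have hm2 : m ≤ 2 := Nat.le_of_mul_le_mul_right hcard hm0
  refine Or.inl ⟨hμ, hA, hB, ?_⟩
  rcases (by clear hA hB hC; omega : m = 1 ∨ m = 2) with rfl | rfl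
  · exact Or.inl ⟨hm, a0, au, b0, bv⟩
  · refine Or.inr (Or.inr ⟨K₀, K₁, hK0c, hK1c, ?_, hinf, k0A, k0B, k1A, k1B⟩)
    have hle : K₀ ⊔ K₁ ≤ φ.ker := sup_le hK0k hK1k
    have hfin' : Finite (K₀ ⊔ K₁ : AddSubgroup G) :=
      Finite.of_injective _ (AddSubgroup.inclusion_injective hle)
    have := card_mul_card_le_of_inf (L := K₀ ⊔ K₁) le_sup_left le_sup_right hinf
    rw [hK0c, hK1c] at this
    exact AddSubgroup.eq_of_le_of_card_ge hle (by rw [N.card_ker]; omega)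

/-- A single incomplete coset, at the end: Kneser's theorem applies to the final terms. -/
theorem chainEnd_of_full (N : CosetChain φ h μ u v A B C)
    (hC : ∀ k < u + v, h - (C k).card = 0) : ChainEnd φ.ker h μ u v A B := by
  have hh := N.holes.two_le
  have hsum := N.holes.sum_d
  have hsd : ∑ k ∈ Finset.range (u + v), (h - (C k).card) = 0 :=
    Finset.sum_eq_zero (fun k hk => hC k (Finset.mem_range.1 hk))
  rw [Finset.sum_range_succ, Finset.sum_range_succ, Finset.sum_range_succ, hsd] at hsum
  have hCl : C (u + v) = B v + A u := by
    apply Finset.Subset.antisymm _ (N.sub u le_rfl v le_rfl)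
    intro x hx
    obtain ⟨i, hi, j, hj, hij, hxs⟩ := N.cover _ le_rfl x hx
    obtain rfl : i = u := by omega
    obtain rfl : j = v := by omega
    exact hxs
  have hap : stab (B v + A u) = ⊥ := by
    apply N.aper
    intro k hk
    rw [← hCl]
    rcases hk.lt_or_eq with hlt | rfl
    · exact (N.stab_le_ker (N.nonempty_C le_rfl)).trans (N.ker_le_stab (hC k hlt))
    · exact le_rfl
  have hkn := kneser_of_stab_eq_bot (N.nonempty_B le_rfl) (N.nonempty_A le_rfl) hap
  rw [hCl] at hsum
  have c1 := N.card_A u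
  have c2 := N.card_B v
  have c3 := N.card_C (u + v)
  rw [hCl] at c3
  refine Or.inr ⟨∑ i ∈ Finset.range u, (h - (A i).card) +
    ∑ j ∈ Finset.range v, (h - (B j).card), by omega, by omega, by omega⟩

/-- Up to reversal, every chain has one of the shapes of `ChainEnd`, according to the positions of
the holes of its sum. -/
theorem chainEnd (N : CosetChain φ h μ u v A B C) : ChainEnd φ.ker h μ u v A B ∨
    ChainEnd φ.ker h μ u v (fun i => A (u - i)) (fun j => B (v - j)) := by
  have hu := N.holes.hu
  have hv := N.holes.hv
  have eA := Finset.sum_flip (n := u) (fun i => h - (A i).card)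
  have eB := Finset.sum_flip (n := v) (fun i => h - (B i).card)
  rcases N.holes.classify with ⟨h1, h2, h3, h4, h5, h6, h7, h8⟩ | ⟨h1, h2, h3, h4, h5, h6, h7, h8⟩ |
    ⟨h1, h2, h3, h4, h5, h6, h7, h8, h9, h10⟩ | h1 | h1
  · exact Or.inl (N.chainEnd_of_interior h1 h2 h3 h4 h5 h6 h7 h8)
  · right
    refine N.reverse.chainEnd_of_interior h1 (by rw [eA]; exact h2) (by rw [eB]; exact h3) ?_ ?_
      ?_ ?_ ?_
    · simpa using h4
    · rw [show u - (u - 1) = 1 by omega]; exact h5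
    · simpa using h6
    · rw [show v - (v - 1) = 1 by omega]; exact h7
    · rw [if_pos (by omega), show u + v - (u + v - 1) = 1 by omega]; exact h8
  · exact Or.inl (N.chainEnd_of_ends h1 h2 h3 h4 h5 h6 h7 h8 h9 h10)
  · exact Or.inl (N.chainEnd_of_full h1)
  · right
    apply N.reverse.chainEnd_of_full
    intro k hk
    rw [if_pos hk.le]
    exact h1 _ (by omega) (by omega)

end CosetChain

variable {φ : G →+ Q} {S T : Finset G} {h μ : ℕ}

theorem sum_holes {f : ℕ → ℕ} {h n : ℕ} (hf : ∀ i, f i ≤ h) :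
    ∑ i ∈ Finset.range n, (h - f i) + ∑ i ∈ Finset.range n, f i = h * n := by
  rw [← Finset.sum_add_distrib, Finset.sum_congr rfl (fun i _ => Nat.sub_add_cancel (hf i)),
    Finset.sum_const, Finset.card_range, smul_eq_mul, mul_comm]

theorem card_eq_sum_run {Y : Finset G} {p y : Q} {n : ℕ} (hY : Y.image φ = run p y n)
    (hn : (run p y n).card = n) :
    Y.card = ∑ i ∈ Finset.range n, (fib φ Y (p + i • y)).card := by
  rw [card_eq_sum_fib (φ := φ) hY.subset, run, Finset.sum_image]
  intro i hi j hj hij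
  simp only [Finset.coe_range, Set.mem_Iio] at hi hj
  exact IsRun.injOn hn hi hj hij

/-- If the images of `S` and `T` are progressions with the same difference, and the terms of the sum
of these progressions are distinct, then the fibres form a chain. -/
theorem Config.cosetChain (C : Config φ S T h μ) {p q y : Q} {u v : ℕ}
    (hS : S.image φ = run p y (u + 1)) (hSc : (run p y (u + 1)).card = u + 1)
    (hT : T.image φ = run q y (v + 1)) (hTc : (run q y (v + 1)).card = v + 1)
    (hR : ((T + S).image φ).card = u + v + 1) (hv : 1 ≤ v) :
    CosetChain φ h μ u v (fun i => fib φ S (p + i • y)) (fun j => fib φ T (q + j • y))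
      (fun k => fib φ (T + S) (p + q + k • y)) := by
  have hfin := C.fin
  have hker := C.card_ker
  have hadd : ∀ i j : ℕ, q + j • y + (p + i • y) = p + q + (i + j) • y := by
    intro i j
    rw [add_nsmul]; abel
  have hRrun : (T + S).image φ = run (p + q) y (u + v + 1) := by
    rw [image_add_hom, hS, hT]
    ext z
    rw [Finset.mem_add, mem_run]
    constructor
    · rintro ⟨a, ha, b, hb, rfl⟩
      obtain ⟨j, hj, rfl⟩ := mem_run.1 ha
      obtain ⟨i, hi, rfl⟩ := mem_run.1 hb
      exact ⟨i + j, by omega, (hadd i j).symm⟩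
    · rintro ⟨k, hk, rfl⟩
      obtain ⟨i, j, hi, hj, rfl⟩ := HoleChain.exists_rep (show k ≤ u + v by omega)
      exact ⟨_, mem_run.2 ⟨j, by omega, rfl⟩, _, mem_run.2 ⟨i, by omega, rfl⟩, hadd i j⟩
  have hRc : (run (p + q) y (u + v + 1)).card = u + v + 1 := by rw [← hRrun]; exact hR
  have hSm : ∀ i ≤ u, p + i • y ∈ S.image φ := fun i hi => by
    rw [hS]; exact mem_run.2 ⟨i, by omega, rfl⟩
  have hTm : ∀ j ≤ v, q + j • y ∈ T.image φ := fun j hj => by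
    rw [hT]; exact mem_run.2 ⟨j, by omega, rfl⟩
  have hSle : ∀ i : ℕ, (fib φ S (p + i • y)).card ≤ h := fun i => hker ▸ card_fib_le _ _
  have hTle : ∀ i : ℕ, (fib φ T (q + i • y)).card ≤ h := fun i => hker ▸ card_fib_le _ _
  have hRle : ∀ i : ℕ, (fib φ (T + S) (p + q + i • y)).card ≤ h := fun i => hker ▸ card_fib_le _ _
  have sS := card_eq_sum_run hS hSc
  have sT := card_eq_sum_run hT hTc
  have sR := card_eq_sum_run hRrun hRc
  have oS := sum_holes (n := u + 1) hSle
  have oT := sum_holes (n := v + 1) hTle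
  have oR := sum_holes (n := u + v + 1) hRle
  rw [← sS] at oS
  rw [← sT] at oT
  rw [← sR] at oR
  have hsc : (S.image φ).card = u + 1 := by rw [hS]; exact hSc
  have h1 := C.h_mul_le
  have h2 := C.card
  have h3 := C.card_S
  have h4 := C.card_T
  have h5 := C.card_S_le
  have h6 := C.rigid.two_le
  rw [hsc] at h1 h6
  have hsub : ∀ i j : ℕ, fib φ T (q + j • y) + fib φ S (p + i • y) ⊆
      fib φ (T + S) (p + q + (i + j) • y) := by
    intro i j
    rw [← hadd]
    exact fib_add_subset _ _ _ _
  refine ⟨hfin, hker, ⟨C.two_le, C.hμ, by omega, hv, fun i hi => ?_, fun j hj => ?_,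
    fun i hi j hj => ?_, fun i hi j hj => ?_, fun i hi j hj hne => ?_, fun j hj hb => ?_, ?_, ?_,
    ?_, ?_, ?_⟩, hSle, hTle, hRle, fun i _ j _ => hsub i j, ?_, ?_, ?_⟩
  · have := card_fib_pos (hSm i hi)
    have := hSle i
    omega
  · have := card_fib_pos (hTm j hj)
    have := hTle j
    omega
  · have := card_fib_add_right (φ := φ) (B := S) (q := p + i • y) (hTm j hj)
    rw [hadd] at this
    omega
  · have := card_fib_add_left (φ := φ) (A := T) (p := q + j • y) (hSm i hi)
    rw [hadd] at this
    omega
  · by_contra hlt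
    apply hne
    have h7 := hSle i
    have h8 := hTle j
    have := card_fib_add_of_lt C.surj (A := T) (B := S) (p := q + j • y) (q := p + i • y) (by
      rw [hker]; omega)
    rw [hadd, hker] at this
    omega
  · have h7 := hTle j
    have h8 := C.test_fib (x := q + j • y) (by omega)
    rw [hsc] at h8
    have h9 : (fib φ T (q + j • y) + S).card ≤
        ∑ i ∈ Finset.range (u + 1), (fib φ (T + S) (p + q + (i + j) • y)).card := by
      refine le_trans (Finset.card_le_card ?_) Finset.card_biUnion_le
      intro z hz
      obtain ⟨a, ha, b, hb, rfl⟩ := Finset.mem_add.1 hz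
      have hbm : φ b ∈ run p y (u + 1) := by rw [← hS]; exact Finset.mem_image_of_mem φ hb
      obtain ⟨i, hi, hib⟩ := mem_run.1 hbm
      rw [Finset.mem_biUnion]
      exact ⟨i, Finset.mem_range.2 hi,
        hsub i j (Finset.add_mem_add ha (mem_fib.2 ⟨hb, hib.symm⟩))⟩
    have h10 := sum_holes (n := u + 1)
      (f := fun i => (fib φ (T + S) (p + q + (i + j) • y)).card) (fun i => hRle (i + j))
    omega
  · omega
  · have e : h * (u + v + 1) + h = h * (u + 1) + h * (v + 1) := by ring
    omega
  · omega
  · omega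
  · omega
  · intro k hk x hx
    obtain ⟨hxR, hφx⟩ := mem_fib.1 hx
    obtain ⟨a, ha, b, hb, rfl⟩ := Finset.mem_add.1 hxR
    have ham : φ a ∈ run q y (v + 1) := by rw [← hT]; exact Finset.mem_image_of_mem φ ha
    have hbm : φ b ∈ run p y (u + 1) := by rw [← hS]; exact Finset.mem_image_of_mem φ hb
    obtain ⟨j, hj, hja⟩ := mem_run.1 ham
    obtain ⟨i, hi, hib⟩ := mem_run.1 hbm
    have hij : p + q + (i + j) • y = p + q + k • y := by
      rw [← hφx, map_add, ← hja, ← hib, hadd]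
    have hijk := IsRun.injOn hRc (by omega) (by omega) hij
    exact ⟨i, by omega, j, by omega, hijk,
      Finset.add_mem_add (mem_fib.2 ⟨ha, hja.symm⟩) (mem_fib.2 ⟨hb, hib.symm⟩)⟩
  · intro k x hx x' hx'
    exact (mem_fib.1 hx).2.trans (mem_fib.1 hx').2.symm
  · intro K hK
    rw [eq_bot_iff, ← C.aper]
    intro g hg
    apply mem_stab_of_forall
    intro x hx
    have hxm : φ x ∈ run (p + q) y (u + v + 1) := by
      rw [← hRrun]; exact Finset.mem_image_of_mem φ hx
    obtain ⟨k, hk, hkx⟩ := mem_run.1 hxm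
    exact (mem_fib.1 ((mem_stab.1 (hK k (by omega) hg) x).2 (mem_fib.2 ⟨hx, hkx.symm⟩))).1

end CosetChain

/-! ### The case of two cosets: sets meeting every coset -/

section TwoCosets

variable {G Q : Type*} [AddCommGroup G] [DecidableEq G] [AddCommGroup Q] [DecidableEq Q]
variable {φ : G →+ Q} {S T : Finset G} {h μ : ℕ}

/-- A configuration in which `S` lies in two cosets and `T` meets all cosets. -/
structure TwoCosets (φ : G →+ Q) (S T : Finset G) (h μ : ℕ) (d : Q) : Prop
    extends Config φ S T h μ where
  image_S : S.image φ = {0, d}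
  ne_zero : d ≠ 0
  mem_image_T : ∀ q, q ∈ T.image φ

namespace TwoCosets

variable {d : Q}

theorem finite (C : TwoCosets φ S T h μ d) : Finite Q := by
  apply Set.finite_univ_iff.1
  exact (T.image φ).finite_toSet.subset (fun q _ => C.mem_image_T q)

theorem card_image (C : TwoCosets φ S T h μ d) : (S.image φ).card = 2 := by
  rw [C.image_S, Finset.card_pair C.ne_zero.symm]

theorem zmultiples_eq (C : TwoCosets φ S T h μ d) : AddSubgroup.zmultiples d = ⊤ := by
  rw [eq_top_iff, ← C.rigid.closure_eq, C.image_S, AddSubgroup.closure_le]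
  intro x hx
  rw [Finset.mem_coe, Finset.mem_insert, Finset.mem_singleton] at hx
  rcases hx with rfl | rfl
  · exact zero_mem _
  · exact AddSubgroup.mem_zmultiples x

theorem three_le (C : TwoCosets φ S T h μ d) : 3 ≤ Nat.card Q := by
  have := C.rigid.card_le C.finite
  rw [C.card_image] at this
  omega

theorem card_S_eq (C : TwoCosets φ S T h μ d) :
    S.card = (fib φ S 0).card + (fib φ S d).card := by
  rw [card_eq_sum_fib (φ := φ) C.image_S.subset, Finset.sum_pair C.ne_zero.symm]

theorem S_eq_union (C : TwoCosets φ S T h μ d) : S = fib φ S 0 ∪ fib φ S d := by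
  ext x
  rw [Finset.mem_union, mem_fib, mem_fib]
  constructor
  · intro hx
    have := Finset.mem_image_of_mem φ hx
    rw [C.image_S, Finset.mem_insert, Finset.mem_singleton] at this
    exact this.imp (fun h => ⟨hx, h⟩) (fun h => ⟨hx, h⟩)
  · rintro (h | h) <;> exact h.1

theorem nonempty_zero (C : TwoCosets φ S T h μ d) : (fib φ S 0).Nonempty := by
  rw [fib_nonempty, C.image_S]; simp

theorem nonempty_d (C : TwoCosets φ S T h μ d) : (fib φ S d).Nonempty := by
  rw [fib_nonempty, C.image_S]; simp

theorem nonempty_T (C : TwoCosets φ S T h μ d) (x : Q) : (fib φ T x).Nonempty :=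
  fib_nonempty.2 (C.mem_image_T x)

theorem fib_add_fib_zero_subset (C : TwoCosets φ S T h μ d) (x : Q) :
    fib φ T x + fib φ S 0 ⊆ fib φ (T + S) x := by
  have := fib_add_subset (φ := φ) T S x 0
  rwa [add_zero] at this

theorem fib_add_fib_subset (C : TwoCosets φ S T h μ d) (x : Q) :
    fib φ T x + fib φ S d ⊆ fib φ (T + S) (x + d) := fib_add_subset T S x d

theorem le_rho_zero (C : TwoCosets φ S T h μ d) (x : Q) :
    (fib φ S 0).card ≤ (fib φ (T + S) x).card :=
  (Finset.card_le_card_add_left (C.nonempty_T x)).trans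
    (Finset.card_le_card (C.fib_add_fib_zero_subset x))

theorem le_rho_d (C : TwoCosets φ S T h μ d) (x : Q) :
    (fib φ S d).card ≤ (fib φ (T + S) x).card := by
  have h1 := (Finset.card_le_card_add_left (t := fib φ S d) (C.nonempty_T (x - d))).trans
    (Finset.card_le_card (C.fib_add_fib_subset (x - d)))
  rwa [sub_add_cancel] at h1

/-- The property of the hyper-atom for a fibre of `T`, in terms of the two parts of `S`. -/
theorem test_add (C : TwoCosets φ S T h μ d) {x : Q} (hx : 2 ≤ (fib φ T x).card) :
    (fib φ T x).card + h ≤ (fib φ T x + fib φ S 0).card + (fib φ T x + fib φ S d).card := by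
  have h1 := C.test_fib hx
  rw [C.card_image] at h1
  have h2 : (fib φ T x + S).card ≤
      (fib φ T x + fib φ S 0).card + (fib φ T x + fib φ S d).card := by
    conv_lhs => rw [C.S_eq_union]
    rw [Finset.add_union]
    exact Finset.card_union_le _ _
  omega

/-- A fibre of `T` with at least two elements makes two consecutive fibres of the sumset large. In
names, `tau` refers to the sizes of the fibres of `T`, and `rho` to those of `T + S`. -/
theorem two_le_rho (C : TwoCosets φ S T h μ d) {x : Q} (hx : 2 ≤ (fib φ T x).card) :
    (fib φ T x).card + h ≤ (fib φ (T + S) x).card + (fib φ (T + S) (x + d)).card :=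
  (C.test_add hx).trans (add_le_add (Finset.card_le_card (C.fib_add_fib_zero_subset x))
    (Finset.card_le_card (C.fib_add_fib_subset x)))

theorem card_S_le_rho (C : TwoCosets φ S T h μ d) (x : Q) :
    S.card ≤ (fib φ (T + S) x).card + (fib φ (T + S) (x + d)).card := by
  rw [C.card_S_eq]
  exact add_le_add (C.le_rho_zero x) (C.le_rho_d _)

theorem one_le_tau (C : TwoCosets φ S T h μ d) (x : Q) : 1 ≤ (fib φ T x).card :=
  Finset.card_pos.2 (C.nonempty_T x)

theorem stab_S_eq_bot (C : TwoCosets φ S T h μ d) : stab S = ⊥ := by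
  rw [eq_bot_iff, ← C.aper]
  exact stab_le_stab_add_right T S

section Finite

variable [Fintype Q]

theorem card_T_eq (T : Finset G) : T.card = ∑ x : Q, (fib φ T x).card :=
  card_eq_sum_fib (φ := φ) (Finset.subset_univ _)

theorem sum_rho_shift (R : Finset G) (d : Q) :
    ∑ x : Q, (fib φ R (x + d)).card = R.card := by
  rw [card_T_eq (φ := φ) R]
  exact Equiv.sum_comp (Equiv.addRight d) (fun x => (fib φ R x).card)

theorem mul_le_card (C : TwoCosets φ S T h μ d) {m : ℕ}
    (hm : ∀ x, m ≤ (fib φ (T + S) x).card) : Nat.card Q * m ≤ (T + S).card := by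
  rw [card_T_eq (φ := φ) (T + S), Nat.card_eq_fintype_card, ← Finset.card_univ, ← smul_eq_mul]
  exact Finset.card_nsmul_le_sum _ _ _ (fun x _ => hm x)

theorem eq_of_mul_eq (C : TwoCosets φ S T h μ d) {m : ℕ}
    (hm : ∀ x, m ≤ (fib φ (T + S) x).card) (hc : (T + S).card ≤ Nat.card Q * m) (x : Q) :
    (fib φ (T + S) x).card = m := by
  rw [card_T_eq (φ := φ) (T + S), Nat.card_eq_fintype_card, ← Finset.card_univ, ← smul_eq_mul,
    ← Finset.sum_const] at hc
  have h1 : ∑ x : Q, m = ∑ x : Q, (fib φ (T + S) x).card :=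
    le_antisymm (Finset.sum_le_sum (fun x _ => hm x)) hc
  exact ((Finset.sum_eq_sum_iff_of_le (fun x _ => hm x)).1 h1 x (Finset.mem_univ x)).symm

/-- The bound `3 |T + S| ≤ 2 |G| + 2 μ`, for the smallest fibre of the sumset. -/
theorem three_mul_le (C : TwoCosets φ S T h μ d) {m : ℕ}
    (hm : ∀ x, m ≤ (fib φ (T + S) x).card) : 3 * m ≤ 2 * h := by
  have h1 := C.mul_le_card hm
  have h2 := C.small C.finite
  have h3 := C.three_le
  have h4 := C.hμ
  by_contra hlt
  have h5 : Nat.card Q * (2 * h + 1) ≤ Nat.card Q * (3 * m) :=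
    Nat.mul_le_mul_left _ (by omega)
  have e1 : Nat.card Q * (3 * m) = 3 * (Nat.card Q * m) := by ring
  have e2 : Nat.card Q * (2 * h + 1) = 2 * (h * Nat.card Q) + Nat.card Q := by ring
  omega

/-- `S` has as many elements as one coset. Otherwise summing `two_le_rho` over all cosets shows that
there are at most four cosets, and that all fibres have the same size if there are four. -/
theorem card_S_eq_h (C : TwoCosets φ S T h μ d) : μ = 0 ∧ S.card = h := by
  have hn3 := C.three_le
  have hle := C.h_mul_le
  rw [C.card_image] at hle
  have hsmall := C.small C.finite
  have hcard := C.card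
  have hST := C.card_S_le
  have hS := C.card_S_eq
  have hh := C.two_le
  have hσ0 := C.three_mul_le C.le_rho_zero
  have hσd := C.three_mul_le C.le_rho_d
  by_contra hcon
  have hlt : h + 1 ≤ S.card := by omega
  have hρ : ∀ x ∈ Finset.univ, (fib φ T x).card + h ≤
      (fib φ (T + S) x).card + (fib φ (T + S) (x + d)).card := by
    intro x _
    by_cases hx : 2 ≤ (fib φ T x).card
    · exact C.two_le_rho hx
    · have := C.card_S_le_rho x
      omega
  have hsum := Finset.sum_le_sum hρ
  rw [Finset.sum_add_distrib, Finset.sum_add_distrib, sum_rho_shift, ← card_T_eq, ← card_T_eq,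
    Finset.sum_const, Finset.card_univ, ← Nat.card_eq_fintype_card, smul_eq_mul] at hsum
  have hcomm : Nat.card Q * h = h * Nat.card Q := mul_comm _ _
  have hn4 : Nat.card Q ≤ 4 := by
    by_contra h5
    have : 5 * h ≤ Nat.card Q * h := Nat.mul_le_mul_right h (by omega)
    omega
  rcases (by omega : Nat.card Q = 3 ∨ Nat.card Q = 4) with hn | hn
  · rw [hn] at hsmall hcomm
    omega
  · rw [hn] at hsum hsmall
    refine C.not_equal_fibers (m := (fib φ S 0).card) C.mem_image_T ?_
      (C.eq_of_mul_eq C.le_rho_zero (by rw [hn]; omega))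
    intro i hi
    rw [C.image_S, Finset.mem_insert, Finset.mem_singleton] at hi
    rcases hi with rfl | rfl
    · rfl
    · omega

/-- Two consecutive fibres of the sumset of the least possible size: the two parts of `S` are
translates of each other and have half the size of a coset. -/
theorem half (C : TwoCosets φ S T h 0 d) {x : Q}
    (hx : (fib φ (T + S) x).card + (fib φ (T + S) (x + d)).card ≤ h) :
    ∃ m, h = 2 * m ∧ (fib φ S 0).card = m ∧ (fib φ S d).card = m ∧
      (fib φ (T + S) x).card = m ∧ (fib φ (T + S) (x + d)).card = m ∧
      stab (fib φ S 0) = ⊥ ∧ stab (fib φ S d) = ⊥ := by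
  have hSh := C.card_S_eq_h.2
  have hS := C.card_S_eq
  have h1 := C.le_rho_zero x
  have h2 := C.le_rho_d x
  have h3 := C.le_rho_zero (x + d)
  have h4 := C.le_rho_d (x + d)
  obtain ⟨t, ht⟩ := C.nonempty_T x
  obtain ⟨t', ht'⟩ := C.nonempty_T (x - d)
  -- the fibre over `x` is a translate of both parts of `S`, so these have the same periods, which
  -- are periods of `S`
  have e1 : (fib φ S 0).image (· + t) = fib φ (T + S) x := by
    apply Finset.eq_of_subset_of_card_le
    · intro z hz
      obtain ⟨y, hy, rfl⟩ := Finset.mem_image.1 hz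
      rw [add_comm y t]
      exact C.fib_add_fib_zero_subset x (Finset.add_mem_add ht hy)
    · rw [card_image_add]; omega
  have e2 : (fib φ S d).image (· + t') = fib φ (T + S) x := by
    apply Finset.eq_of_subset_of_card_le
    · intro z hz
      obtain ⟨y, hy, rfl⟩ := Finset.mem_image.1 hz
      rw [add_comm y t']
      have := C.fib_add_fib_subset (x - d) (Finset.add_mem_add ht' hy)
      rwa [sub_add_cancel] at this
    · rw [card_image_add]; omega
  have hst : stab (fib φ S 0) = stab (fib φ S d) := by
    rw [← stab_image_add (fib φ S 0) t, e1, ← e2, stab_image_add]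
  have hbot : stab (fib φ S 0) = ⊥ := by
    rw [eq_bot_iff, ← C.stab_S_eq_bot]
    intro k hk
    apply mem_stab_of_forall
    intro y hy
    rw [C.S_eq_union, Finset.mem_union] at hy ⊢
    rcases hy with hy | hy
    · exact Or.inl ((mem_stab.1 hk y).2 hy)
    · rw [hst] at hk
      exact Or.inr ((mem_stab.1 hk y).2 hy)
  exact ⟨(fib φ S 0).card, by omega, rfl, by omega, by omega, by omega, hbot, hst ▸ hbot⟩

/-- A fibre of the sumset that is only as large as the parts of `S` arises from single elements of
`T`, as the parts of `S` are aperiodic. -/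
theorem tau_of_rho (C : TwoCosets φ S T h 0 d) {m : ℕ} (hA : (fib φ S 0).card = m)
    (hB : (fib φ S d).card = m) (sA : stab (fib φ S 0) = ⊥) (sB : stab (fib φ S d) = ⊥) {z : Q}
    (hz : (fib φ (T + S) z).card = m) :
    (fib φ T z).card = 1 ∧ (fib φ T (z - d)).card = 1 := by
  have key : ∀ X Y : Finset G, Y.card = m → stab Y = ⊥ → X.Nonempty →
      X + Y ⊆ fib φ (T + S) z → X.card = 1 := by
    intro X Y hY hYs hX hsub
    have him : ∀ t ∈ X, Y.image (· + t) = fib φ (T + S) z := by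
      intro t ht
      apply Finset.eq_of_subset_of_card_le
      · intro w hw
        obtain ⟨y, hy, rfl⟩ := Finset.mem_image.1 hw
        rw [add_comm y t]
        exact hsub (Finset.add_mem_add ht hy)
      · rw [card_image_add]; omega
    apply le_antisymm _ (Finset.card_pos.2 hX)
    rw [Finset.card_le_one]
    intro t ht t' ht'
    have : t - t' ∈ stab Y := by
      apply mem_stab_of_forall
      intro y hy
      have : y + t ∈ Y.image (· + t') := by
        rw [him t' ht', ← him t ht]; exact Finset.mem_image_of_mem _ hy
      obtain ⟨y', hy', he⟩ := Finset.mem_image.1 this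
      have : t - t' + y = y' := by rw [sub_add_eq_add_sub, add_comm t y, ← he, add_sub_cancel_right]
      rwa [this]
    rw [hYs, AddSubgroup.mem_bot] at this
    exact sub_eq_zero.1 this
  refine ⟨key _ _ hA sA (C.nonempty_T z) (C.fib_add_fib_zero_subset z),
    key _ _ hB sB (C.nonempty_T _) ?_⟩
  have := C.fib_add_fib_subset (z - d)
  rwa [sub_add_cancel] at this

/-- The arithmetic of `card_eq_three`: there are `n` cosets of `2 m` elements; `u` fibres of the
sumset have the smallest possible size `m`, and `v` of them are followed by another such fibre; `w`
fibres of the first summand are single elements. -/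
theorem half_arith {m n u v w : ℕ} (hm : 2 ≤ m) (hn : 4 ≤ n) (hv : 2 * m * n ≤ 6 * m + 3 * v)
    (hu : v + 1 ≤ u) (hw : 2 * u ≤ w + v) (hwm : w * m ≤ 2 * m + w) (hwn : w ≤ n) :
    m = 2 ∧ n = 4 ∧ w = 4 := by
  obtain ⟨n', rfl⟩ := Nat.exists_eq_add_of_le hn
  have h1 : 2 * m * (4 + n') = 8 * m + 2 * (m * n') := by ring
  have h2 : m * 0 ≤ m * n' := Nat.mul_le_mul_left m (Nat.zero_le _)
  obtain ⟨i, rfl⟩ := Nat.exists_eq_add_of_le (show 3 ≤ w by omega)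
  have h3 : (3 + i) * m = 3 * m + i * m := by ring
  have h4 : i * 2 ≤ i * m := Nat.mul_le_mul_left i hm
  have hm3 : m ≤ 3 := by omega
  rcases (by omega : m = 2 ∨ m = 3) with rfl | rfl <;> omega

/-- The number of cosets is three. Otherwise the sum of the inequalities `two_le_rho` over all
cosets exceeds the size bound, so that some of them fail for single elements of `T`; then two
consecutive fibres of the sumset are translates of the parts of `S`, and `half_arith` leaves only
the case that all fibres of `T + S` have the same size, which is excluded by `not_equal_fibers`. -/
theorem card_eq_three (C : TwoCosets φ S T h 0 d) : Nat.card Q = 3 := by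
  have hn3 := C.three_le
  by_contra hne
  have hSh := C.card_S_eq_h.2
  have hsmall := C.small C.finite
  have hcard := C.card
  have hS3 := C.card_S
  have hcomm : Nat.card Q * h = h * Nat.card Q := mul_comm _ _
  -- the inequality `two_le_rho` can fail, by one, only for the indices in `V`
  set V : Finset Q := Finset.univ.filter
    (fun x => (fib φ (T + S) x).card + (fib φ (T + S) (x + d)).card = h) with hV
  have hρ : ∀ x ∈ Finset.univ, (fib φ T x).card + h ≤
      (fib φ (T + S) x).card + (fib φ (T + S) (x + d)).card +
        (if (fib φ (T + S) x).card + (fib φ (T + S) (x + d)).card = h then 1 else 0) := by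
    intro x _
    by_cases hx : 2 ≤ (fib φ T x).card
    · exact (C.two_le_rho hx).trans (Nat.le_add_right _ _)
    · have := C.card_S_le_rho x
      split_ifs <;> omega
  have hsum := Finset.sum_le_sum hρ
  rw [Finset.sum_add_distrib, Finset.sum_add_distrib, Finset.sum_add_distrib, sum_rho_shift,
    ← card_T_eq, ← card_T_eq, Finset.sum_const, Finset.card_univ, ← Nat.card_eq_fintype_card,
    smul_eq_mul, ← Finset.card_filter, ← hV] at hsum
  have hVne : V.Nonempty := by
    rw [← Finset.card_pos]
    by_contra hv
    have : 4 * h ≤ Nat.card Q * h := Nat.mul_le_mul_right h (by omega)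
    have := C.two_le
    omega
  obtain ⟨x, hx⟩ := hVne
  obtain ⟨m, hm, hA, hB, _, _, sA, sB⟩ := C.half (Finset.mem_filter.1 hx).2.le
  have hmρ : ∀ z, m ≤ (fib φ (T + S) z).card := fun z => hA ▸ C.le_rho_zero z
  have hnot : ¬ ∀ z, (fib φ (T + S) z).card = m := by
    intro hall
    refine C.not_equal_fibers C.mem_image_T ?_ hall
    intro i hi
    rw [C.image_S, Finset.mem_insert, Finset.mem_singleton] at hi
    rcases hi with rfl | rfl <;> assumption
  -- `U` is the set of the smallest fibres of the sumset, and `V = U ∩ (U - d)`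
  set U : Finset Q := Finset.univ.filter (fun z => (fib φ (T + S) z).card = m) with hU
  have hUm : ∀ z, z ∈ U ↔ (fib φ (T + S) z).card = m := fun z => by simp [hU]
  have hVm : ∀ z, z ∈ V ↔ z ∈ U ∧ z + d ∈ U := by
    intro z
    rw [hUm, hUm, hV, Finset.mem_filter]
    have h1 := hmρ z
    have h2 := hmρ (z + d)
    constructor
    · rintro ⟨_, h3⟩; omega
    · rintro ⟨h3, h4⟩; exact ⟨Finset.mem_univ z, by omega⟩
  -- `U` is not all of the cyclic group generated by `d`, so it does not consist of the indices in
  -- `V` only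
  have hVU : V.card + 1 ≤ U.card := by
    apply Finset.card_lt_card
    refine Finset.ssubset_iff_subset_ne.2 ⟨fun z hz => ((hVm z).1 hz).1, fun he => hnot ?_⟩
    have hxU : x ∈ U := ((hVm x).1 hx).1
    have := mem_of_forall_add_mem C.zmultiples_eq ⟨x, hxU⟩
      (fun z hz => ((hVm z).1 (he ▸ hz)).2)
    exact fun z => (hUm z).1 (this z)
  -- by `tau_of_rho`, the fibres of `T` over `U ∪ (U - d)` are single elements
  set W : Finset Q := Finset.univ.filter (fun z => (fib φ T z).card = 1) with hW
  have hUW : U ∪ U.image (· + -d) ⊆ W := by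
    intro z hz
    rw [hW, Finset.mem_filter]
    refine ⟨Finset.mem_univ z, ?_⟩
    rcases Finset.mem_union.1 hz with hz | hz
    · exact (C.tau_of_rho hA hB sA sB ((hUm z).1 hz)).1
    · obtain ⟨y, hy, rfl⟩ := Finset.mem_image.1 hz
      have := (C.tau_of_rho hA hB sA sB ((hUm y).1 hy)).2
      rwa [sub_eq_add_neg] at this
  have hUVW : 2 * U.card ≤ W.card + V.card := by
    have h1 := Finset.card_le_card hUW
    have h2 := Finset.card_union_add_card_inter U (U.image (· + -d))
    rw [card_image_add] at h2
    have h3 : U ∩ U.image (· + -d) ⊆ V := by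
      intro z hz
      obtain ⟨hz1, hz2⟩ := Finset.mem_inter.1 hz
      obtain ⟨y, hy, rfl⟩ := Finset.mem_image.1 hz2
      rw [hVm]
      exact ⟨hz1, by rwa [neg_add_cancel_right]⟩
    have h4 := Finset.card_le_card h3
    omega
  -- each fibre of `T + S` has at least `m` elements and at least as many as that of `T`, while
  -- `|T + S| = |T| + 2 m`
  have hWm : W.card * m ≤ 2 * m + W.card := by
    have h1 : ∀ z ∈ Finset.univ, (fib φ T z).card + (if (fib φ T z).card = 1 then m else 0) ≤
        (fib φ (T + S) z).card + (if (fib φ T z).card = 1 then 1 else 0) := by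
      intro z _
      have h2 := hmρ z
      have h3 := (Finset.card_le_card_add_right (s := fib φ T z) C.nonempty_zero).trans
        (Finset.card_le_card (C.fib_add_fib_zero_subset z))
      split_ifs with hz <;> omega
    have h2 := Finset.sum_le_sum h1
    rw [Finset.sum_add_distrib, Finset.sum_add_distrib, ← card_T_eq, ← card_T_eq,
      ← Finset.card_filter, ← Finset.sum_filter, Finset.sum_const, ← hW, smul_eq_mul] at h2
    omega
  have hWn : W.card ≤ Nat.card Q := by
    rw [Nat.card_eq_fintype_card]; exact Finset.card_le_univ _
  obtain ⟨hm2, hn4, hw4⟩ := half_arith (m := m) (n := Nat.card Q) (u := U.card) (v := V.card)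
    (w := W.card) (by omega) (by omega) (by rw [← hm]; omega) hVU hUVW hWm hWn
  apply hnot
  have hWu : W = Finset.univ := by
    apply Finset.eq_univ_of_card
    rw [← Nat.card_eq_fintype_card, hw4, hn4]
  have hT4 : T.card = 4 := by
    have h1 : ∀ z ∈ Finset.univ, (fib φ T z).card = 1 := fun z _ => by
      have : z ∈ W := by rw [hWu]; exact Finset.mem_univ z
      exact (Finset.mem_filter.1 this).2
    rw [card_T_eq (φ := φ) T, Finset.sum_congr rfl h1, Finset.sum_const, Finset.card_univ,
      ← Nat.card_eq_fintype_card, hn4]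
    rfl
  exact C.eq_of_mul_eq hmρ (by rw [hn4]; omega)

end Finite

end TwoCosets

/-- The situation of `TwoCosets` with exactly three cosets. Then all inequalities are equalities:
`S` and `T` have `h` elements, and so have each fibre of `T + S` and the next fibre of `T`
together. -/
structure ThreeCosets (φ : G →+ Q) (S T : Finset G) (h : ℕ) (d : Q) : Prop
    extends TwoCosets φ S T h 0 d where
  eq_or : ∀ x z : Q, z = x ∨ z = x + d ∨ z = x + d + d
  three_d : d + d + d = 0
  card_Q : Nat.card Q = 3
  S_card : S.card = h
  T_card : T.card = h
  rho_add : ∀ x, (fib φ (T + S) x).card + (fib φ T (x + d)).card = h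
  tau_add : ∀ x, (fib φ T x).card + (fib φ T (x + d)).card + (fib φ T (x + d + d)).card = h

theorem TwoCosets.threeCosets {d : Q} (C : TwoCosets φ S T h 0 d) : ThreeCosets φ S T h d := by
  have hQ := C.finite
  have := Fintype.ofFinite Q
  have hn := C.card_eq_three
  have hcardQ : Fintype.card Q = 3 := by rw [← Nat.card_eq_fintype_card, hn]
  have hord : addOrderOf d = 3 := by
    rw [← Nat.card_zmultiples, C.zmultiples_eq, AddSubgroup.card_top, hn]
  have h3d : d + d + d = 0 := by
    have := addOrderOf_nsmul_eq_zero d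
    rw [hord] at this
    rw [← this, succ_nsmul, two_nsmul]
  have h2d : d + d ≠ 0 := by
    intro h2
    rw [h2, zero_add] at h3d
    exact C.ne_zero h3d
  have huniv : ∀ x : Q, (Finset.univ : Finset Q) = {x, x + d, x + d + d} := by
    intro x
    symm
    apply Finset.eq_univ_of_card
    rw [hcardQ, Finset.card_eq_three]
    refine ⟨x, x + d, x + d + d, ?_, ?_, ?_, rfl⟩
    · simpa using C.ne_zero
    · rw [add_assoc]; simpa using h2d
    · simpa using C.ne_zero
  have hsum : ∀ (f : Q → ℕ) (x : Q), ∑ z : Q, f z = f x + f (x + d) + f (x + d + d) := by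
    intro f x
    have h1 : x ∉ ({x + d, x + d + d} : Finset Q) := by
      rw [Finset.mem_insert, Finset.mem_singleton, add_assoc]
      simpa using ⟨C.ne_zero, h2d⟩
    have h2 : x + d ≠ x + d + d := by simpa using C.ne_zero
    rw [huniv x, Finset.sum_insert h1, Finset.sum_pair h2, ← add_assoc (f x)]
  have heq : ∀ x z : Q, z = x ∨ z = x + d ∨ z = x + d + d := by
    intro x z
    have : z ∈ (Finset.univ : Finset Q) := Finset.mem_univ z
    rw [huniv x] at this
    simpa using this
  have hSh := C.card_S_eq_h.2
  have hsmall := C.small C.finite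
  rw [hn] at hsmall
  have hcard := C.card
  have hST := C.card_S_le
  have hT4 := C.card_T
  have hTh : T.card = h := by omega
  have hRh : (T + S).card = 2 * h := by omega
  -- if `two_le_rho` failed for a single element, then all three fibres of `T` would be single
  -- elements, but `|T| ≥ 4`
  have hρ : ∀ x ∈ Finset.univ, (fib φ T x).card + h ≤
      (fib φ (T + S) x).card + (fib φ (T + S) (x + d)).card := by
    intro x _
    by_cases hx : 2 ≤ (fib φ T x).card
    · exact C.two_le_rho hx
    by_contra hlt
    obtain ⟨m, _, hA, hB, h1, h2, sA, sB⟩ := C.half (x := x) (by omega)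
    obtain ⟨t1, t2⟩ := C.tau_of_rho hA hB sA sB h1
    obtain ⟨t3, _⟩ := C.tau_of_rho hA hB sA sB h2
    have h4 := TwoCosets.card_T_eq (φ := φ) T
    rw [hsum _ x] at h4
    have e : x + d + d = x - d := by
      rw [eq_sub_iff_add_eq, add_assoc, add_assoc, ← add_assoc d d d, h3d, add_zero]
    rw [e, t1, t2, t3] at h4
    omega
  have hsumρ : ∑ x : Q, ((fib φ T x).card + h) =
      ∑ x : Q, ((fib φ (T + S) x).card + (fib φ (T + S) (x + d)).card) := by
    rw [Finset.sum_add_distrib, Finset.sum_add_distrib, TwoCosets.sum_rho_shift,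
      ← TwoCosets.card_T_eq, ← TwoCosets.card_T_eq, Finset.sum_const, Finset.card_univ, hcardQ,
      smul_eq_mul]
    omega
  have hρeq := (Finset.sum_eq_sum_iff_of_le hρ).1 hsumρ
  refine ⟨C, heq, h3d, hn, hSh, hTh, fun x => ?_, fun x => ?_⟩
  · have h1 := hρeq (x + d) (Finset.mem_univ _)
    have h2 := TwoCosets.card_T_eq (φ := φ) (T + S)
    rw [hsum _ x] at h2
    omega
  · rw [← hTh, TwoCosets.card_T_eq (φ := φ) T, hsum _ x]

end TwoCosets

/-! ### Stabilizers and divisibility -/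

section Stabilizers

variable {G Q : Type*} [AddCommGroup G] [DecidableEq G] [AddCommGroup Q] [DecidableEq Q]

theorem card_dvd_of_le_stab {C : Finset G} {K : AddSubgroup G} [Finite K] (hK : K ≤ stab C) :
    Nat.card K ∣ C.card := by
  classical
  set φ := QuotientAddGroup.mk' K with hφ
  have hker : φ.ker = K := QuotientAddGroup.ker_mk' K
  have : Finite φ.ker := by rw [hker]; infer_instance
  have hC : C = pre φ (C.image φ) := by
    ext x
    rw [mem_pre, Finset.mem_image]
    constructor
    · exact fun hx => ⟨x, hx, rfl⟩
    · rintro ⟨y, hy, he⟩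
      have h1 : x - y ∈ K := by
        rw [← hker, AddMonoidHom.mem_ker, map_sub, he, sub_self]
      have := (mem_stab.1 (hK h1) y).2 hy
      rwa [sub_add_cancel] at this
  rw [hC, card_pre (QuotientAddGroup.mk'_surjective K), hker]
  exact dvd_mul_right _ _

/-- Kneser's theorem with a name for the stabilizer, which avoids rewriting in the type of its
finiteness. -/
theorem kneser_of_stab_eq {A B : Finset G} (hA : A.Nonempty) (hB : B.Nonempty) {K : AddSubgroup G}
    [Finite K] (hK : stab (A + B) = K) :
    (A + elts K).card + (B + elts K).card ≤ (A + B).card + Nat.card K := by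
  subst hK
  exact kneser hA hB

theorem stab_le_ker {φ : G →+ Q} {C : Finset G} {q : Q} (hC : C.Nonempty)
    (h : ∀ x ∈ C, φ x = q) : stab C ≤ φ.ker := by
  intro k hk
  obtain ⟨x, hx⟩ := hC
  have h1 := h _ ((mem_stab.1 hk x).2 hx)
  rw [map_add, h x hx] at h1
  rw [AddMonoidHom.mem_ker]
  simpa using h1

theorem le_stab_of_card_add_elts {C : Finset G} {K : AddSubgroup G} [Finite K]
    (h : (C + elts K).card ≤ C.card) : K ≤ stab C := by
  rw [Finset.eq_of_subset_of_card_le (subset_add_elts C K) h]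
  exact le_stab_add_elts C K

/-- In a finite group, `X` is admissible as soon as `X + S` has at most `|G| - 2` elements. -/
theorem adm_of_card [Finite G] {S X : Finset G} (hX : 2 ≤ X.card)
    (h : (X + S).card + 2 ≤ Nat.card G) : Adm S X := by
  have := Fintype.ofFinite G
  have h1 : 1 < (X + S)ᶜ.card := by
    rw [Finset.card_compl, ← Nat.card_eq_fintype_card]; omega
  obtain ⟨z, hz, w, hw, hzw⟩ := Finset.one_lt_card.1 h1
  exact ⟨hX, z, w, hzw, Finset.mem_compl.1 hz, Finset.mem_compl.1 hw⟩

/-- Let `X + A` lie in a coset of `ker φ` and have only one element more than `X`, without being the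
whole coset. Then `A` has at most two elements, or it fills at most one coset of the stabilizer of
`X + A`, which is a proper subgroup of `ker φ`. -/
theorem two_mul_card_le_of_card_add {φ : G →+ Q} {X A : Finset G} {q : Q} [Finite φ.ker]
    (hX : X.Nonempty) (hA : A.Nonempty) (hq : ∀ x ∈ X + A, φ x = q)
    (hc : (X + A).card = X.card + 1) (hlt : X.card + 1 < Nat.card φ.ker) :
    A.card ≤ 2 ∨ 2 * A.card < Nat.card φ.ker ∨
      (2 * A.card = Nat.card φ.ker ∧ 2 * (X.card + 1) = Nat.card φ.ker) := by
  have hne := hX.add hA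
  -- for the stabilizer `K` of `X + A`, Kneser's theorem bounds the number `l` of `K`-cosets met by
  -- `A` by one, unless `K` is trivial; `j` is the index of `K` in `ker φ`, and `i` the number of
  -- `K`-cosets in `X + A`
  obtain ⟨K, hK⟩ : ∃ K, stab (X + A) = K := ⟨_, rfl⟩
  have hfin : Finite K := hK ▸ finite_stab hne
  have hk := kneser_of_stab_eq hX hA hK
  have hXK := Finset.card_le_card (subset_add_elts X K)
  have hAK := Finset.card_le_card (subset_add_elts A K)
  have hKpos : 0 < Nat.card K := Nat.card_pos
  have hd1 : Nat.card K ∣ X.card + 1 := hc ▸ card_dvd_of_le_stab hK.ge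
  have hd2 : Nat.card K ∣ Nat.card φ.ker := AddSubgroup.card_dvd_of_le (hK ▸ stab_le_ker hne hq)
  have hd3 : Nat.card K ∣ (A + elts K).card := card_dvd_of_le_stab (le_stab_add_elts A K)
  by_cases h1 : Nat.card K = 1
  · left; omega
  right
  obtain ⟨i, hi⟩ := hd1
  obtain ⟨j, hj⟩ := hd2
  obtain ⟨l, hl⟩ := hd3
  have hl1 : l ≤ 1 := by
    by_contra hl2
    have : Nat.card K * 2 ≤ Nat.card K * l := Nat.mul_le_mul_left _ (by omega)
    omega
  have hlK : Nat.card K * l ≤ Nat.card K := by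
    calc _ ≤ Nat.card K * 1 := Nat.mul_le_mul_left _ hl1
      _ = _ := mul_one _
  rw [hi, hj] at hlt
  have hij := lt_of_mul_lt_mul_left hlt (Nat.zero_le _)
  have hi1 : 1 ≤ i := by
    by_contra h0
    obtain rfl : i = 0 := by omega
    omega
  rcases (by omega : j = 2 ∨ 3 ≤ j) with rfl | hj3
  · obtain rfl : i = 1 := by omega
    omega
  · left
    have : Nat.card K * 3 ≤ Nat.card K * j := Nat.mul_le_mul_left _ hj3
    omega

end Stabilizers

/-! ### Three cosets and the cyclic group of order twelve -/

namespace ThreeCosets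

variable {G Q : Type*} [AddCommGroup G] [DecidableEq G] [AddCommGroup Q] [DecidableEq Q]
variable {φ : G →+ Q} {S T : Finset G} {h : ℕ} {d : Q}

theorem add_three (C : ThreeCosets φ S T h d) (x : Q) : x + d + d + d = x := by
  rw [add_assoc, add_assoc, ← add_assoc d d d, C.three_d, add_zero]

theorem forall_iff (C : ThreeCosets φ S T h d) (x : Q) {p : Q → Prop} (h1 : p x)
    (h2 : p (x + d)) (h3 : p (x + d + d)) (z : Q) : p z := by
  rcases C.eq_or x z with rfl | rfl | rfl <;> assumption

/-- Over a fibre of `T` with at least two elements, both sums with the parts of `S` are whole fibres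
of the sumset: the equalities of `ThreeCosets` leave no room in `test_add`. -/
theorem fib_add_eq (C : ThreeCosets φ S T h d) {x : Q} (hx : 2 ≤ (fib φ T x).card) :
    fib φ T x + fib φ S 0 = fib φ (T + S) x ∧ fib φ T x + fib φ S d = fib φ (T + S) (x + d) := by
  have h1 := C.test_add hx
  have h2 := C.rho_add x
  have h3 := C.rho_add (x + d)
  have h4 := C.tau_add x
  have h5 := Finset.card_le_card (C.fib_add_fib_zero_subset x)
  have h6 := Finset.card_le_card (C.fib_add_fib_subset x)
  exact ⟨Finset.eq_of_subset_of_card_le (C.fib_add_fib_zero_subset x) (by omega),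
    Finset.eq_of_subset_of_card_le (C.fib_add_fib_subset x) (by omega)⟩

theorem stab_fib_le (C : ThreeCosets φ S T h d) (x : Q) : stab (fib φ (T + S) x) ≤ φ.ker :=
  stab_le_ker (((C.nonempty_T x).add C.nonempty_zero).mono (C.fib_add_fib_zero_subset x))
    (fun _ hy => (mem_fib.1 hy).2)

/-- If all fibres of `T` have at least two elements, a period of one fibre of the sumset is a
period of the next one. -/
theorem stab_le_stab (C : ThreeCosets φ S T h d) (h2 : ∀ x, 2 ≤ (fib φ T x).card) {x : Q}
    (hx : stab (fib φ (T + S) x) ≠ ⊥) :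
    stab (fib φ (T + S) x) ≤ stab (fib φ (T + S) (x + d)) := by
  have hne : (fib φ (T + S) x).Nonempty :=
    ((C.nonempty_T x).add C.nonempty_zero).mono (C.fib_add_fib_zero_subset x)
  obtain ⟨L, hL⟩ : ∃ L, stab (fib φ (T + S) x) = L := ⟨_, rfl⟩
  have hfin : Finite L := hL ▸ finite_stab hne
  have e1 := (C.fib_add_eq (h2 x)).1
  have e2 := (C.fib_add_eq (h2 (x + d + d))).2
  rw [C.add_three] at e2
  have k1 := kneser_of_stab_eq (C.nonempty_T x) C.nonempty_zero (by rw [e1, hL])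
  have k2 := kneser_of_stab_eq (C.nonempty_T (x + d + d)) C.nonempty_d (by rw [e2, hL])
  rw [e1] at k1
  rw [e2] at k2
  rw [hL] at hx ⊢
  have hLker : L ≤ φ.ker := hL ▸ C.stab_fib_le x
  have hfk := C.fin
  -- the definition of the connectivity, applied to `L`
  have htest : Nat.card L + h ≤ (fib φ S 0 + elts L).card + (fib φ S d + elts L).card := by
    have hL2 : 2 ≤ (elts L).card := by
      rw [card_elts]
      have h0 : 0 < Nat.card L := Nat.card_pos
      have h1 : Nat.card L ≠ 1 := fun h1 => hx (AddSubgroup.card_eq_one.1 h1)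
      omega
    have hadm : Adm S (elts L) := by
      obtain ⟨w, hw⟩ := C.surj (d + d)
      have hout : ∀ k ∈ φ.ker, w + k ∉ elts L + S := by
        intro k hk hmem
        obtain ⟨l, hl, s, hs, he⟩ := Finset.mem_add.1 hmem
        have h1 : φ s = d + d := by
          have := congrArg φ he
          rw [map_add, map_add, AddMonoidHom.mem_ker.1 hk, AddMonoidHom.mem_ker.1
            (hLker (mem_elts.1 hl)), zero_add, add_zero, hw] at this
          exact this
        have h2 := Finset.mem_image_of_mem φ hs
        rw [C.image_S, h1, Finset.mem_insert, Finset.mem_singleton] at h2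
        rcases h2 with h2 | h2
        · have := C.three_d
          rw [h2, zero_add] at this
          exact C.ne_zero this
        · exact C.ne_zero (by simpa using h2)
      obtain ⟨z, hz, w', hw', hzw⟩ := Finset.one_lt_card.1
        (show 1 < (elts φ.ker).card by rw [card_elts, C.card_ker]; exact C.two_le)
      exact ⟨hL2, w + z, w + w', fun he => hzw (add_left_cancel he), hout _ (mem_elts.1 hz),
        hout _ (mem_elts.1 hw')⟩
    have h1 := C.test _ hadm
    rw [C.card_image, card_elts] at h1
    have h3 : (elts L + S).card ≤ (fib φ S 0 + elts L).card + (fib φ S d + elts L).card := by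
      conv_lhs => rw [C.S_eq_union]
      rw [Finset.add_union, add_comm (elts L), add_comm (elts L)]
      exact Finset.card_union_le _ _
    omega
  have hdvd : Nat.card L ∣ (fib φ T (x + d)).card := by
    have h1 : Nat.card L ∣ (fib φ (T + S) x).card + (fib φ T (x + d)).card := by
      rw [C.rho_add x, ← C.card_ker]
      exact AddSubgroup.card_dvd_of_le hLker
    exact (Nat.dvd_add_right (card_dvd_of_le_stab hL.ge)).1 h1
  -- the size of the fibre of `T` over `x + d` is a multiple of `|L|`, hence at least `|L|`
  have hle : Nat.card L ≤ (fib φ T (x + d)).card :=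
    Nat.le_of_dvd (Finset.card_pos.2 (C.nonempty_T _)) hdvd
  have t1 := Finset.card_le_card (subset_add_elts (fib φ T x) L)
  have t2 := Finset.card_le_card (subset_add_elts (fib φ T (x + d + d)) L)
  have t3 := C.rho_add x
  have t4 := C.tau_add x
  have hper : L ≤ stab (fib φ T x) := le_stab_of_card_add_elts (by omega)
  refine hper.trans ?_
  rw [← (C.fib_add_eq (h2 x)).2]
  exact stab_le_stab_add_left _ _

/-- By `stab_le_stab`, a period of one fibre of the sumset would be a period of all of them, and
hence of `T + S`. -/
theorem stab_fib_eq_bot (C : ThreeCosets φ S T h d) (h2 : ∀ x, 2 ≤ (fib φ T x).card) (x : Q) :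
    stab (fib φ (T + S) x) = ⊥ := by
  by_contra hx
  have l1 := C.stab_le_stab h2 hx
  have l2 := C.stab_le_stab h2 (x := x + d) (fun h0 => hx (eq_bot_iff.2 (h0 ▸ l1)))
  apply hx
  rw [eq_bot_iff, ← C.aper]
  intro k hk
  have hall : ∀ z, k ∈ stab (fib φ (T + S) z) :=
    C.forall_iff x hk (l1 hk) (l2 (l1 hk))
  apply mem_stab_of_forall
  intro y hy
  exact (mem_fib.1 ((mem_stab.1 (hall (φ y)) y).2 (mem_fib.2 ⟨hy, rfl⟩))).1

/-- A three-element set is a progression with difference `g` if its sum with `{t, t + g}` is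
aperiodic and has only four elements. -/
theorem eq_run_three {A : Finset G} {t g : G} (hg : g ≠ 0) (hA : A.card = 3)
    (hc : (({t, t + g} : Finset G) + A).card = 4) (hs : stab (({t, t + g} : Finset G) + A) = ⊥) :
    ∃ u, A = {u, u + g, u + g + g} := by
  have hgg : g + g ≠ 0 := by
    intro h0
    have : g ∈ stab (({t, t + g} : Finset G) + A) := by
      apply stab_le_stab_add_left
      apply mem_stab_of_forall
      intro x hx
      rw [Finset.mem_insert, Finset.mem_singleton] at hx ⊢
      rcases hx with rfl | rfl
      · right; abel
      · left; rw [add_left_comm, h0, add_zero]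
    rw [hs] at this
    exact hg (AddSubgroup.mem_bot.1 this)
  have hsd : ((A.image (· + g)) \ A).card = 1 := by
    have e : ({t, t + g} : Finset G) + A = (A ∪ A.image (· + g)).image (· + t) := by
      ext z
      simp only [Finset.mem_add, Finset.mem_image, Finset.mem_union, Finset.mem_insert,
        Finset.mem_singleton]
      constructor
      · rintro ⟨_, rfl | rfl, a, ha, rfl⟩
        · exact ⟨a, Or.inl ha, add_comm _ _⟩
        · exact ⟨a + g, Or.inr ⟨a, ha, rfl⟩, by abel⟩
      · rintro ⟨_, ha | ⟨a, ha, rfl⟩, rfl⟩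
        · exact ⟨t, Or.inl rfl, _, ha, add_comm _ _⟩
        · exact ⟨t + g, Or.inr rfl, a, ha, by abel⟩
    rw [e, card_image_add, ← Finset.union_sdiff_self_eq_union,
      Finset.card_union_of_disjoint Finset.disjoint_sdiff] at hc
    omega
  obtain ⟨P, X₀, hP, hdisj, hPne, ⟨p, hrun⟩, hinv⟩ := exists_run_of_card_sdiff hsd
  have hcard : P.card + X₀.card = 3 := by
    rw [← Finset.card_union_of_disjoint hdisj, ← hP, hA]
  rcases X₀.eq_empty_or_nonempty with h0 | ⟨x, hx⟩
  · rw [h0, Finset.card_empty] at hcard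
    rw [h0, Finset.union_empty] at hP
    refine ⟨p, ?_⟩
    rw [add_zero] at hcard
    rw [hP, hrun, hcard]
    ext z
    simp only [mem_run, Finset.mem_insert, Finset.mem_singleton]
    constructor
    · rintro ⟨i, hi, rfl⟩
      interval_cases i
      · simp
      · simp
      · simp [two_nsmul, add_assoc]
    · rintro (rfl | rfl | rfl)
      · exact ⟨0, by omega, by simp⟩
      · exact ⟨1, by omega, by simp⟩
      · exact ⟨2, by omega, by simp [two_nsmul, add_assoc]⟩
  · exfalso
    have h3 : ({x, x + g, x + g + g} : Finset G).card = 3 := by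
      rw [Finset.card_eq_three]
      refine ⟨_, _, _, ?_, ?_, ?_, rfl⟩
      · simpa using hg
      · rw [add_assoc]; simpa using hgg
      · simpa using hg
    have hsub : ({x, x + g, x + g + g} : Finset G) ⊆ X₀ := by
      intro z hz
      simp only [Finset.mem_insert, Finset.mem_singleton] at hz
      rcases hz with rfl | rfl | rfl
      · exact hx
      · exact hinv _ hx
      · exact hinv _ (hinv _ hx)
    have := Finset.card_le_card hsub
    have := Finset.card_pos.2 hPne
    omega

/-- Two representations of a four-term progression as the sum of a three-term and a two-term
progression are translates of each other. -/
theorem pair_eq_of_add_eq {X R : Finset G} {t u v g : G} (hs : stab R = ⊥) (hR : R.card = 4)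
    (hX : X.card = 2) (h1 : ({t, t + g} : Finset G) + {u, u + g, u + g + g} = R)
    (h2 : X + {v, v + g, v + g + g} = R) : X = {t + (u - v), t + (u - v) + g} := by
  set e := t + u with he
  have hRe : R = {e, e + g, e + g + g, e + g + g + g} := by
    rw [← h1]
    ext z
    simp only [Finset.mem_add, Finset.mem_insert, Finset.mem_singleton, he]
    constructor
    · rintro ⟨_, rfl | rfl, _, rfl | rfl | rfl, rfl⟩
      · left; rfl
      · right; left; abel
      · right; right; left; abel
      · right; left; abel
      · right; right; left; abel
      · right; right; right; abel
    · rintro (rfl | rfl | rfl | rfl)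
      · exact ⟨t, Or.inl rfl, u, Or.inl rfl, rfl⟩
      · exact ⟨t, Or.inl rfl, _, Or.inr (Or.inl rfl), by abel⟩
      · exact ⟨t, Or.inl rfl, _, Or.inr (Or.inr rfl), by abel⟩
      · exact ⟨t + g, Or.inr rfl, _, Or.inr (Or.inr rfl), by abel⟩
  -- the progression does not close up
  have hout : e + g + g + g + g ∉ R := by
    intro hmem
    have hg : g ∈ stab R := by
      apply le_stab_of_add_mem
      intro x hx
      rw [hRe] at hx
      simp only [Finset.mem_insert, Finset.mem_singleton] at hx
      rcases hx with rfl | rfl | rfl | rfl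
      · rw [hRe]; simp
      · rw [hRe]; simp
      · rw [hRe]; simp
      · exact hmem
    rw [hs, AddSubgroup.mem_bot] at hg
    rw [hRe, hg] at hR
    simp at hR
  have hne : ∀ x ∈ X, x + v = e ∨ x + v = e + g := by
    intro x hx
    have m0 : x + v ∈ R := by rw [← h2]; exact Finset.add_mem_add hx (by simp)
    have m2 : x + (v + g + g) ∈ R := by rw [← h2]; exact Finset.add_mem_add hx (by simp)
    have m1 : x + (v + g) ∈ R := by rw [← h2]; exact Finset.add_mem_add hx (by simp)
    rw [hRe] at m0
    simp only [Finset.mem_insert, Finset.mem_singleton] at m0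
    rcases m0 with h | h | h | h
    · exact Or.inl h
    · exact Or.inr h
    · exfalso; apply hout
      rw [show e + g + g + g + g = x + (v + g + g) by rw [← h]; abel]
      exact m2
    · exfalso; apply hout
      rw [show e + g + g + g + g = x + (v + g) by rw [← h]; abel]
      exact m1
  apply Finset.eq_of_subset_of_card_le
  · intro x hx
    rw [Finset.mem_insert, Finset.mem_singleton]
    rcases hne x hx with h | h
    · left; rw [← add_sub_assoc, eq_sub_iff_add_eq, h]
    · right
      rw [← add_sub_assoc, sub_add_eq_add_sub, eq_sub_iff_add_eq, h]
  · rw [hX]; exact Finset.card_le_two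

/-- Some fibre of `T` is a single element. Otherwise all the fibres of the sumset are aperiodic, and
Kneser's theorem shows that `h = 6`, that the fibres of `T` are pairs with a common difference, and
that the parts of `S` are progressions `u, u + g, u + 2 g` and `v, v + g, v + 2 g`. But then `u - v`
is a period of `T`. -/
theorem exists_card_eq_one (C : ThreeCosets φ S T h d) : ∃ x, (fib φ T x).card = 1 := by
  by_contra hcon
  push Not at hcon
  have h2 : ∀ x, 2 ≤ (fib φ T x).card := by
    intro x
    have := C.one_le_tau x
    have := hcon x
    omega
  have hbot := C.stab_fib_eq_bot h2
  have hSS := C.card_S_eq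
  have hSh := C.S_card
  have hk : ∀ x, (fib φ T x).card + (fib φ S 0).card ≤ (fib φ (T + S) x).card + 1 ∧
      (fib φ T x).card + (fib φ S d).card ≤ (fib φ (T + S) (x + d)).card + 1 := by
    intro x
    obtain ⟨e1, e2⟩ := C.fib_add_eq (h2 x)
    have k1 := kneser_of_stab_eq_bot (C.nonempty_T x) C.nonempty_zero (by rw [e1]; exact hbot _)
    have k2 := kneser_of_stab_eq_bot (C.nonempty_T x) C.nonempty_d (by rw [e2]; exact hbot _)
    rw [e1] at k1
    rw [e2] at k2
    exact ⟨k1, k2⟩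
  have hle : ∀ x, (fib φ T x).card ≤ 2 := by
    intro x
    have h1 := (hk (x + d + d)).1
    have h3 := (hk (x + d)).2
    have h4 := C.rho_add (x + d + d)
    rw [C.add_three] at h4
    have h5 := C.tau_add x
    omega
  have heq : ∀ x, (fib φ T x).card = 2 := fun x => le_antisymm (hle x) (h2 x)
  have hsix : h = 6 := by
    have := C.tau_add 0
    rw [heq, heq, heq] at this
    omega
  have hρ : ∀ x, (fib φ (T + S) x).card = 4 := by
    intro x
    have := C.rho_add x
    rw [heq] at this
    omega
  have hA3 : (fib φ S 0).card = 3 := by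
    have h1 := hk 0
    rw [heq, hρ, hρ] at h1
    omega
  have hB3 : (fib φ S d).card = 3 := by omega
  obtain ⟨t, t', htt, hT0⟩ := Finset.card_eq_two.1 (heq 0)
  obtain ⟨g, rfl⟩ : ∃ g, t' = t + g := ⟨t' - t, by abel⟩
  have hg : g ≠ 0 := by
    rintro rfl
    simp at htt
  have e0 := C.fib_add_eq (h2 0)
  rw [hT0] at e0
  obtain ⟨u, hu⟩ := eq_run_three hg hA3 (by rw [e0.1]; exact hρ _) (by rw [e0.1]; exact hbot _)
  obtain ⟨v, hv⟩ := eq_run_three hg hB3 (by rw [e0.2]; exact hρ _) (by rw [e0.2]; exact hbot _)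
  -- cancelling the parts of `S` shows that the fibres of `T` are translated by `u - v` from one
  -- coset to the previous one
  have step : ∀ x t, fib φ T x = {t, t + g} →
      fib φ T (x + d + d) = {t + (u - v), t + (u - v) + g} := by
    intro x t hx
    apply pair_eq_of_add_eq (hbot x) (hρ x) (heq _)
    · rw [← (C.fib_add_eq (h2 x)).1, hx, hu]
    · rw [← hv, (C.fib_add_eq (h2 (x + d + d))).2, C.add_three]
  have s1 := step _ _ hT0
  have s2 := step _ _ s1
  have s3 := step _ _ s2
  rw [show (0 : Q) + d + d + d + d = 0 + d by rw [C.add_three]] at s2 s3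
  rw [C.add_three] at s3
  have hstab : u - v ∈ stab T := by
    apply le_stab_of_add_mem
    intro x hx
    have key : ∀ z, ∀ y ∈ fib φ T z, y + (u - v) ∈ T := by
      have aux : ∀ (z w : Q) (p : G), fib φ T z = {p, p + g} →
          fib φ T w = {p + (u - v), p + (u - v) + g} → ∀ y ∈ fib φ T z, y + (u - v) ∈ T := by
        intro z w p h1 h2 y hy
        apply fib_subset (φ := φ) T w
        rw [h2, Finset.mem_insert, Finset.mem_singleton]
        rw [h1, Finset.mem_insert, Finset.mem_singleton] at hy
        rcases hy with rfl | rfl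
        · left; rfl
        · right; abel
      exact C.forall_iff 0 (aux _ _ _ hT0 s1) (aux _ _ _ s2 s3) (aux _ _ _ s1 s2)
    exact key (φ x) x (mem_fib.2 ⟨hx, rfl⟩)
  have h0 := stab_le_stab_add_left T S hstab
  rw [C.aper, AddSubgroup.mem_bot, sub_eq_zero] at h0
  have hu0 : φ u = 0 := (mem_fib.1 (show u ∈ fib φ S 0 by rw [hu]; simp)).2
  have hvd : φ v = d := (mem_fib.1 (show v ∈ fib φ S d by rw [hv]; simp)).2
  rw [h0, hvd] at hu0
  exact C.ne_zero hu0

/-- Two consecutive fibres of `T` are single elements. Otherwise there is only one such fibre. Each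
of the two others grows by just one element in a sum with a part of `S`, which bounds the parts of
`S` by `two_mul_card_le_of_card_add` and contradicts `|S| = h`. -/
theorem exists_pair (C : ThreeCosets φ S T h d) :
    ∃ x, (fib φ T x).card = 1 ∧ (fib φ T (x + d)).card = 1 ∧ 2 ≤ (fib φ T (x + d + d)).card := by
  obtain ⟨x, hx⟩ := C.exists_card_eq_one
  have hfin := C.fin
  have t0 := C.tau_add x
  have p1 := C.one_le_tau (x + d)
  have p2 := C.one_le_tau (x + d + d)
  have hT := C.card_T
  have hT' := C.T_card
  by_cases h1 : (fib φ T (x + d)).card = 1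
  · exact ⟨x, hx, h1, by omega⟩
  by_cases h2 : (fib φ T (x + d + d)).card = 1
  · refine ⟨x + d + d, h2, ?_, ?_⟩
    · rw [C.add_three]; exact hx
    · rw [C.add_three]; omega
  exfalso
  have e1 := (C.fib_add_eq (x := x + d) (by omega)).1
  have e2 := (C.fib_add_eq (x := x + d + d) (by omega)).2
  rw [C.add_three] at e2
  have r1 := C.rho_add (x + d)
  have r2 := C.rho_add x
  have k1 := two_mul_card_le_of_card_add (φ := φ) (q := x + d) (C.nonempty_T (x + d))
    C.nonempty_zero (by rw [e1]; exact fun _ hy => (mem_fib.1 hy).2) (by rw [e1]; omega)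
    (by rw [C.card_ker]; omega)
  have k2 := two_mul_card_le_of_card_add (φ := φ) (q := x) (C.nonempty_T (x + d + d))
    C.nonempty_d (by rw [e2]; exact fun _ hy => (mem_fib.1 hy).2) (by rw [e2]; omega)
    (by rw [C.card_ker]; omega)
  rw [C.card_ker] at k1 k2
  have hSS := C.card_S_eq
  have hSh := C.S_card
  omega

theorem card_G (C : ThreeCosets φ S T h d) : Nat.card G = 3 * h := by
  have h1 := AddSubgroup.card_eq_card_quotient_mul_card_addSubgroup φ.ker
  rw [C.card_ker, Nat.card_congr (QuotientAddGroup.quotientKerEquivOfSurjective φ C.surj).toEquiv,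
    C.card_Q] at h1
  exact h1

/-- An element of the kernel of order larger than two, together with an element mapping to a
generator of the quotient, generates the group if the kernel has order four. -/
theorem zmultiples_eq_top (C : ThreeCosets φ S T h d) (hh : h = 4) {c g : G} (hc : φ c = d)
    (hg : φ g = 0) (hgg : g + g ≠ 0) (hgc : g ∈ AddSubgroup.zmultiples c) :
    AddSubgroup.zmultiples c = ⊤ := by
  have hfin := C.fin
  have hgk : AddSubgroup.zmultiples g ≤ φ.ker := AddSubgroup.zmultiples_le_of_mem hg
  have hcard : Nat.card (AddSubgroup.zmultiples g) ∣ 4 := by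
    rw [← hh, ← C.card_ker]; exact AddSubgroup.card_dvd_of_le hgk
  have h4 : Nat.card (AddSubgroup.zmultiples g) = 4 := by
    rw [Nat.card_zmultiples] at hcard ⊢
    have hle := Nat.le_of_dvd (by norm_num) hcard
    have hz := addOrderOf_nsmul_eq_zero g
    interval_cases hord : addOrderOf g
    · norm_num at hcard
    · rw [one_nsmul] at hz
      rw [hz, add_zero] at hgg
      exact absurd rfl hgg
    · rw [two_nsmul] at hz
      exact absurd hz hgg
    · norm_num at hcard
    · rfl
  have hker : AddSubgroup.zmultiples g = φ.ker := by
    apply AddSubgroup.eq_of_le_of_card_ge hgk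
    rw [C.card_ker, h4, hh]
  rw [eq_top_iff]
  intro z _
  have hz : φ z ∈ AddSubgroup.zmultiples d := by rw [C.zmultiples_eq]; trivial
  obtain ⟨k, hk⟩ := AddSubgroup.mem_zmultiples_iff.1 hz
  have h1 : z - k • c ∈ AddSubgroup.zmultiples g := by
    rw [hker, AddMonoidHom.mem_ker, map_sub, map_zsmul, hc, hk, sub_self]
  have h2 := AddSubgroup.zmultiples_le_of_mem hgc h1
  have h3 : k • c ∈ AddSubgroup.zmultiples c := AddSubgroup.zsmul_mem_zmultiples c k
  have := add_mem h2 h3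
  rwa [sub_add_cancel] at this

theorem mem_run_four {a c z : G} :
    z ∈ run a c 4 ↔ z = a ∨ z = a + c ∨ z = a + c + c ∨ z = a + c + c + c := by
  rw [mem_run]
  constructor
  · rintro ⟨i, hi, rfl⟩
    interval_cases i
    · left; simp
    · right; left; simp
    · right; right; left; simp [two_nsmul, add_assoc]
    · right; right; right; simp [succ_nsmul, add_assoc]
  · rintro (rfl | rfl | rfl | rfl)
    · exact ⟨0, by omega, by simp⟩
    · exact ⟨1, by omega, by simp⟩
    · exact ⟨2, by omega, by simp [two_nsmul, add_assoc]⟩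
    · exact ⟨3, by omega, by simp [succ_nsmul, add_assoc]⟩

/-- Two pairs `{p, p + c}` and `{q, q + g}` form a four-term progression with difference `c`, if
`p + 2 c` is in the second pair and `p - c` is as well, and `3 c ≠ 0`. -/
theorem exists_run_of_four {T : Finset G} {p q c g : G} (h3c : c + c + c ≠ 0)
    (hT : ∀ z, z ∈ T ↔ z = p ∨ z = p + c ∨ z = q ∨ z = q + g)
    (m1 : p + c + c = q ∨ p + c + c = q + g) (m2 : p = q + c ∨ p = q + c + g) :
    ∃ a, T = run a c 4 ∧ g ∈ AddSubgroup.zmultiples c := by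
  have hcm : c + c + c ∈ AddSubgroup.zmultiples c :=
    add_mem (add_mem (AddSubgroup.mem_zmultiples c) (AddSubgroup.mem_zmultiples c))
      (AddSubgroup.mem_zmultiples c)
  rcases m2 with rfl | rfl
  · have e : q + c + c + c = q + (c + c + c) := by abel
    rcases m1 with m1 | m1
    · rw [e] at m1
      exact absurd (add_eq_left.1 m1) h3c
    · obtain rfl : c + c + c = g := by rw [e] at m1; exact add_left_cancel m1
      refine ⟨q, ?_, hcm⟩
      ext z
      rw [hT, mem_run_four, e]
      tauto
  · have e : q + c + g + c + c = q + g + (c + c + c) := by abel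
    rcases m1 with m1 | m1
    · have hg : g + (c + c + c) = 0 := by
        rw [e, add_assoc] at m1; exact add_eq_left.1 m1
      refine ⟨q + g, ?_, ?_⟩
      · ext z
        rw [hT, mem_run_four, show q + g + c + c + c = q by
          rw [add_right_comm q c g] at m1; exact m1, add_right_comm q c g]
        tauto
      · rw [eq_neg_of_add_eq_zero_left hg]
        exact neg_mem hcm
    · rw [e] at m1
      exact absurd (add_eq_left.1 m1) h3c

/-- The definition of the connectivity excludes that `{0, c, 2c}` is a subgroup. -/
theorem three_ne_zero (C : ThreeCosets φ S T h d) (hh : h = 4) {c u g : G} (hcd : φ c = d)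
    (hA : fib φ S 0 = {u, u + g}) (hB : fib φ S d = {u + c, u + c + g}) : c + c + c ≠ 0 := by
  intro h3
  have hfG : Finite G := by
    apply Nat.finite_of_card_ne_zero
    rw [C.card_G]; omega
  have hd0 := C.ne_zero
  have hdd : d + d ≠ 0 := by
    intro h0
    have := C.three_d
    rw [h0, zero_add] at this
    exact hd0 this
  have hX : ({0, c, c + c} : Finset G).card = 3 := by
    rw [Finset.card_eq_three]
    refine ⟨_, _, _, ?_, ?_, ?_, rfl⟩
    · rintro h0; apply hd0; rw [← hcd, ← h0, map_zero]
    · rintro h0; apply hdd; rw [← hcd, ← map_add, ← h0, map_zero]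
    · intro h0; apply hd0; rw [← hcd, add_eq_left.1 h0.symm, map_zero]
  have hXS : (({0, c, c + c} : Finset G) + S).card ≤ 6 := by
    have hsub : ({0, c, c + c} : Finset G) + S ⊆ ({0, c, c + c} : Finset G) + {u, u + g} := by
      intro z hz
      obtain ⟨y, hy, s, hs, rfl⟩ := Finset.mem_add.1 hz
      rw [C.S_eq_union, hA, hB] at hs
      simp only [Finset.mem_union, Finset.mem_insert, Finset.mem_singleton] at hs hy
      have hyc : y + c ∈ ({0, c, c + c} : Finset G) := by
        rcases hy with rfl | rfl | rfl
        · simp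
        · simp
        · rw [h3]; simp
      have hy' : y ∈ ({0, c, c + c} : Finset G) := by simpa using hy
      rcases hs with (rfl | rfl) | (rfl | rfl)
      · exact Finset.add_mem_add hy' (by simp)
      · exact Finset.add_mem_add hy' (by simp)
      · rw [show y + (u + c) = y + c + u by abel]
        exact Finset.add_mem_add hyc (by simp)
      · rw [show y + (u + c + g) = y + c + (u + g) by abel]
        exact Finset.add_mem_add hyc (by simp)
    -- if `3 c = 0`, then the sum of `{0, c, 2 c}` with `S` is the sum with one part of `S` only
    calc _ ≤ _ := Finset.card_le_card hsub
      _ ≤ _ := Finset.card_add_le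
      _ ≤ 3 * 2 := Nat.mul_le_mul hX.le Finset.card_le_two
      _ = 6 := rfl
  have := C.test _ (adm_of_card (S := S) (by rw [hX]; norm_num) (by
    rw [C.card_G]; omega))
  rw [C.card_image] at this
  omega

/-- In the three-term progression `{q, q + g} + {w, w + g}`, only the first two terms are followed
by another term. -/
theorem eq_or_eq_of_pair_mem {y q w g : G} (hg0 : g ≠ 0) (hgg : g + g ≠ 0) (hg3 : g + g + g ≠ 0)
    (h1 : y ∈ ({q, q + g} : Finset G) + {w, w + g})
    (h2 : y + g ∈ ({q, q + g} : Finset G) + {w, w + g}) : y = q + w ∨ y = q + w + g := by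
  have key : ∀ y ∈ ({q, q + g} : Finset G) + {w, w + g},
      y = q + w ∨ y = q + w + g ∨ y = q + w + g + g := by
    intro y hy
    simp only [Finset.mem_add, Finset.mem_insert, Finset.mem_singleton] at hy
    obtain ⟨_, rfl | rfl, _, rfl | rfl, rfl⟩ := hy
    · left; rfl
    · right; left; abel
    · right; left; abel
    · right; right; abel
  rcases key _ h1 with rfl | rfl | rfl
  · exact Or.inl rfl
  · exact Or.inr rfl
  · exfalso
    rcases key _ h2 with h | h | h
    · rw [add_assoc, add_assoc, add_eq_left, ← add_assoc] at h
      exact hg3 h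
    · rw [add_assoc (q + w + g), add_eq_left] at h
      exact hgg h
    · exact hg0 (add_eq_left.1 h)

/-- A pair whose sum with `{u, u + g}` has at most three elements has the difference `g`. -/
theorem exists_pair_eq {w w' u g : G} (hg0 : g ≠ 0) (hww : w ≠ w')
    (hc3 : (({w, w'} : Finset G) + {u, u + g}).card ≤ 3) :
    ∃ q, ({w, w'} : Finset G) = {q, q + g} := by
  by_cases h1 : w' = w + g
  · exact ⟨w, by rw [h1]⟩
  by_cases h2 : w = w' + g
  · exact ⟨w', by rw [h2, Finset.pair_comm]⟩
  exfalso
  have hsub : ({w + u, w + (u + g), w' + u, w' + (u + g)} : Finset G) ⊆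
      ({w, w'} : Finset G) + {u, u + g} := by
    intro z hz
    simp only [Finset.mem_insert, Finset.mem_singleton] at hz
    rcases hz with rfl | rfl | rfl | rfl <;> apply Finset.add_mem_add <;> simp
  have hle := Finset.card_le_card hsub
  have h4 : ({w + u, w + (u + g), w' + u, w' + (u + g)} : Finset G).card = 4 := by
    have n1 : w + u ≠ w + (u + g) := by simpa using hg0
    have n2 : w + u ≠ w' + u := fun he => hww (add_right_cancel he)
    have n3 : w + u ≠ w' + (u + g) := by
      intro he
      apply h2
      apply add_right_cancel (b := u)
      rw [he]; abel
    have n4 : w + (u + g) ≠ w' + u := by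
      intro he
      apply h1
      apply add_right_cancel (b := u)
      rw [← he]; abel
    have n5 : w + (u + g) ≠ w' + (u + g) := fun he => hww (add_right_cancel he)
    have n6 : w' + u ≠ w' + (u + g) := by simpa using hg0
    rw [Finset.card_insert_of_notMem, Finset.card_insert_of_notMem, Finset.card_pair n6]
    · simp [n4, n5]
    · simp [n1, n2, n3]
  omega

theorem eq_pair_of_singleton_add {B : Finset G} {p c u g : G}
    (e1 : ({p} : Finset G) + B = {p + c} + {u, u + g}) : B = {u + c, u + c + g} := by
  ext z
  have h1 : z ∈ B ↔ p + z ∈ ({p} : Finset G) + B := by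
    simp [Finset.singleton_add]
  rw [h1, e1]
  simp only [Finset.mem_add, Finset.mem_insert, Finset.mem_singleton]
  constructor
  · rintro ⟨_, rfl, _, rfl | rfl, he⟩
    · left
      apply add_left_cancel (a := p)
      rw [← he]; abel
    · right
      apply add_left_cancel (a := p)
      rw [← he]; abel
  · rintro (rfl | rfl)
    · exact ⟨_, rfl, u, Or.inl rfl, by abel⟩
    · exact ⟨_, rfl, u + g, Or.inr rfl, by abel⟩

/-- The cosets have four elements and `T` is a four-term progression, whose difference generates the
group. Two fibres of `T` are single elements `p` and `p + c`; comparing the sums that fill the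
fibres of `T + S` shows that the third one is `{p - c, p + 2 c}`. -/
theorem exists_run (C : ThreeCosets φ S T h d) :
    h = 4 ∧ ∃ c p, AddSubgroup.zmultiples c = ⊤ ∧ T = run p c 4 := by
  obtain ⟨x, hx0, hx1, hx2⟩ := C.exists_pair
  have t0 := C.tau_add x
  have hT := C.card_T
  have hT' := C.T_card
  have hSS := C.card_S_eq
  have hSh := C.S_card
  have r0 := C.rho_add x
  have r1 := C.rho_add (x + d)
  have r2 := C.rho_add (x + d + d)
  rw [C.add_three] at r2
  have a1 := C.le_rho_zero (x + d)
  have b1 := C.le_rho_d (x + d)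
  have hh : h = 4 := by omega
  have hA2 : (fib φ S 0).card = 2 := by omega
  have hB2 : (fib φ S d).card = 2 := by omega
  refine ⟨hh, ?_⟩
  obtain ⟨p, hp⟩ := Finset.card_eq_one.1 hx0
  obtain ⟨p', hp'⟩ := Finset.card_eq_one.1 hx1
  obtain ⟨c, rfl⟩ : ∃ c, p' = p + c := ⟨p' - p, by abel⟩
  obtain ⟨u, u', huu, hA⟩ := Finset.card_eq_two.1 hA2
  obtain ⟨g, rfl⟩ : ∃ g, u' = u + g := ⟨u' - u, by abel⟩
  have hg0 : g ≠ 0 := by rintro rfl; simp at huu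
  obtain ⟨w, w', hww, hTw⟩ := Finset.card_eq_two.1 (show (fib φ T (x + d + d)).card = 2 by omega)
  have hpx : φ p = x := (mem_fib.1 (show p ∈ fib φ T x by rw [hp]; simp)).2
  have hpx' : φ (p + c) = x + d :=
    (mem_fib.1 (show p + c ∈ fib φ T (x + d) by rw [hp']; simp)).2
  have hcd : φ c = d := by rw [map_add, hpx] at hpx'; exact add_left_cancel hpx'
  have hu : φ u = 0 := (mem_fib.1 (show u ∈ fib φ S 0 by rw [hA]; simp)).2
  have hug : φ (u + g) = 0 := (mem_fib.1 (show u + g ∈ fib φ S 0 by rw [hA]; simp)).2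
  have hg : φ g = 0 := by rw [map_add, hu, zero_add] at hug; exact hug
  -- the two parts of `S` are translates of each other
  have hB : fib φ S d = {u + c, u + c + g} := by
    have e1 : fib φ T x + fib φ S d = fib φ (T + S) (x + d) := by
      apply Finset.eq_of_subset_of_card_le (C.fib_add_fib_subset x)
      rw [hp, Finset.singleton_add, Finset.card_vadd_finset]
      omega
    have e2 : fib φ T (x + d) + fib φ S 0 = fib φ (T + S) (x + d) := by
      apply Finset.eq_of_subset_of_card_le (C.fib_add_fib_zero_subset (x + d))
      rw [hp', Finset.singleton_add, Finset.card_vadd_finset]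
      omega
    rw [← e2, hp, hp', hA] at e1
    exact eq_pair_of_singleton_add e1
  obtain ⟨f1, f2⟩ := C.fib_add_eq hx2
  rw [C.add_three] at f2
  -- the third fibre of `T` is a pair with the same difference
  obtain ⟨q, hq⟩ : ∃ q, fib φ T (x + d + d) = {q, q + g} := by
    rw [hTw]
    apply exists_pair_eq hg0 hww
    rw [← hTw, ← hA, f1]
    omega
  rw [hq, hA] at f1
  rw [hq, hB] at f2
  have hgg : g + g ≠ 0 := by
    intro h0
    have hsub : ({q, q + g} : Finset G) + {u, u + g} ⊆ {q + u, q + u + g} := by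
      intro z hz
      simp only [Finset.mem_add, Finset.mem_insert, Finset.mem_singleton] at hz ⊢
      rcases hz with ⟨_, rfl | rfl, _, rfl | rfl, rfl⟩
      · left; rfl
      · right; abel
      · right; abel
      · left
        rw [show q + g + (u + g) = q + u + (g + g) by abel, h0, add_zero]
    have := (Finset.card_le_card hsub).trans Finset.card_le_two
    rw [f1] at this
    omega
  have h4g : g + g + g + g = 0 := by
    have hfin := C.fin
    have : Nat.card φ.ker • (⟨g, hg⟩ : φ.ker) = 0 := card_nsmul_eq_zero'
    rw [C.card_ker, hh] at this
    have := congrArg Subtype.val this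
    simpa [succ_nsmul] using this
  have hg3 : g + g + g ≠ 0 := by
    intro h3
    rw [h3, zero_add] at h4g
    exact hg0 h4g
  -- the remaining sums force `3c` to be a multiple of `g`
  have m1 : p + c + c = q ∨ p + c + c = q + g := by
    have hm : ∀ y ∈ fib φ S d, p + c + y ∈ ({q, q + g} : Finset G) + {u, u + g} := by
      intro y hy
      rw [f1]
      exact C.fib_add_fib_subset (x + d) (Finset.add_mem_add (show p + c ∈ fib φ T (x + d) by
        rw [hp']; simp) hy)
    have h1 := hm (u + c) (by rw [hB]; simp)
    have h2 := hm (u + c + g) (by rw [hB]; simp)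
    rw [← add_assoc] at h2
    rcases eq_or_eq_of_pair_mem hg0 hgg hg3 h1 h2 with k | k
    · left
      apply add_right_cancel (b := u)
      rw [← k]; abel
    · right
      apply add_right_cancel (b := u)
      rw [add_right_comm q, ← k]; abel
  have m2 : p = q + c ∨ p = q + c + g := by
    have hm : ∀ y ∈ fib φ S 0, p + y ∈ ({q, q + g} : Finset G) + {u + c, u + c + g} := by
      intro y hy
      rw [f2]
      exact C.fib_add_fib_zero_subset x
        (Finset.add_mem_add (show p ∈ fib φ T x by rw [hp]; simp) hy)
    have h1 := hm u (by rw [hA]; simp)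
    have h2 := hm (u + g) (by rw [hA]; simp)
    rw [← add_assoc] at h2
    rcases eq_or_eq_of_pair_mem hg0 hgg hg3 h1 h2 with k | k
    · left
      apply add_right_cancel (b := u)
      rw [k]; abel
    · right
      apply add_right_cancel (b := u)
      rw [k]; abel
  have h3c := C.three_ne_zero hh hcd hA hB
  have hTeq : ∀ z, z ∈ T ↔ z = p ∨ z = p + c ∨ z = q ∨ z = q + g := by
    intro z
    have : z ∈ T ↔ z ∈ fib φ T x ∨ z ∈ fib φ T (x + d) ∨ z ∈ fib φ T (x + d + d) := by
      constructor
      · intro hz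
        exact (C.eq_or x (φ z)).imp (fun e => mem_fib.2 ⟨hz, e⟩)
          (Or.imp (fun e => mem_fib.2 ⟨hz, e⟩) (fun e => mem_fib.2 ⟨hz, e⟩))
      · rintro (hz | hz | hz) <;> exact (mem_fib.1 hz).1
    rw [this, hp, hp', hq]
    rw [Finset.mem_singleton, Finset.mem_singleton, Finset.mem_insert, Finset.mem_singleton]
  obtain ⟨a, ha, hgc⟩ := exists_run_of_four h3c hTeq m1 m2
  exact ⟨c, a, C.zmultiples_eq_top hh hcd hg hgg hgc, ha⟩

end ThreeCosets

/-! ### Images in the quotient are progressions -/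

section Shape

variable {G Q : Type*} [AddCommGroup G] [DecidableEq G] [AddCommGroup Q] [DecidableEq Q]
variable {φ : G →+ Q} {S T : Finset G} {h μ : ℕ}

/-- The images of `S` and `T` are progressions with the same difference and the image of the
sumset is as small as possible, unless `T` is a four-term progression in a cyclic group of order
twelve. -/
theorem Config.shape (C : Config φ S T h μ) :
    (μ = 0 ∧ Nat.card G = 12 ∧ S.card = 4 ∧ T.card = 4 ∧
      ∃ c p, AddSubgroup.zmultiples c = ⊤ ∧ T = run p c 4) ∨
    ∃ p q y : Q, ∃ u v : ℕ, 1 ≤ v ∧ S.image φ = run p y (u + 1) ∧ (run p y (u + 1)).card = u + 1 ∧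
      T.image φ = run q y (v + 1) ∧ (run q y (v + 1)).card = v + 1 ∧
      ((T + S).image φ).card = u + v + 1 := by
  have hfin := C.fin
  have hSpos : 0 < S.card := by have := C.card_S; have := C.hμ; omega
  have hTpos : 0 < T.card := lt_of_lt_of_le hSpos C.card_S_le
  have hTne : (T.image φ).Nonempty := (Finset.card_pos.1 hTpos).image φ
  have hs2 := C.rigid.two_le
  have ht2 : 2 ≤ (T.image φ).card := by
    by_contra ht
    have ht1 : (T.image φ).card = 1 := by have := Finset.card_pos.2 hTne; omega
    have h1 := C.not_periodic_T
    have h2 := C.h_mul_le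
    have h3 := C.card_S_le
    have h4 : h * 2 ≤ h * (S.image φ).card := Nat.mul_le_mul_left h hs2
    rw [ht1] at h1
    omega
  have hle := C.card_image_add_le
  have himg : (T + S).image φ = T.image φ + S.image φ := image_add_hom T S
  -- two progressions, once the difference of the first one is known
  have key : ∀ p y : Q, S.image φ = run p y (S.image φ).card → IsRun y (T.image φ) →
      (T.image φ).card + (S.image φ).card ≤ ((T + S).image φ).card + 1 →
      ∃ p q y : Q, ∃ u v : ℕ, 1 ≤ v ∧ S.image φ = run p y (u + 1) ∧
        (run p y (u + 1)).card = u + 1 ∧ T.image φ = run q y (v + 1) ∧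
        (run q y (v + 1)).card = v + 1 ∧ ((T + S).image φ).card = u + v + 1 := by
    rintro p y hS ⟨q, hT⟩ hc
    refine ⟨p, q, y, (S.image φ).card - 1, (T.image φ).card - 1, by omega, ?_, ?_, ?_, ?_, by omega⟩
    · rwa [Nat.sub_add_cancel (by omega)]
    · rw [Nat.sub_add_cancel (by omega), ← hS]
    · rwa [Nat.sub_add_cancel (by omega)]
    · rw [Nat.sub_add_cancel (by omega), ← hT]
  -- if all cosets are met, then `φ(S) = {0, d}`, and `φ(T)` is a progression with difference `d`,
  -- since adding `d` yields only one new coset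
  by_cases hR : ∀ z, z ∈ (T + S).image φ
  · have hs := C.card_image_eq_two hR
    have hQ : Finite Q := Set.finite_univ_iff.1
      (((T + S).image φ).finite_toSet.subset (fun q _ => hR q))
    have := Fintype.ofFinite Q
    have hRuniv : (T + S).image φ = Finset.univ := Finset.eq_univ_iff_forall.2 hR
    obtain ⟨d, hd⟩ : ∃ d, S.image φ = {0, d} := by
      obtain ⟨x, y, hxy, he⟩ := Finset.card_eq_two.1 hs
      have h0 := C.rigid.zero_mem
      rw [he, Finset.mem_insert, Finset.mem_singleton] at h0
      rcases h0 with rfl | rfl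
      · exact ⟨y, he⟩
      · exact ⟨x, by rw [he, Finset.pair_comm]⟩
    have hd0 : d ≠ 0 := by
      rintro rfl
      rw [hd] at hs
      simp at hs
    by_cases hTQ : ∀ q, q ∈ T.image φ
    · left
      have C2 : TwoCosets φ S T h μ d := ⟨C, hd, hd0, hTQ⟩
      obtain ⟨rfl, hSh⟩ := C2.card_S_eq_h
      have C3 := C2.threeCosets
      obtain ⟨rfl, hrun⟩ := C3.exists_run
      exact ⟨rfl, by rw [C3.card_G], hSh, C3.T_card, hrun⟩
    · right
      have htn : (T.image φ).card < ((T + S).image φ).card := by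
        apply Finset.card_lt_card
        rw [hRuniv, Finset.ssubset_univ_iff]
        intro he
        exact hTQ (fun q => he ▸ Finset.mem_univ q)
      have hgen : AddSubgroup.zmultiples d = ⊤ := by
        rw [eq_top_iff, ← C.rigid.closure_eq, hd, AddSubgroup.closure_le]
        intro x hx
        rw [Finset.mem_coe, Finset.mem_insert, Finset.mem_singleton] at hx
        rcases hx with rfl | rfl
        · exact zero_mem _
        · exact AddSubgroup.mem_zmultiples x
      have hun : T.image φ ∪ (T.image φ).image (· + d) = (T + S).image φ := by
        rw [himg, hd, Finset.insert_eq, Finset.add_union, add_singleton_eq_image,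
          add_singleton_eq_image]
        simp
      refine key 0 d ?_ (isRun_of_card_sdiff hgen ?_) (by omega)
      · rw [hs, hd]
        simp [run, Finset.range_add_one, Finset.pair_comm]
      · rw [← hun, ← Finset.union_sdiff_self_eq_union,
          Finset.card_union_of_disjoint Finset.disjoint_sdiff] at hle htn
        omega
  · right
    -- if a coset is missed, then `φ(S)` is a progression with the difference `y` of
    -- `exists_small_union`, and so is `φ(T)`, since the sum of the images is of minimal size
    push Not at hR
    obtain ⟨y, hy, hyS⟩ := C.exists_small_union hR
    obtain ⟨hgen, p, hp⟩ := C.rigid.isRun hy hyS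
    have hlow := C.rigid.card_add _ hTne (by rwa [← himg])
    rw [← himg] at hlow
    refine key p y hp ?_ hlow
    have hs1 : (S.image φ).card = ((S.image φ).card - 1) + 1 := by omega
    rw [hs1] at hp
    apply isRun_of_card_add_run hgen hTne ((S.image φ).card - 1) (by omega) (p := p)
    · rwa [← hp, ← himg]
    · rw [← hp, ← himg]; omega

end Shape

/-! ### Coset progressions and periodic sets -/

section Translation

variable {G : Type*} [AddCommGroup G] [DecidableEq G] {H : AddSubgroup G}

theorem isPeriodic_iff_le_stab {A : Finset G} : IsPeriodic H A ↔ H ≤ stab A := by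
  constructor
  · intro hA k hk
    apply le_stab_of_add_mem
    intro x hx
    have : x + k ∈ (A : Set G) + (H : Set G) := Set.add_mem_add hx hk
    rw [hA] at this
    exact this
  · intro hA
    apply Set.Subset.antisymm
    · rintro _ ⟨x, hx, k, hk, rfl⟩
      have := (mem_stab.1 (hA hk) x).2 hx
      rwa [add_comm] at this
    · intro x hx
      exact ⟨x, hx, 0, zero_mem H, add_zero x⟩

variable [DecidableEq (G ⧸ H)]

instance [Finite H] : Finite (QuotientAddGroup.mk' H).ker := by
  rw [QuotientAddGroup.ker_mk']; infer_instance

theorem coe_pre_image [Finite H] (A : Finset G) :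
    (pre (QuotientAddGroup.mk' H) (A.image (QuotientAddGroup.mk' H)) : Set G) =
      (A : Set G) + (H : Set G) := by
  ext x
  rw [Finset.mem_coe, mem_pre, Finset.mem_image]
  constructor
  · rintro ⟨a, ha, he⟩
    exact ⟨a, ha, -a + x, QuotientAddGroup.eq.1 he, add_neg_cancel_left a x⟩
  · rintro ⟨a, ha, k, hk, rfl⟩
    refine ⟨a, ha, QuotientAddGroup.eq.2 ?_⟩
    rwa [neg_add_cancel_left]

theorem card_pre_mk [Finite H] (X : Finset (G ⧸ H)) :
    (pre (QuotientAddGroup.mk' H) X).card = Nat.card H * X.card := by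
  rw [card_pre (QuotientAddGroup.mk'_surjective H), QuotientAddGroup.ker_mk']

theorem ncard_add [Finite H] (A : Finset G) :
    ((A : Set G) + (H : Set G)).ncard = Nat.card H * (A.image (QuotientAddGroup.mk' H)).card := by
  rw [← coe_pre_image, Set.ncard_coe_finset, card_pre_mk]

theorem isPeriodic_pre [Finite H] (X : Finset (G ⧸ H)) :
    IsPeriodic H (pre (QuotientAddGroup.mk' H) X) := by
  rw [isPeriodic_iff_le_stab]
  intro k hk
  apply le_stab_of_add_mem
  intro x hx
  rw [mem_pre] at hx ⊢
  rw [map_add, show QuotientAddGroup.mk' H k = 0 from (QuotientAddGroup.eq_zero_iff k).2 hk,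
    add_zero]
  exact hx

/-- A set with `ν` holes in the cosets that it meets arises from their union by deleting `ν`
elements. -/
theorem isNearPeriodic_of_card [Finite H] {A : Finset G} {ν : ℕ}
    (hA : A.card + ν = Nat.card H * (A.image (QuotientAddGroup.mk' H)).card) :
    IsNearPeriodic H ν A := by
  have hsub : A ⊆ pre (QuotientAddGroup.mk' H) (A.image (QuotientAddGroup.mk' H)) :=
    fun x hx => mem_pre.2 (Finset.mem_image_of_mem _ hx)
  refine ⟨_, _, isPeriodic_pre (A.image (QuotientAddGroup.mk' H)), Finset.sdiff_subset (t := A),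
    ?_, (Finset.sdiff_sdiff_eq_self hsub).symm⟩
  rw [Finset.card_sdiff_of_subset hsub, card_pre_mk]
  omega

theorem isPeriodic_of_card [Finite H] {A : Finset G}
    (hA : A.card = Nat.card H * (A.image (QuotientAddGroup.mk' H)).card) : IsPeriodic H A := by
  have hsub : A ⊆ pre (QuotientAddGroup.mk' H) (A.image (QuotientAddGroup.mk' H)) :=
    fun x hx => mem_pre.2 (Finset.mem_image_of_mem _ hx)
  rw [Finset.eq_of_subset_of_card_le hsub (by rw [card_pre_mk, hA])]
  exact isPeriodic_pre _

variable {A : Finset G} {u : ℕ} {X : ℕ → Finset G}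

theorem IsDecomposition.mk_eq (hX : IsDecomposition H A u X) {i : ℕ} (hi : i ≤ u) {x y : G}
    (hx : x ∈ X i) (hy : y ∈ X i) : (x : G ⧸ H) = y := by
  obtain ⟨a, ha⟩ := hX.coset i hi
  have h1 : x ∈ a +ᵥ (H : Set G) := (ha ▸ Finset.mem_coe.2 hx : x ∈ _ ∩ (A : Set G)).1
  have h2 : y ∈ a +ᵥ (H : Set G) := (ha ▸ Finset.mem_coe.2 hy : y ∈ _ ∩ (A : Set G)).1
  rw [Set.mem_vadd_set_iff_neg_vadd_mem] at h1 h2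
  rw [← QuotientAddGroup.eq.2 h1, ← QuotientAddGroup.eq.2 h2]

theorem IsDecomposition.mem_of_mk_eq (hX : IsDecomposition H A u X) {i : ℕ} (hi : i ≤ u) {x y : G}
    (hx : x ∈ X i) (hy : y ∈ A) (h : (x : G ⧸ H) = y) : y ∈ X i := by
  obtain ⟨a, ha⟩ := hX.coset i hi
  have h1 : x ∈ a +ᵥ (H : Set G) := (ha ▸ Finset.mem_coe.2 hx : x ∈ _ ∩ (A : Set G)).1
  rw [← Finset.mem_coe, ha]
  refine ⟨?_, hy⟩
  rw [Set.mem_vadd_set_iff_neg_vadd_mem] at h1 ⊢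
  have := add_mem h1 (QuotientAddGroup.eq.1 h)
  simpa [vadd_eq_add, add_assoc] using this

theorem IsDecomposition.card_biUnion (hX : IsDecomposition H A u X) {n : ℕ} (hn : n ≤ u + 1) :
    ((Finset.range n).biUnion X).card = ∑ i ∈ Finset.range n, (X i).card := by
  apply Finset.card_biUnion
  intro i hi j hj hij
  rw [Finset.mem_coe, Finset.mem_range] at hi hj
  exact hX.disjoint i (by omega) j (by omega) hij

/-- The first `n` sets of a decomposition meet exactly `n` cosets. -/
theorem IsDecomposition.card_image_biUnion (hX : IsDecomposition H A u X) {n : ℕ}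
    (hn : n ≤ u + 1) :
    (((Finset.range n).biUnion X).image (QuotientAddGroup.mk' H)).card = n := by
  have hex : ∀ i, ∃ x, i ≤ u → x ∈ X i := by
    intro i
    by_cases hi : i ≤ u
    · obtain ⟨x, hx⟩ := hX.nonempty i hi
      exact ⟨x, fun _ => hx⟩
    · exact ⟨0, fun h => absurd h hi⟩
  choose x hx using hex
  have hA : ∀ i ≤ u, ∀ y ∈ X i, y ∈ A := by
    intro i hi y hy
    rw [hX.union]
    exact Finset.mem_biUnion.2 ⟨i, Finset.mem_range.2 (by omega), hy⟩
  have himg : ((Finset.range n).biUnion X).image (QuotientAddGroup.mk' H) =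
      (Finset.range n).image (fun i => QuotientAddGroup.mk' H (x i)) := by
    ext z
    simp only [Finset.mem_image, Finset.mem_biUnion, Finset.mem_range]
    constructor
    · rintro ⟨y, ⟨i, hi, hy⟩, rfl⟩
      exact ⟨i, hi, hX.mk_eq (by omega) (hx i (by omega)) hy⟩
    · rintro ⟨i, hi, rfl⟩
      exact ⟨x i, ⟨i, hi, hx i (by omega)⟩, rfl⟩
  rw [himg, Finset.card_image_of_injOn, Finset.card_range]
  intro i hi j hj hij
  rw [Finset.mem_coe, Finset.mem_range] at hi hj
  by_contra hne
  have h1 := hX.mem_of_mk_eq (show i ≤ u by omega) (hx i (by omega))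
    (hA j (by omega) _ (hx j (by omega))) hij
  exact Finset.disjoint_left.1 (hX.disjoint i (by omega) j (by omega) hne) h1 (hx j (by omega))

theorem IsDecomposition.sdiff_last (hX : IsDecomposition H A u X) :
    A \ X u = (Finset.range u).biUnion X := by
  ext y
  rw [Finset.mem_sdiff]
  conv_lhs => rw [hX.union]
  simp only [Finset.mem_biUnion, Finset.mem_range]
  constructor
  · rintro ⟨⟨i, hi, hy⟩, hyu⟩
    refine ⟨i, ?_, hy⟩
    rcases Nat.lt_or_ge i u with h | h
    · exact h
    · obtain rfl : i = u := by omega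
      exact absurd hy hyu
  · rintro ⟨i, hi, hy⟩
    exact ⟨⟨i, by omega, hy⟩, fun hyu =>
      Finset.disjoint_left.1 (hX.disjoint i (by omega) u le_rfl (by omega)) hy hyu⟩

variable {h : ℕ}

/-- The holes of the first `n` sets of a decomposition complete their union to a union of cosets. -/
theorem IsDecomposition.sum_sub_card (hX : IsDecomposition H A u X) (hc : ∀ i, (X i).card ≤ h)
    {n : ℕ} (hn : n ≤ u + 1) :
    ∑ i ∈ Finset.range n, (h - (X i).card) + ((Finset.range n).biUnion X).card =
      h * (((Finset.range n).biUnion X).image (QuotientAddGroup.mk' H)).card := by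
  rw [hX.card_image_biUnion hn, hX.card_biUnion hn, sum_holes hc]

theorem IsDecomposition.ncard_add_eq [Finite H] (hX : IsDecomposition H A u X)
    (hh : Nat.card H = h) (hc : ∀ i, (X i).card ≤ h) :
    ((A : Set G) + (H : Set G)).ncard = ∑ i ∈ Finset.range (u + 1), (h - (X i).card) + A.card := by
  have := hX.sum_sub_card hc le_rfl
  rw [← hX.union] at this
  rw [this, ncard_add, hh]

theorem IsDecomposition.isNearPeriodic [Finite H] (hX : IsDecomposition H A u X)
    (hh : Nat.card H = h) (hc : ∀ i, (X i).card ≤ h) {ν : ℕ}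
    (hν : ∑ i ∈ Finset.range u, (h - (X i).card) = ν) : IsNearPeriodic H ν (A \ X u) := by
  apply isNearPeriodic_of_card
  have := hX.sum_sub_card hc (Nat.le_succ u)
  rw [hX.sdiff_last, hh, ← this, hν, add_comm]

theorem IsDecomposition.isPeriodic [Finite H] (hX : IsDecomposition H A u X)
    (hh : Nat.card H = h) (hc : ∀ i, (X i).card ≤ h)
    (hν : ∑ i ∈ Finset.range u, (h - (X i).card) = 0) : IsPeriodic H (A \ X u) := by
  apply isPeriodic_of_card
  have := hX.sum_sub_card hc (Nat.le_succ u)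
  rw [hX.sdiff_last, hh, ← this, hν, zero_add]

theorem IsCosetProgression.reverse {d : G ⧸ H} (hX : IsCosetProgression H d A u X) :
    IsCosetProgression H (-d) A u (fun i => X (u - i)) := by
  refine ⟨⟨fun i _ => hX.nonempty _ (Nat.sub_le _ _), fun i _ => hX.coset _ (Nat.sub_le _ _),
    fun i hi j hj hij => hX.disjoint _ (Nat.sub_le _ _) _ (Nat.sub_le _ _) (by omega), ?_⟩,
    fun i hi x hx y hy => ?_⟩
  · rw [hX.union]
    ext y
    simp only [Finset.mem_biUnion, Finset.mem_range]
    constructor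
    · rintro ⟨i, hi, hy⟩
      exact ⟨u - i, by omega, by rwa [Nat.sub_sub_self (by omega)]⟩
    · rintro ⟨i, hi, hy⟩
      exact ⟨u - i, by omega, hy⟩
  · have := hX.step (u - (i + 1)) (by omega) y hy x (by
      rwa [show u - (i + 1) + 1 = u - i by omega])
    rw [this, add_neg_cancel_right]

/-- A set whose image in the quotient is a progression is a coset progression; its terms are its
fibres. -/
theorem isCosetProgression_fib {p y : G ⧸ H}
    (hA : A.image (QuotientAddGroup.mk' H) = run p y (u + 1))
    (hc : (run p y (u + 1)).card = u + 1) :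
    IsCosetProgression H y A u (fun i => fib (QuotientAddGroup.mk' H) A (p + i • y)) := by
  have hne : ∀ i ≤ u, (fib (QuotientAddGroup.mk' H) A (p + i • y)).Nonempty := by
    intro i hi
    rw [fib_nonempty, hA, mem_run]
    exact ⟨i, by omega, rfl⟩
  refine ⟨⟨hne, fun i hi => ?_, fun i hi j hj hij => ?_, ?_⟩, fun i hi x hx z hz => ?_⟩
  · obtain ⟨a, ha⟩ := hne i hi
    refine ⟨a, ?_⟩
    ext x
    rw [Finset.mem_coe, mem_fib, Set.mem_inter_iff, Set.mem_vadd_set_iff_neg_vadd_mem,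
      Finset.mem_coe, and_comm, ← (mem_fib.1 ha).2]
    apply and_congr_left'
    exact eq_comm.trans QuotientAddGroup.eq
  · rw [Finset.disjoint_left]
    intro x hx hx'
    exact hij (IsRun.injOn hc (by omega) (by omega)
      ((mem_fib.1 hx).2.symm.trans (mem_fib.1 hx').2))
  · ext x
    simp only [Finset.mem_biUnion, Finset.mem_range, mem_fib]
    constructor
    · intro hx
      have := Finset.mem_image_of_mem (QuotientAddGroup.mk' H) hx
      rw [hA, mem_run] at this
      obtain ⟨i, hi, he⟩ := this
      exact ⟨i, hi, hx, he.symm⟩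
    · rintro ⟨i, _, hx, _⟩
      exact hx
  · have h1 := (mem_fib.1 hx).2
    have h2 := (mem_fib.1 hz).2
    rw [QuotientAddGroup.mk'_apply] at h1 h2
    rw [h1, h2, succ_nsmul, add_assoc]

/-- The conclusion of the structure theorem for two sets that are progressions of partial
cosets. -/
def IsPairShape (H : AddSubgroup G) (μ : ℕ) (S T : Finset G) : Prop :=
  (μ = 0 ∧ IsEssentialPair H S T) ∨
    ((∃ (d : G ⧸ H) (u t : ℕ) (X Y : ℕ → Finset G) (ν : ℕ),
        IsCosetProgression H d S u X ∧ IsCosetProgression H d T t Y ∧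
        ν ≤ 1 - μ ∧
        ((IsPeriodic H (S \ X u) ∧ IsNearPeriodic H ν (T \ Y t)) ∨
          (IsPeriodic H (T \ Y t) ∧ IsNearPeriodic H ν (S \ X u))) ∧
        (Y t + X u).card + ν + μ = (Y t).card + (X u).card) ∧
      ((T : Set G) + (H : Set G)).ncard + μ ≤ T.card + Nat.card H)

/-- The possible ends of a chain, expressed for the sets `S` and `T`. The number of holes of `T` is
at most `h - μ`, and the periodicity statements say that certain fibres have no holes. -/
theorem isPairShape_of_chainEnd [Finite H] {S T : Finset G} {d : G ⧸ H} {v μ : ℕ}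
    {Y : ℕ → Finset G} (hh : Nat.card H = h) (hu : 1 ≤ u) (hv : 1 ≤ v)
    (hX : IsCosetProgression H d S u X) (hY : IsCosetProgression H d T v Y)
    (hXc : ∀ i, (X i).card ≤ h) (hYc : ∀ i, (Y i).card ≤ h)
    (hb : ∑ j ∈ Finset.range (v + 1), (h - (Y j).card) + μ ≤ h)
    (hE : ChainEnd H h μ u v X Y) : IsPairShape H μ S T := by
  have nS := hX.ncard_add_eq hh hXc
  have nT := hY.ncard_add_eq hh hYc
  rcases hE with ⟨hμ, hA, hB, hcase⟩ | ⟨ν, hν, hper, hc⟩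
  · left
    refine ⟨hμ, d, u, v, X, Y, hX, hY, by omega, by omega, ?_⟩
    rw [hh]
    rcases hcase with h1 | ⟨h1, h2, h3, h4, h5⟩ | h1
    · exact Or.inl h1
    · exact Or.inr (Or.inl ⟨hu, hv, h1, h2, h3, h4, h5⟩)
    · exact Or.inr (Or.inr h1)
  · right
    refine ⟨⟨d, u, v, X, Y, ν, hX, hY, hν, ?_, hc⟩, by omega⟩
    rcases hper with ⟨h1, h2⟩ | ⟨h1, h2⟩
    · exact Or.inl ⟨hX.isPeriodic hh hXc h1, hY.isNearPeriodic hh hYc h2⟩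
    · exact Or.inr ⟨hY.isPeriodic hh hYc h1, hX.isNearPeriodic hh hXc h2⟩

/-- By `Config.shape` the sets are coset progressions, or `T` is a four-term progression in a cyclic
group of order twelve. The fibres of coset progressions form a chain, to which `CosetChain.chainEnd`
applies, possibly after reversing both progressions. -/
theorem Config.isPairShape {S T : Finset G} {μ : ℕ}
    (C : Config (QuotientAddGroup.mk' H) S T h μ) :
    (μ = 0 ∧ Nat.card G = 12 ∧ S.card = 4 ∧ T.card = 4 ∧
      ∃ c p, AddSubgroup.zmultiples c = ⊤ ∧ T = run p c 4) ∨ IsPairShape H μ S T := by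
  refine C.shape.imp_right ?_
  rintro ⟨p, q, y, u, v, hv, hS, hSc, hT, hTc, hR⟩
  have N := C.cosetChain hS hSc hT hTc hR hv
  have hfin : Finite H := by have := C.fin; rwa [QuotientAddGroup.ker_mk'] at this
  have hh : Nat.card H = h := by have := C.card_ker; rwa [QuotientAddGroup.ker_mk'] at this
  have hX := isCosetProgression_fib hS hSc
  have hY := isCosetProgression_fib hT hTc
  have hb := N.holes.sum_b_le
  have hE := N.chainEnd
  rw [QuotientAddGroup.ker_mk'] at hE
  rcases hE with hE | hE
  · exact isPairShape_of_chainEnd hh N.holes.hu hv hX hY N.card_A N.card_B hb hE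
  · exact isPairShape_of_chainEnd hh N.holes.hu hv hX.reverse hY.reverse (fun i => N.card_A _)
      (fun i => N.card_B _) (by
        rwa [Finset.sum_flip (n := v) (fun j => h - (fib (QuotientAddGroup.mk' H) T
          (q + j • y)).card)]) hE

end Translation

/-! ### Connectivity -/

section Connectivity

variable {G : Type*} [AddCommGroup G] [DecidableEq G] {S : Finset G}

theorem isAdmissible_iff {X : Finset G} : IsAdmissible 2 S X ↔ Adm S X := by
  unfold IsAdmissible Adm
  apply and_congr_right'
  have h1 : ((2 : ℕ) : ℕ∞) ≤ (exterior S X).encard ↔ 1 < (exterior S X).encard := by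
    rw [← ENat.add_one_le_iff (by simp)]
    norm_num
  rw [h1, Set.one_lt_encard_iff]
  constructor
  · rintro ⟨z, w, hz, hw, hzw⟩
    exact ⟨z, w, hzw, hz, hw⟩
  · rintro ⟨z, w, hzw, hz, hw⟩
    exact ⟨z, w, hz, hw, hzw⟩

theorem card_boundary_add (h0 : (0 : G) ∈ S) (X : Finset G) :
    (boundary S X).card + X.card = (X + S).card := by
  have hsub : X ⊆ X + S := fun x hx => by
    simpa using Finset.add_mem_add hx h0
  have := Finset.card_sdiff_add_card_eq_card hsub
  exact this

theorem connectivity_le {X : Finset G} (hX : Adm S X) : connectivity 2 S ≤ (boundary S X).card := by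
  have hX' := isAdmissible_iff.2 hX
  unfold connectivity
  rw [if_pos ⟨X, hX'⟩]
  exact Nat.sInf_le ⟨X, hX', rfl⟩

theorem le_connectivity {X : Finset G} (hX : Adm S X) {m : ℕ}
    (h : ∀ Y, Adm S Y → m ≤ (boundary S Y).card) : m ≤ connectivity 2 S := by
  have hX' := isAdmissible_iff.2 hX
  unfold connectivity
  rw [if_pos ⟨X, hX'⟩]
  refine le_csInf ⟨_, X, hX', rfl⟩ ?_
  rintro _ ⟨Y, hY, rfl⟩
  exact h Y (isAdmissible_iff.1 hY)

/-- The connectivity of a four-term progression containing zero in a cyclic group of order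
twelve. -/
theorem connectivity_run {c p : G} (hG : Nat.card G = 12) (hc : AddSubgroup.zmultiples c = ⊤)
    (h0 : (0 : G) ∈ run p c 4) : connectivity 2 (run p c 4) = 3 := by
  have hfin : Finite G := Nat.finite_of_card_ne_zero (by omega)
  have hord : addOrderOf c = 12 := by
    rw [← Nat.card_zmultiples, hc, AddSubgroup.card_top, hG]
  have hc0 : c ≠ 0 := by
    rintro rfl
    rw [addOrderOf_zero] at hord
    omega
  have hX2 : ({0, c} : Finset G).card = 2 := Finset.card_pair hc0.symm
  have hX5 : (({0, c} : Finset G) + run p c 4).card ≤ 5 := by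
    have hsub : ({0, c} : Finset G) + run p c 4 ⊆ run p c 5 := by
      intro z hz
      obtain ⟨x, hx, y, hy, rfl⟩ := Finset.mem_add.1 hz
      obtain ⟨i, hi, rfl⟩ := mem_run.1 hy
      rw [Finset.mem_insert, Finset.mem_singleton] at hx
      rcases hx with rfl | rfl
      · exact mem_run.2 ⟨i, by omega, by rw [zero_add]⟩
      · exact mem_run.2 ⟨i + 1, by omega, by rw [succ_nsmul]; abel⟩
    refine (Finset.card_le_card hsub).trans (Finset.card_image_le.trans ?_)
    rw [Finset.card_range]
  have hadm : Adm (run p c 4) {0, c} := adm_of_card hX2.ge (by omega)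
  apply le_antisymm
  · have h1 := connectivity_le hadm
    have h2 := card_boundary_add h0 {0, c}
    omega
  · apply le_connectivity hadm
    rintro Y ⟨hY, z, _, _, hz, _⟩
    have h1 := card_add_card_run_le (p := p) hc (Finset.card_pos.1 (by omega : 0 < Y.card)) 3
      ⟨z, hz⟩
    rw [show 3 + 1 = 4 from rfl] at h1
    have h2 := card_boundary_add h0 Y
    omega

theorem closure_run {c p : G} (hc : AddSubgroup.zmultiples c = ⊤) {n : ℕ} :
    AddSubgroup.closure (run p c (n + 2) : Set G) = ⊤ := by
  rw [eq_top_iff, ← hc, AddSubgroup.zmultiples_le]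
  have h1 : p ∈ AddSubgroup.closure (run p c (n + 2) : Set G) :=
    AddSubgroup.subset_closure (Finset.mem_coe.2 (mem_run.2 ⟨0, by omega, by simp⟩))
  have h2 : p + c ∈ AddSubgroup.closure (run p c (n + 2) : Set G) :=
    AddSubgroup.subset_closure (Finset.mem_coe.2 (mem_run.2 ⟨1, by omega, by simp⟩))
  simpa using sub_mem h2 h1

theorem vadd_run (a p c : G) (n : ℕ) : a +ᵥ run p c n = run (a + p) c n := by
  ext z
  simp only [Finset.mem_vadd_finset, mem_run, vadd_eq_add]
  constructor
  · rintro ⟨_, ⟨i, hi, rfl⟩, rfl⟩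
    exact ⟨i, hi, by rw [add_assoc]⟩
  · rintro ⟨i, hi, rfl⟩
    exact ⟨_, ⟨i, hi, rfl⟩, by rw [add_assoc]⟩

end Connectivity

/-! ### From hyper-atoms to configurations -/

section HyperAtom

variable {G : Type*} [AddCommGroup G] [DecidableEq G] {S T : Finset G} {H : AddSubgroup G}
variable [DecidableEq (G ⧸ H)] {μ : ℕ}

theorem coe_pre_elts [Finite H] (L : AddSubgroup (G ⧸ H)) [Finite L] :
    (pre (QuotientAddGroup.mk' H) (elts L) : Set G) = L.comap (QuotientAddGroup.mk' H) := by
  ext x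
  rw [Finset.mem_coe, mem_pre, mem_elts]
  rfl

/-- A union of cosets is admissible if its sum with `S` misses a coset. -/
theorem adm_pre [Finite H] (hh : 2 ≤ Nat.card H) {X : Finset (G ⧸ H)} (hX : X.Nonempty)
    (hz : ∃ z, z ∉ X + S.image (QuotientAddGroup.mk' H)) :
    Adm S (pre (QuotientAddGroup.mk' H) X) := by
  refine ⟨?_, ?_⟩
  · rw [card_pre_mk]
    have := Nat.mul_le_mul hh (Finset.card_pos.2 hX)
    omega
  · obtain ⟨z, hz⟩ := hz
    obtain ⟨x, y, hxy, he⟩ := Finset.card_eq_two.1 (Finset.exists_subset_card_eq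
      (show 2 ≤ (pre (QuotientAddGroup.mk' H) {z}).card by
        rw [card_pre_mk, Finset.card_singleton]; omega)).choose_spec.2
    have hsub := (Finset.exists_subset_card_eq
      (show 2 ≤ (pre (QuotientAddGroup.mk' H) {z}).card by
        rw [card_pre_mk, Finset.card_singleton]; omega)).choose_spec.1
    have hmem : ∀ w ∈ pre (QuotientAddGroup.mk' H) {z},
        w ∉ pre (QuotientAddGroup.mk' H) X + S := by
      intro w hw hw'
      rw [pre_add, mem_pre] at hw'
      rw [mem_pre, Finset.mem_singleton] at hw
      exact hz (hw ▸ hw')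
    exact ⟨x, y, hxy, hmem _ (hsub (by rw [he]; simp)), hmem _ (hsub (by rw [he]; simp))⟩

/-- The combinatorial content of being a hyper-atom. Since `H` is a `2`-fragment, the connectivity
of `S` is `|H| (|φ(S)| - 1)`. Applied to unions of cosets, this is the first half of the rigidity of
`φ(S)`; the second half expresses the maximality of `H` among the subgroups that are fragments. -/
theorem IsHyperAtom.config (h0 : (0 : G) ∈ S) (hgen : AddSubgroup.closure (S : Set G) = ⊤)
    (hH : IsHyperAtom S H) (hμ : μ ≤ 1) (hS : 3 ≤ S.card + μ) (hT : 4 ≤ T.card + 2 * μ)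
    (hST : S.card ≤ T.card) (haper : stab (T + S) = ⊥)
    (hcard : (T + S).card + μ = S.card + T.card)
    (hsmall : 3 * ((T + S).card : ℕ∞) ≤ 2 * ENat.card G + 2 * (μ : ℕ∞)) :
    Config (QuotientAddGroup.mk' H) S T (Nat.card H) μ := by
  obtain ⟨X₀, hX₀, hadm₀, hfrag⟩ := hH.prop
  rw [isAdmissible_iff] at hadm₀
  have hfin : Finite H := by
    have := X₀.finite_toSet
    rw [hX₀] at this
    exact this.to_subtype
  set φ := QuotientAddGroup.mk' H with hφ
  have hsurj : Function.Surjective φ := QuotientAddGroup.mk'_surjective H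
  have hker : Nat.card φ.ker = Nat.card H := by rw [hφ, QuotientAddGroup.ker_mk']
  have hX₀e : X₀ = pre φ {0} := by
    ext x
    rw [mem_pre, Finset.mem_singleton, ← Finset.mem_coe, hX₀, SetLike.mem_coe]
    exact (QuotientAddGroup.eq_zero_iff x).symm
  have hX₀c : X₀.card = Nat.card H := by
    rw [hX₀e, card_pre_mk, Finset.card_singleton, mul_one]
  have hX₀S : X₀ + S = pre φ (S.image φ) := by
    rw [hX₀e, pre_add, Finset.singleton_add]
    simp
  have hX₀Sc : (X₀ + S).card = Nat.card H * (S.image φ).card := by rw [hX₀S, card_pre_mk]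
  have hh : 2 ≤ Nat.card H := hX₀c ▸ hadm₀.1
  have hS0 : (0 : G ⧸ H) ∈ S.image φ := by
    have := Finset.mem_image_of_mem φ h0
    rwa [map_zero] at this
  have hclos : AddSubgroup.closure (S.image φ : Set (G ⧸ H)) = ⊤ := by
    rw [Finset.coe_image, ← AddMonoidHom.map_closure, hgen, ← AddMonoidHom.range_eq_map,
      AddMonoidHom.range_eq_top]
    exact hsurj
  have hzS : ∃ z, z ∉ S.image φ := by
    obtain ⟨_, z, _, _, hz, _⟩ := hadm₀
    rw [hX₀S, mem_pre] at hz
    exact ⟨_, hz⟩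
  have hs2 : 2 ≤ (S.image φ).card := by
    by_contra hlt
    obtain ⟨z, hz⟩ := hzS
    have hone : S.image φ = {0} := by
      apply (Finset.eq_of_subset_of_card_le (Finset.singleton_subset_iff.2 hS0) _).symm
      rw [Finset.card_singleton]
      omega
    rw [hone, Finset.coe_singleton, AddSubgroup.closure_singleton_zero] at hclos
    have : z ∈ (⊥ : AddSubgroup (G ⧸ H)) := by rw [hclos]; trivial
    rw [AddSubgroup.mem_bot] at this
    exact hz (this ▸ hS0)
  -- the boundary of the fragment `H` consists of the other cosets met by `S`
  have hcon : connectivity 2 S + Nat.card H = Nat.card H * (S.image φ).card := by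
    rw [← hfrag, ← hX₀Sc, ← card_boundary_add h0 X₀, hX₀c]
  have htest : ∀ X, Adm S X →
      X.card + Nat.card H * (S.image φ).card ≤ (X + S).card + Nat.card H := by
    intro X hX
    have h1 := connectivity_le hX
    have h2 := card_boundary_add h0 X
    omega
  have hcardG : Finite G → Nat.card G = Nat.card H * Nat.card (G ⧸ H) := fun _ => by
    rw [mul_comm]; exact AddSubgroup.card_eq_card_quotient_mul_card_addSubgroup H
  have hsmallG : Finite G → 3 * (T + S).card ≤ 2 * Nat.card G + 2 * μ := fun _ => by
    rw [ENat.card_eq_coe_natCard] at hsmall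
    exact_mod_cast hsmall
  -- if `G` is finite, then `H` has index at least three, and the size bound leaves two elements
  -- outside `T + S`
  have hadmT : Adm S T := by
    rcases finite_or_infinite G with hG | hG
    · apply adm_of_card (by omega)
      have h1 := hsmallG hG
      have h2 := hcardG hG
      have h3 : 3 ≤ Nat.card (G ⧸ H) := by
        have := Fintype.ofFinite (G ⧸ H)
        obtain ⟨z, hz⟩ := hzS
        have : (S.image φ).card < Nat.card (G ⧸ H) := by
          rw [Nat.card_eq_fintype_card]
          exact Finset.card_lt_univ_of_notMem hz
        omega
      have h4 := Nat.mul_le_mul hh h3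
      omega
    · obtain ⟨z, hz⟩ := Infinite.exists_notMem_finset (T + S)
      obtain ⟨w, hw⟩ := Infinite.exists_notMem_finset (insert z (T + S))
      rw [Finset.mem_insert, not_or] at hw
      exact ⟨by omega, z, w, Ne.symm hw.1, hz, hw.2⟩
  have hrig : IsRigid (S.image φ) := by
    refine ⟨hS0, hclos, hs2, fun X hX hz => ?_, fun L _ hL hz => ?_, fun hQ => ?_⟩
    · have h1 := htest _ (adm_pre hh hX hz)
      rw [pre_add, card_pre_mk, card_pre_mk, ← mul_add, ← Nat.mul_succ] at h1
      exact Nat.le_of_mul_le_mul_left h1 (by omega)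
    · -- otherwise the preimage of `L` is a larger subgroup that is a fragment
      by_contra hlt
      apply hL
      rw [add_comm (S.image φ)] at hlt hz
      have hadm := adm_pre hh ⟨0, mem_elts.2 (zero_mem L)⟩ hz
      have hfragK : IsSubgroupFragment 2 S (L.comap φ) := by
        refine ⟨_, coe_pre_elts L, isAdmissible_iff.2 hadm, ?_⟩
        apply le_antisymm _ (connectivity_le hadm)
        change (boundary S (pre φ (elts L))).card ≤ connectivity 2 S
        have h1 := card_boundary_add h0 (pre φ (elts L))
        rw [pre_add, card_pre_mk, card_pre_mk, card_elts] at h1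
        have h2 : Nat.card H * ((elts L + S.image φ).card + 1) ≤
            Nat.card H * ((S.image φ).card + Nat.card L) := Nat.mul_le_mul_left _ (by omega)
        rw [mul_add, mul_add, mul_one] at h2
        omega
      have hle : H ≤ L.comap φ := by
        intro x hx
        rw [AddSubgroup.mem_comap, show φ x = 0 from (QuotientAddGroup.eq_zero_iff x).2 hx]
        exact zero_mem L
      have hge := hH.le_of_ge hfragK hle
      rw [eq_bot_iff]
      intro q hq
      obtain ⟨x, rfl⟩ := hsurj q
      rw [AddSubgroup.mem_bot]
      exact (QuotientAddGroup.eq_zero_iff x).2 (hge hq)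
    -- the connectivity bounds `|H| (|φ(S)| - 1)` by `|T + S| - |T| = |S| - μ`, which the size bound
    -- limits to a third of `|G|`
    · have hG : Finite G := Finite.of_equiv _
        (AddSubgroup.addGroupEquivQuotientProdAddSubgroup (s := H)).symm
      have h1 := hsmallG hG
      have h2 := hcardG hG
      have h3 := htest T hadmT
      obtain ⟨k, hk⟩ := Nat.exists_eq_add_of_le' (show 1 ≤ (S.image φ).card by omega)
      rw [hk] at h3 ⊢
      rw [mul_add, mul_one] at h3
      have h4 : Nat.card H * (3 * k) ≤ Nat.card H * Nat.card (G ⧸ H) := by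
        have : Nat.card H * (3 * k) = 3 * (Nat.card H * k) := by ring
        omega
      have := Nat.le_of_mul_le_mul_left h4 (by omega)
      omega
  exact ⟨hsurj, by rw [hφ, QuotientAddGroup.ker_mk']; exact hfin, hker, hh, hrig, htest, hadmT, hμ,
    hS, hT, hST, haper, hcard, fun hQ => by
      have hG : Finite G := Finite.of_equiv _
        (AddSubgroup.addGroupEquivQuotientProdAddSubgroup (s := H)).symm
      rw [← hcardG hG]; exact hsmallG hG⟩

end HyperAtom

end SmallSumset

theorem mainTheorem2 {G : Type*} [AddCommGroup G] [DecidableEq G]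
    (μ : ℕ) (hμ : μ = 0 ∨ μ = 1)
    (S : Finset G) (h0 : (0 : G) ∈ S) (hgen : AddSubgroup.closure (S : Set G) = ⊤)
    (hdeg : IsDegenerate S) (H : AddSubgroup G) (hH : IsHyperAtom S H)
    (T : Finset G) (hS : 3 - μ ≤ S.card) (hT : max (4 - 2 * μ) S.card ≤ T.card)
    (haper : IsAperiodic (S + T))
    (hcard : (S + T).card + μ = S.card + T.card)
    (hsmall : 3 * ((S + T).card : ℕ∞) ≤ 2 * ENat.card G + 2 * (μ : ℕ∞)) :
    (μ = 0 ∧ Nat.card G = 12 ∧ 3 * S.card = 12 ∧ 3 * T.card = 12 ∧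
      ∀ a ∈ T, AddSubgroup.closure ((-a +ᵥ T : Finset G) : Set G) = ⊤ ∧
        4 * connectivity 2 (-a +ᵥ T) = 12) ∨
    (μ = 0 ∧ IsEssentialPair H S T) ∨
    ((∃ (d : G ⧸ H) (u t : ℕ) (X Y : ℕ → Finset G) (ν : ℕ),
        IsCosetProgression H d S u X ∧ IsCosetProgression H d T t Y ∧
        ν ≤ 1 - μ ∧
        ((IsPeriodic H (S \ X u) ∧ IsNearPeriodic H ν (T \ Y t)) ∨
          (IsPeriodic H (T \ Y t) ∧ IsNearPeriodic H ν (S \ X u))) ∧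
        (Y t + X u).card + ν + μ = (Y t).card + (X u).card) ∧
      ((T : Set G) + (H : Set G)).ncard + μ ≤ T.card + Nat.card H) := by
  classical
  obtain ⟨hS', hT'⟩ : 3 ≤ S.card + μ ∧ 4 ≤ T.card + 2 * μ := by
    have := le_max_left (4 - 2 * μ) S.card
    omega
  have haper' : stab (T + S) = ⊥ := by
    rw [add_comm]
    exact haper _ (isPeriodic_iff_le_stab.2 le_rfl)
  rw [add_comm S T] at hcard hsmall
  have C := hH.config h0 hgen (by omega) hS' hT' ((le_max_right _ _).trans hT) haper' hcard hsmall
  refine C.isPairShape.imp_left ?_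
  rintro ⟨hμ0, hG, hS4, hT4, c, p, hc, rfl⟩
  refine ⟨hμ0, hG, by omega, by omega, fun a ha => ?_⟩
  have h0' : (0 : G) ∈ -a +ᵥ run p c 4 := by
    have := Finset.vadd_mem_vadd_finset (a := -a) ha
    rwa [vadd_eq_add, neg_add_cancel] at this
  rw [vadd_run] at h0' ⊢
  exact ⟨closure_run hc, by rw [connectivity_run hG hc h0']⟩
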